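/- Let $H$ be a finite-dimensional Hopf algebra over a field $k$ with bijective antipode $S$, with $\Delta(h)=h_1\otimes h_2$, and let $G=\mathrm{Aut}_{Hopf}(H)\times \mathrm{Aut}_{Hopf}(H)$ be the group with multiplication $(\alpha,\beta)*(\gamma,\delta)=(\alpha\gamma,\ \delta\gamma^{-1}\beta\gamma)$. Let $H^*$ have the convolution product $(pq)(h)=p(h_1)q(h_2)$, write $p\mapsto p_1\otimes p_2$ for its comultiplication, $p(hl)=p_1(h)p_2(l)$, and put $(h\rightharpoonup p)(l)=p(lh)$, $(p\leftharpoonup h)(l)=p(hl)$. For $(\alpha,\beta)\in G$ let $H^*\bowtie H(\alpha,\beta)$ be the diagonal crossed product: the associative algebra on $H^*\otimes H$ with unit $\varepsilon\bowtie 1$ and product $$(p\bowtie h)(q\bowtie l)=p\,\bigl(\alpha(h_1)\rightharpoonup q\leftharpoonup S^{-1}(\beta(h_3))\bigr)\bowtie h_2l .$$ Theorem. The family $DT(H)=\{H^*\bowtie H(\alpha,\beta)\}_{(\alpha,\beta)\in G}$ is a quasitriangular T-coalgebra over $G$ with the following structure. * Comultiplications $\Delta_{(\alpha,\beta),(\gamma,\delta)}:H^*\bowtie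 H((\alpha,\beta)*(\gamma,\delta))\to (H^*\bowtie H(\alpha,\beta))\otimes (H^*\bowtie H(\gamma,\delta))$, $\ p\bowtie h\mapsto (p_2\bowtie\gamma(h_1))\otimes(p_1\bowtie\gamma^{-1}\beta\gamma(h_2))$. * Counit that of the Drinfeld double $D(H)=H^*\bowtie H(\mathrm{id},\mathrm{id})$: $\varepsilon(p\bowtie h)=p(1)\varepsilon(h)$. * Conjugation $\varphi_{(\alpha,\beta)}^{(\gamma,\delta)}:H^*\bowtie H(\gamma,\delta)\to H^*\bowtie H((\alpha,\beta)*(\gamma,\delta)*(\alpha,\beta)^{-1})$, $\ p\bowtie h\mapsto p\circ\beta\alpha^{-1}\bowtie\alpha\gamma^{-1}\beta^{-1}\gamma(h)$. * Antipode $S_{(\alpha,\beta)}:H^*\bowtie H(\alpha,\beta)\to H^*\bowtie H((\alpha,\beta)^{-1})$, $\ p\bowtie h\mapsto(\varepsilon\bowtie\alpha\beta(S(h)))\cdot(p\circ S^{-1}\bowtie 1)$, the product being that of $H^*\bowtie H((\alpha,\beta)^{-1})$. * Universal $R$-matrix $R_{(\alpha,\beta),(\gamma,\delta)}=\sum_i(\varepsilon\bowtie\beta^{-1}(e_i))\otimes(e^i\bowtie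 1)\in (H^*\bowtie H(\alpha,\beta))\otimes (H^*\bowtie H(\gamma,\delta))$, for any basis $\{e_i\}$ of $H$ with dual basis $\{e^i\}$. Here a T-coalgebra over a group $\pi$ consists of unital associative algebras $A_a$ ($a\in\pi$), unital algebra maps $\Delta_{a,b}:A_{ab}\to A_a\otimes A_b$ and $\varepsilon:A_1\to k$ with $(\Delta_{a,b}\otimes \mathrm{id})\Delta_{ab,c}=(\mathrm{id}\otimes\Delta_{b,c})\Delta_{a,bc}$ and $(\varepsilon\otimes \mathrm{id})\Delta_{1,a}=\mathrm{id}=(\mathrm{id}\otimes\varepsilon)\Delta_{a,1}$, linear maps $S_a:A_a\to A_{a^{-1}}$ with $m_a(S_{a^{-1}}\otimes \mathrm{id})\Delta_{a^{-1},a}=\varepsilon(\cdot)1_a=m_a(\mathrm{id}\otimes S_{a^{-1}})\Delta_{a,a^{-1}}$, where $m_a$ is the multiplication and $1_a$ the unit of $A_a$, and algebra isomorphisms $\varphi_c:A_a\to A_{cac^{-1}}$ with $\varphi_{cd}=\varphi_c\varphi_d$, $(\varphi_c\otimes\varphi_c)\Delta_{a,b}=\Delta_{cac^{-1},cbc^{-1}}\varphi_c$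 and $\varepsilon\varphi_c=\varepsilon$. It is quasitriangular, with universal $R$-matrix the family $R_{a,b}\in A_a\otimes A_b$, if all $R_{a,b}$ are invertible and, for all $a,b,c\in\pi$ and $x\in A_{ab}$, $$R_{a,b}\,\Delta_{a,b}(x)=\sigma\bigl((\varphi_{a^{-1}}\otimes \mathrm{id})\Delta_{aba^{-1},a}(x)\bigr)R_{a,b},$$ $$(\mathrm{id}\otimes\Delta_{b,c})(R_{a,bc})=(R_{a,c})_{1b3}(R_{a,b})_{12c},$$ $$(\Delta_{a,b}\otimes \mathrm{id})(R_{ab,c})=\bigl((\mathrm{id}\otimes\varphi_{b^{-1}})(R_{a,bcb^{-1}})\bigr)_{1b3}(R_{b,c})_{a23},$$ $$(\varphi_c\otimes\varphi_c)(R_{a,b})=R_{cac^{-1},cbc^{-1}},$$ where $\sigma$ is the flip, and $1b3$, $12c$, $a23$ mean that the units of $A_b$, $A_c$, $A_a$ are inserted in the second, third and first tensor factor, respectively. -/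

import Mathlib

open scoped TensorProduct

/-! ## T-coalgebras over a group -/

/-- The structure maps of a T-coalgebra over a group `π` (before imposing any law), on a family
`A` of unital associative algebras indexed by `π`. -/
structure TCoalgebraData (k : Type*) {π : Type*} (A : π → Type*) [Field k] [Group π]
    [∀ a, Ring (A a)] [∀ a, Algebra k (A a)] where
  /-- the comultiplications `Δ_{a,b} : A_{ab} → A_a ⊗ A_b` -/
  comul : ∀ a b : π, A (a * b) →ₗ[k] A a ⊗[k] A b
  /-- the counit `ε : A_1 → k` -/
  counit : A 1 →ₗ[k] k
  /-- the antipode `S_a : A_a → A_{a⁻¹}` -/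
  antipode : ∀ a : π, A a →ₗ[k] A a⁻¹
  /-- the conjugation `φ_c : A_a → A_{c a c⁻¹}` -/
  conj : ∀ c a : π, A a →ₗ[k] A (c * a * c⁻¹)

namespace TCoalgebraData

variable {k : Type*} {π : Type*} {A : π → Type*} [Field k] [Group π]
  [∀ a, Ring (A a)] [∀ a, Algebra k (A a)]

/-- The axioms of a T-coalgebra (crossed Hopf group-coalgebra). Here `AlgEquiv.cast` only
identifies `A a` with `A b` for two names `a = b` of the same group element. -/
structure IsTCoalgebra (D : TCoalgebraData k A) : Prop where
  /-- each `Δ_{a,b}` is a unital algebra morphism -/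
  comul_one : ∀ a b : π, D.comul a b 1 = 1
  comul_mul : ∀ (a b : π) (x y : A (a * b)),
    D.comul a b (x * y) = D.comul a b x * D.comul a b y
  /-- `(Δ_{a,b} ⊗ id) Δ_{ab,c} = (id ⊗ Δ_{b,c}) Δ_{a,bc}` -/
  coassoc : ∀ (a b c : π) (x : A (a * b * c)),
    TensorProduct.assoc k (A a) (A b) (A c)
        ((D.comul a b).rTensor (A c) (D.comul (a * b) c x)) =
      (D.comul b c).lTensor (A a)
        (D.comul a (b * c) (AlgEquiv.cast (R := k) (A := A) (mul_assoc a b c) x))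
  /-- `ε` is a unital algebra morphism -/
  counit_one : D.counit 1 = 1
  counit_mul : ∀ x y : A 1, D.counit (x * y) = D.counit x * D.counit y
  /-- `(ε ⊗ id) Δ_{1,a} = id` -/
  counit_comul : ∀ (a : π) (x : A a),
    TensorProduct.lid k (A a) (D.counit.rTensor (A a)
      (D.comul 1 a (AlgEquiv.cast (R := k) (A := A) (one_mul a).symm x))) = x
  /-- `(id ⊗ ε) Δ_{a,1} = id` -/
  comul_counit : ∀ (a : π) (x : A a),
    TensorProduct.rid k (A a) (D.counit.lTensor (A a)
      (D.comul a 1 (AlgEquiv.cast (R := k) (A := A) (mul_one a).symm x))) = x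
  /-- `m_a (S_{a⁻¹} ⊗ id) Δ_{a⁻¹,a} = ε(-) 1_a` -/
  antipode_left : ∀ (a : π) (x : A 1),
    LinearMap.mul' k (A a)
        (((AlgEquiv.cast (R := k) (A := A) (inv_inv a)).toLinearMap ∘ₗ D.antipode a⁻¹).rTensor (A a)
          (D.comul a⁻¹ a (AlgEquiv.cast (R := k) (A := A) (inv_mul_cancel a).symm x))) =
      D.counit x • (1 : A a)
  /-- `m_a (id ⊗ S_{a⁻¹}) Δ_{a,a⁻¹} = ε(-) 1_a` -/
  antipode_right : ∀ (a : π) (x : A 1),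
    LinearMap.mul' k (A a)
        (((AlgEquiv.cast (R := k) (A := A) (inv_inv a)).toLinearMap ∘ₗ D.antipode a⁻¹).lTensor (A a)
          (D.comul a a⁻¹ (AlgEquiv.cast (R := k) (A := A) (mul_inv_cancel a).symm x))) =
      D.counit x • (1 : A a)
  /-- each `φ_c : A_a → A_{c a c⁻¹}` is an isomorphism of unital algebras -/
  conj_one : ∀ c a : π, D.conj c a 1 = 1
  conj_mul : ∀ (c a : π) (x y : A a), D.conj c a (x * y) = D.conj c a x * D.conj c a y
  conj_bijective : ∀ c a : π, Function.Bijective (D.conj c a)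
  /-- `φ_{cd} = φ_c φ_d` -/
  conj_conj : ∀ (c d a : π) (x : A a),
    D.conj (c * d) a x =
      AlgEquiv.cast (R := k) (A := A)
        (show c * (d * a * d⁻¹) * c⁻¹ = c * d * a * (c * d)⁻¹ by group)
        (D.conj c (d * a * d⁻¹) (D.conj d a x))
  /-- `(φ_c ⊗ φ_c) Δ_{a,b} = Δ_{cac⁻¹,cbc⁻¹} φ_c` -/
  conj_comul : ∀ (c a b : π) (x : A (a * b)),
    TensorProduct.map (D.conj c a) (D.conj c b) (D.comul a b x) =
      D.comul (c * a * c⁻¹) (c * b * c⁻¹)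
        (AlgEquiv.cast (R := k) (A := A)
          (show c * (a * b) * c⁻¹ = c * a * c⁻¹ * (c * b * c⁻¹) by group)
          (D.conj c (a * b) x))
  /-- `ε φ_c = ε` -/
  conj_counit : ∀ (c : π) (x : A 1),
    D.counit (AlgEquiv.cast (R := k) (A := A) (show c * 1 * c⁻¹ = 1 by group) (D.conj c 1 x)) =
      D.counit x

/-- `(D, R)` is a quasitriangular T-coalgebra: `D` is a T-coalgebra and the family
`R_{a,b} ∈ A_a ⊗ A_b` is a universal `R`-matrix. -/
structure IsQuasitriangular (D : TCoalgebraData k A) (R : ∀ a b : π, A a ⊗[k] A b) : Prop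
    extends D.IsTCoalgebra where
  /-- `R_{a,b}` is invertible -/
  isUnit_R : ∀ a b : π, IsUnit (R a b)
  /-- `R_{a,b} Δ_{a,b}(x) = σ((φ_{a⁻¹} ⊗ id) Δ_{aba⁻¹,a}(x)) R_{a,b}`, with `σ` the flip -/
  R_mul_comul : ∀ (a b : π) (x : A (a * b)),
    R a b * D.comul a b x =
      TensorProduct.comm k (A b) (A a)
        (((AlgEquiv.cast (R := k) (A := A)
            (show a⁻¹ * (a * b * a⁻¹) * a⁻¹⁻¹ = b by group)).toLinearMap ∘ₗ
              D.conj a⁻¹ (a * b * a⁻¹)).rTensor (A a)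
          (D.comul (a * b * a⁻¹) a
            (AlgEquiv.cast (R := k) (A := A)
              (show a * b = a * b * a⁻¹ * a by group) x))) * R a b
  /-- `(id ⊗ Δ_{b,c})(R_{a,bc}) = (R_{a,c})_{1b3} (R_{a,b})_{12c}` -/
  lTensor_comul_R : ∀ a b c : π,
    (D.comul b c).lTensor (A a) (R a (b * c)) =
      (Algebra.TensorProduct.includeRight : A c →ₐ[k] A b ⊗[k] A c).toLinearMap.lTensor (A a)
          (R a c) *
        (Algebra.TensorProduct.includeLeft : A b →ₐ[k] A b ⊗[k] A c).toLinearMap.lTensor (A a)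
          (R a b)
  /-- `(Δ_{a,b} ⊗ id)(R_{ab,c}) = ((id ⊗ φ_{b⁻¹})(R_{a,bcb⁻¹}))_{1b3} (R_{b,c})_{a23}` -/
  rTensor_comul_R : ∀ a b c : π,
    TensorProduct.assoc k (A a) (A b) (A c) ((D.comul a b).rTensor (A c) (R (a * b) c)) =
      (Algebra.TensorProduct.includeRight : A c →ₐ[k] A b ⊗[k] A c).toLinearMap.lTensor (A a)
          (((AlgEquiv.cast (R := k) (A := A)
              (show b⁻¹ * (b * c * b⁻¹) * b⁻¹⁻¹ = c by group)).toLinearMap ∘ₗ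
                D.conj b⁻¹ (b * c * b⁻¹)).lTensor (A a) (R a (b * c * b⁻¹))) *
        ((1 : A a) ⊗ₜ[k] R b c)
  /-- `(φ_c ⊗ φ_c)(R_{a,b}) = R_{cac⁻¹,cbc⁻¹}` -/
  conj_R : ∀ c a b : π,
    TensorProduct.map (D.conj c a) (D.conj c b) (R a b) = R (c * a * c⁻¹) (c * b * c⁻¹)

end TCoalgebraData

namespace TurHopf

open WithConv Coalgebra Module

/-! ## The group `G = Aut_Hopf(H) × Aut_Hopf(H)` with its twisted multiplication -/

section Aut

variable {k H : Type*} [Field k] [Ring H] [HopfAlgebra k H]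

/-- Hopf automorphisms of `H` (a bialgebra automorphism commutes with the antipode), as a group
under composition: `(a * b) x = a (b x)`. -/
instance hopfAutGroup : Group (H ≃ₐc[k] H) where
  mul a b := b.trans a
  one := BialgEquiv.refl k H
  inv a := a.symm
  mul_assoc _ _ _ := rfl
  one_mul _ := rfl
  mul_one _ := rfl
  inv_mul_cancel a := BialgEquiv.ext a.symm_apply_apply

end Aut

/-- Pairs `(α, β)` of Hopf automorphisms of `H`. -/
@[ext]
structure AutPair (k H : Type*) [Field k] [Ring H] [HopfAlgebra k H] where
  /-- the first component `α` -/
  fst : H ≃ₐc[k] H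
  /-- the second component `β` -/
  snd : H ≃ₐc[k] H

/-- `(α, β) * (γ, δ) = (α γ, δ γ⁻¹ β γ)`, with unit `(id, id)` and
`(α, β)⁻¹ = (α⁻¹, α β⁻¹ α⁻¹)`. -/
instance autPairGroup {k H : Type*} [Field k] [Ring H] [HopfAlgebra k H] :
    Group (AutPair k H) where
  mul x y := ⟨x.fst * y.fst, y.snd * y.fst⁻¹ * x.snd * y.fst⟩
  one := ⟨1, 1⟩
  inv x := ⟨x.fst⁻¹, x.fst * x.snd⁻¹ * x.fst⁻¹⟩
  mul_assoc x y z := by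
    apply AutPair.ext
    · exact mul_assoc _ _ _
    · change z.snd * z.fst⁻¹ * (y.snd * y.fst⁻¹ * x.snd * y.fst) * z.fst
        = (z.snd * z.fst⁻¹ * y.snd * z.fst) * (y.fst * z.fst)⁻¹ * x.snd * (y.fst * z.fst)
      group
  one_mul x := by
    apply AutPair.ext
    · exact one_mul _
    · change x.snd * x.fst⁻¹ * 1 * x.fst = x.snd
      group
  mul_one x := by
    apply AutPair.ext
    · exact mul_one _
    · change 1 * 1⁻¹ * x.snd * 1 = x.snd
      group
  inv_mul_cancel x := by
    apply AutPair.ext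
    · exact inv_mul_cancel _
    · change x.snd * x.fst⁻¹ * (x.fst * x.snd⁻¹ * x.fst⁻¹) * x.fst = 1
      group

noncomputable section

/-! ## The dual algebra `H^*` and the regular actions of `H` on it -/

section Dual

variable {k H : Type*} [Field k] [Ring H] [HopfAlgebra k H]

/-- The convolution product of `H^*`: `(p q)(h) = p(h₁) q(h₂)`. -/
def dualMul : Dual k H →ₗ[k] Dual k H →ₗ[k] Dual k H :=
  LinearMap.mk₂ k (fun p q => (toConv p * toConv q).ofConv)
    (fun p p' q => by rw [WithConv.toConv_add, add_mul, WithConv.ofConv_add])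
    (fun c p q => by rw [WithConv.toConv_smul, smul_mul_assoc, WithConv.ofConv_smul])
    (fun p q q' => by rw [WithConv.toConv_add, mul_add, WithConv.ofConv_add])
    (fun c p q => by rw [WithConv.toConv_smul, mul_smul_comm, WithConv.ofConv_smul])

/-- The left regular action `(h ⇀ p)(l) = p(l h)`. -/
def hitLeft : H →ₗ[k] Dual k H →ₗ[k] Dual k H :=
  Dual.transpose ∘ₗ (LinearMap.mul k H).flip

/-- The right regular action `(p ↼ h)(l) = p(h l)`, with the arguments in the order `h`, `p`. -/
def hitRight : H →ₗ[k] Dual k H →ₗ[k] Dual k H :=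
  Dual.transpose ∘ₗ LinearMap.mul k H

/-- The iterated comultiplication `h ↦ h₁ ⊗ (h₂ ⊗ h₃)`. -/
def comul₃ : H →ₗ[k] H ⊗[k] (H ⊗[k] H) := (comul (R := k)).lTensor H ∘ₗ comul

theorem hitLeft_apply (h : H) (p : Dual k H) (l : H) : hitLeft h p l = p (l * h) := rfl

theorem hitRight_apply (h : H) (p : Dual k H) (l : H) : hitRight h p l = p (h * l) := rfl

theorem dualMul_apply (p q : Dual k H) (h : H) :
    dualMul p q h = LinearMap.mul' k k (TensorProduct.map p q (comul h)) := rfl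

theorem dualMul_assoc (p q r : Dual k H) :
    dualMul (dualMul p q) r = dualMul p (dualMul q r) :=
  congrArg WithConv.ofConv (mul_assoc (toConv p) (toConv q) (toConv r))

theorem counit_dualMul (p : Dual k H) : dualMul (counit : H →ₗ[k] k) p = p :=
  congrArg WithConv.ofConv (one_mul (toConv p))

theorem dualMul_counit (p : Dual k H) : dualMul p (counit : H →ₗ[k] k) = p :=
  congrArg WithConv.ofConv (mul_one (toConv p))

/-- The antipode is an anti-coalgebra map: `Δ(S(h)) = S(h₂) ⊗ S(h₁)`. -/
theorem comul_antipode (h : H) : comul (HopfAlgebra.antipode k h) =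
    TensorProduct.map (HopfAlgebra.antipode k) (HopfAlgebra.antipode k)
      (TensorProduct.comm k H H (comul h)) := by
  let S : H →ₗ[k] H := HopfAlgebra.antipode k
  let μS : H ⊗[k] H →ₗ[k] H := LinearMap.mul' k H ∘ₗ S.rTensor H
  have hμS : μS ∘ₗ comul = Algebra.linearMap k H ∘ₗ counit :=
    HopfAlgebra.mul_antipode_rTensor_comul
  have reb : (TensorProduct.assoc k H H H).symm.toLinearMap.lTensor H ∘ₗ
      (TensorProduct.assoc k H H (H ⊗[k] H)).toLinearMap ∘ₗ
      TensorProduct.map (comul (R := k)) (comul (R := k)) ∘ₗ (comul : H →ₗ[k] _) =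
    ((comul (R := k)).rTensor H ∘ₗ comul).lTensor H ∘ₗ comul := by
    simp only [coassoc_simps]
  let K := μS.lTensor H ∘ₗ (TensorProduct.leftComm k H H H).toLinearMap ∘ₗ
    (μS.rTensor H).lTensor H
  have e1 : LinearMap.mul' k (H ⊗[k] H) ∘ₗ TensorProduct.map (TensorProduct.map S S ∘ₗ
        (TensorProduct.comm k H H).toLinearMap) LinearMap.id =
      K ∘ₗ (TensorProduct.assoc k H H H).symm.toLinearMap.lTensor H ∘ₗ
      (TensorProduct.assoc k H H (H ⊗[k] H)).toLinearMap := by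
    ext a b c d
    simp [K, μS]
  have key : toConv (TensorProduct.map S S ∘ₗ
      (TensorProduct.comm k H H).toLinearMap ∘ₗ comul) * toConv (comul : H →ₗ[k] _) = 1 := by
    ext h
    have h1 := LinearMap.congr_fun reb h
    have h2 := LinearMap.congr_fun e1 (TensorProduct.map comul comul (comul (R := k) h))
    simp only [LinearMap.comp_apply] at h1 h2
    rw [h1] at h2
    have h3 : (TensorProduct.map (TensorProduct.map S S ∘ₗ
        (TensorProduct.comm k H H).toLinearMap ∘ₗ comul) (comul : H →ₗ[k] _)) =
        TensorProduct.map (TensorProduct.map S S ∘ₗ (TensorProduct.comm k H H).toLinearMap)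
          LinearMap.id ∘ₗ TensorProduct.map comul comul := by
      rw [← TensorProduct.map_comp]; rfl
    have h4 : (μS.rTensor H) ∘ₗ ((comul (R := k)).rTensor H ∘ₗ comul) =
        TensorProduct.mk k H H 1 := by
      rw [← LinearMap.comp_assoc, ← LinearMap.rTensor_comp, hμS, LinearMap.rTensor_comp,
        LinearMap.comp_assoc, Coalgebra.rTensor_counit_comp_comul]
      ext x; simp
    have h5 : (TensorProduct.leftComm k H H H).toLinearMap ∘ₗ (TensorProduct.mk k H H 1).lTensor H
        = TensorProduct.mk k H (H ⊗[k] H) 1 := by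
      ext x y; simp
    have h6 : K ∘ₗ ((comul (R := k)).rTensor H ∘ₗ comul).lTensor H =
        μS.lTensor H ∘ₗ TensorProduct.mk k H (H ⊗[k] H) 1 := by
      rw [← h5, ← h4, LinearMap.lTensor_comp H (μS.rTensor H)]; rfl
    have h7 := LinearMap.congr_fun h6 (comul (R := k) h)
    have h8 := LinearMap.congr_fun hμS h
    simp only [LinearMap.comp_apply, TensorProduct.mk_apply, LinearMap.lTensor_tmul] at h7 h8
    rw [LinearMap.convMul_apply, LinearMap.convOne_apply, WithConv.ofConv_toConv,
      WithConv.ofConv_toConv, h3, LinearMap.comp_apply, h2, h7, h8]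
    simp [Algebra.algebraMap_eq_smul_one,
      Algebra.TensorProduct.one_def]
  exact LinearMap.congr_fun (congrArg WithConv.ofConv
    (left_inv_eq_right_inv key LinearMap.comul_right_inv).symm) h

end Dual

/-! ## The diagonal crossed products `H^* ⋈ H(α, β)` -/

section Crossed

variable {k H : Type*} [Field k] [Ring H] [HopfAlgebra k H]

/-- The inverse `S⁻¹` of the antipode. -/
def antipodeInv (hS : Function.Bijective (HopfAlgebra.antipode k (A := H))) : H ≃ₗ[k] H :=
  (LinearEquiv.ofBijective (HopfAlgebra.antipode k (A := H)) hS).symm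

variable (hS : Function.Bijective (HopfAlgebra.antipode k (A := H)))

theorem antipode_antipodeInv (x : H) : HopfAlgebra.antipode k (antipodeInv hS x) = x :=
  LinearEquiv.apply_symm_apply (LinearEquiv.ofBijective (HopfAlgebra.antipode k (A := H)) hS) x

theorem antipodeInv_mul (x y : H) :
    antipodeInv hS (x * y) = antipodeInv hS y * antipodeInv hS x := by
  apply hS.injective
  rw [HopfAlgebra.antipode_mul_antidistrib]
  simp only [antipode_antipodeInv]

theorem antipodeInv_one : antipodeInv hS 1 = 1 := by
  apply hS.injective
  rw [antipode_antipodeInv, HopfAlgebra.antipode_one]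

theorem counit_antipodeInv (x : H) : counit (R := k) (antipodeInv hS x) = counit (R := k) x := by
  conv_rhs => rw [← antipode_antipodeInv hS x]
  exact (HopfAlgebra.counit_antipode _).symm

theorem comul_antipodeInv (x : H) : comul (R := k) (antipodeInv hS x) =
    TensorProduct.map (antipodeInv hS).toLinearMap (antipodeInv hS).toLinearMap
      (TensorProduct.comm k H H (comul x)) := by
  have h := comul_antipode (k := k) (antipodeInv hS x)
  rw [antipode_antipodeInv] at h
  rw [h]
  generalize comul (R := k) (antipodeInv hS x) = T
  induction T using TensorProduct.induction_on with
  | zero => simp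
  | tmul a b =>
    have e : ∀ y, antipodeInv hS (HopfAlgebra.antipode k y) = y := fun y =>
      LinearEquiv.symm_apply_apply (LinearEquiv.ofBijective (HopfAlgebra.antipode k (A := H)) hS) y
    simp [e]
  | add a b ha hb => simp only [map_add]; rw [← ha, ← hb]

variable (g : AutPair k H)

/-- `x, z ↦ (q ↦ α(x) ⇀ q ↼ S⁻¹(β(z)))` for `g = (α, β)`. -/
def twistAct : H →ₗ[k] H →ₗ[k] Dual k H →ₗ[k] Dual k H :=
  LinearMap.mk₂ k
    (fun x z => hitRight (antipodeInv hS (g.snd z)) ∘ₗ hitLeft (g.fst x))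
    (fun x x' z => by rw [map_add, map_add, LinearMap.comp_add])
    (fun c x z => by rw [map_smul, map_smul, LinearMap.comp_smul])
    (fun x z z' => by rw [map_add, map_add, map_add, LinearMap.add_comp])
    (fun c x z => by rw [map_smul, map_smul, map_smul, LinearMap.smul_comp])

theorem twistAct_apply (x z : H) (q : Dual k H) :
    twistAct hS g x z q = hitRight (antipodeInv hS (g.snd z)) (hitLeft (g.fst x) q) := rfl

/-- `x ⊗ (y ⊗ z) ↦ (q ↦ (α(x) ⇀ q ↼ S⁻¹(β(z))) ⊗ y)` for `g = (α, β)`. -/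
def twist : H ⊗[k] (H ⊗[k] H) →ₗ[k] Dual k H →ₗ[k] Dual k H ⊗[k] H :=
  TensorProduct.lift (LinearMap.mk₂ k
    (fun (e : H ⊗[k] H) (y : H) =>
      (TensorProduct.mk k (Dual k H) H).flip y ∘ₗ TensorProduct.lift (twistAct hS g) e)
    (fun e e' y => by rw [map_add, LinearMap.comp_add])
    (fun c e y => by rw [map_smul, LinearMap.comp_smul])
    (fun e y y' => by rw [map_add, LinearMap.add_comp])
    (fun c e y => by rw [map_smul, LinearMap.smul_comp])) ∘ₗ
  (TensorProduct.assoc k H H H).symm.toLinearMap ∘ₗ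
  (TensorProduct.comm k H H).toLinearMap.lTensor H

theorem twist_tmul (x y z : H) (q : Dual k H) :
    twist hS g (x ⊗ₜ[k] (y ⊗ₜ[k] z)) q = twistAct hS g x z q ⊗ₜ[k] y := rfl

/-- `h, q ↦ (α(h₁) ⇀ q ↼ S⁻¹(β(h₃))) ⊗ h₂` for `g = (α, β)`. -/
def straighten : H →ₗ[k] Dual k H →ₗ[k] Dual k H ⊗[k] H := twist hS g ∘ₗ comul₃

/-- The multiplication of `H^* ⋈ H(α, β)`, for `g = (α, β)`:
`(p ⋈ h)(q ⋈ l) = p (α(h₁) ⇀ q ↼ S⁻¹(β(h₃))) ⋈ h₂ l`. -/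
def crossedMul : Dual k H ⊗[k] H →ₗ[k] Dual k H ⊗[k] H →ₗ[k] Dual k H ⊗[k] H :=
  TensorProduct.curry
    (TensorProduct.map (TensorProduct.lift dualMul) (LinearMap.mul' k H) ∘ₗ
      (TensorProduct.assoc k (Dual k H) (Dual k H) (H ⊗[k] H)).symm.toLinearMap ∘ₗ
      ((TensorProduct.assoc k (Dual k H) H H).toLinearMap ∘ₗ
        (TensorProduct.lift (straighten hS g)).rTensor H ∘ₗ
        (TensorProduct.assoc k H (Dual k H) H).symm.toLinearMap).lTensor (Dual k H) ∘ₗ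
      (TensorProduct.assoc k (Dual k H) H (Dual k H ⊗[k] H)).toLinearMap)

/-- `q ⋈ h ↦ p q ⋈ h l`. -/
def sandwich (p : Dual k H) (l : H) : Dual k H ⊗[k] H →ₗ[k] Dual k H ⊗[k] H :=
  TensorProduct.map (dualMul p) (LinearMap.mulRight k l)

theorem sandwich_tmul (p q : Dual k H) (h l : H) :
    sandwich p l (q ⊗ₜ[k] h) = dualMul p q ⊗ₜ[k] (h * l) := rfl

theorem crossedMul_tmul (p q : Dual k H) (h l : H) :
    crossedMul hS g (p ⊗ₜ[k] h) (q ⊗ₜ[k] l) = sandwich p l (straighten hS g h q) := by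
  simp only [crossedMul, TensorProduct.curry_apply, LinearMap.comp_apply,
    LinearEquiv.coe_coe, TensorProduct.assoc_tmul, LinearMap.lTensor_tmul,
    TensorProduct.assoc_symm_tmul, LinearMap.rTensor_tmul, TensorProduct.lift.tmul]
  generalize straighten hS g h q = T
  induction T using TensorProduct.induction_on with
  | zero => simp
  | tmul a b => rfl
  | add a b ha hb =>
    simp only [TensorProduct.add_tmul, TensorProduct.tmul_add, map_add]
    rw [ha, hb]

/-- `(x₁ ⊗ x₂) ⊗ (z₁ ⊗ z₂) ↦ q^{x₁,z₂} r^{x₂,z₁}` for the action `twistAct`. -/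
def twistPair (q r : Dual k H) : (H ⊗[k] H) ⊗[k] (H ⊗[k] H) →ₗ[k] Dual k H :=
  TensorProduct.lift dualMul ∘ₗ
    TensorProduct.map ((TensorProduct.lift (twistAct hS g)).flip q)
      ((TensorProduct.lift (twistAct hS g)).flip r) ∘ₗ
    (TensorProduct.tensorTensorTensorComm k H H H H).toLinearMap ∘ₗ
    (TensorProduct.comm k H H).toLinearMap.lTensor (H ⊗[k] H)

theorem twistPair_tmul (q r : Dual k H) (a b c d : H) :
    twistPair hS g q r ((a ⊗ₜ[k] b) ⊗ₜ[k] (c ⊗ₜ[k] d)) =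
      dualMul (twistAct hS g a d q) (twistAct hS g b c r) := rfl

theorem twistAct_dualMul (x z : H) (q r : Dual k H) :
    twistAct hS g x z (dualMul q r) = twistPair hS g q r (comul x ⊗ₜ[k] comul z) := by
  ext l
  have hx : comul (R := k) (g.fst x) =
      TensorProduct.map (g.fst : H →ₗ[k] H) (g.fst : H →ₗ[k] H) (comul x) :=
    (CoalgHomClass.map_comp_comul_apply g.fst x).symm
  have hz : comul (R := k) (g.snd z) =
      TensorProduct.map (g.snd : H →ₗ[k] H) (g.snd : H →ₗ[k] H) (comul z) :=
    (CoalgHomClass.map_comp_comul_apply g.snd z).symm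
  rw [twistAct_apply, hitRight_apply, hitLeft_apply, dualMul_apply, Bialgebra.comul_mul,
    Bialgebra.comul_mul, comul_antipodeInv, hx, hz]
  generalize comul (R := k) x = X
  generalize comul (R := k) z = Z
  induction X using TensorProduct.induction_on with
  | zero => simp
  | add a b ha hb =>
    simp only [map_add, mul_add, TensorProduct.add_tmul, LinearMap.add_apply]
    rw [ha, hb]
  | tmul x₁ x₂ =>
    induction Z using TensorProduct.induction_on with
    | zero => simp
    | add a b ha hb =>
      simp only [map_add, add_mul, TensorProduct.tmul_add, LinearMap.add_apply]
      rw [ha, hb]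
    | tmul z₁ z₂ =>
      rw [twistPair_tmul, dualMul_apply]
      generalize comul (R := k) l = Y
      induction Y using TensorProduct.induction_on with
      | zero => simp
      | add a b ha hb =>
        simp only [map_add, add_mul, mul_add]
        rw [ha, hb]
      | tmul l₁ l₂ =>
        rw [TensorProduct.map_tmul, TensorProduct.map_tmul, TensorProduct.comm_tmul,
          TensorProduct.map_tmul, Algebra.TensorProduct.tmul_mul_tmul,
          Algebra.TensorProduct.tmul_mul_tmul]
        rfl

theorem straighten_dualMul (h : H) (q r : Dual k H) :
    straighten hS g h (dualMul q r) =
      crossedMul hS g (straighten hS g h q) (r ⊗ₜ[k] 1) := by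
  have reb : TensorProduct.map (comul (R := k)) ((comul (R := k)).lTensor H) ∘ₗ comul₃ =
      (TensorProduct.assoc k H H (H ⊗[k] (H ⊗[k] H))).symm.toLinearMap ∘ₗ
      ((TensorProduct.assoc k H H H).toLinearMap.lTensor H ∘ₗ
        (TensorProduct.assoc k H (H ⊗[k] H) H).toLinearMap).lTensor H ∘ₗ
      ((comul₃ (k := k)).rTensor H).lTensor H ∘ₗ (comul₃ : H →ₗ[k] _) := by
    simp only [comul₃, coassoc_simps]
  let K : (H ⊗[k] H) ⊗[k] (H ⊗[k] (H ⊗[k] H)) →ₗ[k] Dual k H ⊗[k] H :=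
    (twistPair hS g q r).rTensor H ∘ₗ
      (TensorProduct.assoc k (H ⊗[k] H) (H ⊗[k] H) H).symm.toLinearMap ∘ₗ
      (TensorProduct.comm k H (H ⊗[k] H)).toLinearMap.lTensor (H ⊗[k] H)
  have e1 : ∀ T : H ⊗[k] (H ⊗[k] H), twist hS g T (dualMul q r) =
      K (TensorProduct.map (comul (R := k)) ((comul (R := k)).lTensor H) T) := by
    intro T
    induction T using TensorProduct.induction_on with
    | zero => simp
    | add a b ha hb => simp only [map_add, LinearMap.add_apply]; rw [ha, hb]
    | tmul x T =>
      induction T using TensorProduct.induction_on with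
      | zero => simp
      | add a b ha hb =>
        simp only [map_add, TensorProduct.tmul_add, LinearMap.add_apply]; rw [ha, hb]
      | tmul y z =>
        rw [twist_tmul, twistAct_dualMul]
        rfl
  have e2 : ∀ T : H ⊗[k] (H ⊗[k] H), crossedMul hS g (twist hS g T q) (r ⊗ₜ[k] 1) =
      K ((TensorProduct.assoc k H H (H ⊗[k] (H ⊗[k] H))).symm.toLinearMap
        (((TensorProduct.assoc k H H H).toLinearMap.lTensor H ∘ₗ
          (TensorProduct.assoc k H (H ⊗[k] H) H).toLinearMap).lTensor H
          (((comul₃ (k := k)).rTensor H).lTensor H T))) := by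
    intro T
    induction T using TensorProduct.induction_on with
    | zero => simp
    | add a b ha hb => simp only [map_add, LinearMap.add_apply]; rw [ha, hb]
    | tmul x T =>
      induction T using TensorProduct.induction_on with
      | zero => simp
      | add a b ha hb =>
        simp only [map_add, TensorProduct.tmul_add, LinearMap.add_apply]; rw [ha, hb]
      | tmul y z =>
        rw [twist_tmul, crossedMul_tmul, straighten, LinearMap.comp_apply,
          LinearMap.lTensor_tmul, LinearMap.rTensor_tmul]
        generalize comul₃ (k := k) y = Y
        induction Y using TensorProduct.induction_on with
        | zero => simp
        | add a b ha hb =>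
          simp only [map_add, TensorProduct.tmul_add, TensorProduct.add_tmul,
            LinearMap.add_apply]
          rw [ha, hb]
        | tmul b Y =>
          induction Y using TensorProduct.induction_on with
          | zero => simp
          | add a b ha hb =>
            simp only [map_add, TensorProduct.tmul_add, TensorProduct.add_tmul,
              LinearMap.add_apply]
            rw [ha, hb]
          | tmul c d =>
            rw [twist_tmul, sandwich_tmul, mul_one]
            rfl
  have h1 := LinearMap.congr_fun reb h
  simp only [LinearMap.comp_apply] at h1
  rw [straighten, LinearMap.comp_apply, e1, h1, e2]

theorem straighten_mul (h l : H) (r : Dual k H) :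
    straighten hS g (h * l) r =
      crossedMul hS g ((counit : H →ₗ[k] k) ⊗ₜ[k] h) (straighten hS g l r) := by
  have e0 : ∀ h l : H, comul₃ (k := k) (h * l) = comul₃ h * comul₃ l := by
    intro h l
    have e : ∀ h : H, comul₃ (k := k) h =
        Algebra.TensorProduct.map (AlgHom.id k H) (Bialgebra.comulAlgHom k H)
          (Bialgebra.comulAlgHom k H h) := fun _ => rfl
    rw [e, e, e, map_mul, map_mul]
  have e1 : ∀ Y : H ⊗[k] (H ⊗[k] H), twist hS g (comul₃ (k := k) h * Y) r =
      crossedMul hS g ((counit : H →ₗ[k] k) ⊗ₜ[k] h) (twist hS g Y r) := by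
    intro Y
    induction Y using TensorProduct.induction_on with
    | zero => simp
    | add a b ha hb => simp only [map_add, mul_add, LinearMap.add_apply]; rw [ha, hb]
    | tmul x Y =>
      induction Y using TensorProduct.induction_on with
      | zero => simp
      | add a b ha hb =>
        simp only [map_add, mul_add, TensorProduct.tmul_add, LinearMap.add_apply]; rw [ha, hb]
      | tmul y z =>
        rw [twist_tmul, crossedMul_tmul, straighten, LinearMap.comp_apply]
        generalize comul₃ (k := k) h = X
        induction X using TensorProduct.induction_on with
        | zero => simp
        | add a b ha hb => simp only [map_add, add_mul, LinearMap.add_apply]; rw [ha, hb]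
        | tmul a X =>
          induction X using TensorProduct.induction_on with
          | zero => simp
          | add a b ha hb =>
            simp only [map_add, add_mul, TensorProduct.tmul_add, LinearMap.add_apply]
            rw [ha, hb]
          | tmul b c =>
            rw [Algebra.TensorProduct.tmul_mul_tmul, Algebra.TensorProduct.tmul_mul_tmul,
              twist_tmul, twist_tmul, sandwich_tmul, counit_dualMul]
            congr 1
            ext w
            simp only [twistAct_apply, hitLeft_apply, hitRight_apply, map_mul,
              antipodeInv_mul, mul_assoc]
  rw [straighten, LinearMap.comp_apply, e0, e1]
  rfl

theorem straighten_one (q : Dual k H) : straighten hS g 1 q = q ⊗ₜ[k] 1 := by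
  have : comul₃ (k := k) (1 : H) = 1 ⊗ₜ[k] (1 ⊗ₜ[k] 1) := by
    simp [comul₃, Algebra.TensorProduct.one_def]
  rw [straighten, LinearMap.comp_apply, this, twist_tmul, twistAct_apply, map_one g.fst,
    map_one g.snd, antipodeInv_one]
  congr 1
  ext l
  simp [hitLeft_apply, hitRight_apply]

theorem straighten_counit (h : H) :
    straighten hS g h (counit : H →ₗ[k] k) = (counit : H →ₗ[k] k) ⊗ₜ[k] h := by
  let E : H ⊗[k] (H ⊗[k] H) →ₗ[k] H := (TensorProduct.lid k H).toLinearMap ∘ₗ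
    (counit (R := k)).rTensor H ∘ₗ
    ((TensorProduct.rid k H).toLinearMap ∘ₗ (counit (R := k)).lTensor H).lTensor H
  have e1 : ∀ T : H ⊗[k] (H ⊗[k] H), twist hS g T (counit : H →ₗ[k] k) =
      (counit : H →ₗ[k] k) ⊗ₜ[k] E T := by
    intro T
    induction T using TensorProduct.induction_on with
    | zero => simp
    | add a b ha hb =>
      simp only [map_add, TensorProduct.tmul_add, LinearMap.add_apply]; rw [ha, hb]
    | tmul x T =>
      induction T using TensorProduct.induction_on with
      | zero => simp
      | add a b ha hb =>
        simp only [map_add, TensorProduct.tmul_add, LinearMap.add_apply]; rw [ha, hb]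
      | tmul y z =>
        have e2 : twistAct hS g x z (counit : H →ₗ[k] k) =
            ((counit x : k) * (counit z : k)) • (counit : H →ₗ[k] k) := by
          ext w
          have hx : counit (R := k) (g.fst x) = counit (R := k) x :=
            CoalgHomClass.counit_comp_apply g.fst x
          have hz : counit (R := k) (g.snd z) = counit (R := k) z :=
            CoalgHomClass.counit_comp_apply g.snd z
          rw [twistAct_apply, hitRight_apply, hitLeft_apply, Bialgebra.counit_mul,
            Bialgebra.counit_mul, counit_antipodeInv, hx, hz, LinearMap.smul_apply, smul_eq_mul]
          ring
        rw [twist_tmul, e2, TensorProduct.smul_tmul]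
        simp [E, smul_smul, mul_comm]
  have e3 : E (comul₃ h) = h := by
    have h1 : ((TensorProduct.rid k H).toLinearMap ∘ₗ (counit (R := k)).lTensor H) ∘ₗ comul =
        (LinearMap.id : H →ₗ[k] H) := by
      ext x; simp
    have h2 : E (comul₃ h) = TensorProduct.lid k H ((counit (R := k)).rTensor H
        ((((TensorProduct.rid k H).toLinearMap ∘ₗ (counit (R := k)).lTensor H) ∘ₗ
          comul).lTensor H (comul h))) := by
      rw [LinearMap.lTensor_comp]; rfl
    rw [h2, h1]
    simp
  rw [straighten, LinearMap.comp_apply, e1, e3]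

theorem crossedMul_sandwich_left (p r : Dual k H) (l m : H) (T : Dual k H ⊗[k] H) :
    crossedMul hS g (sandwich p l T) (r ⊗ₜ[k] m) =
      sandwich p m (crossedMul hS g T (straighten hS g l r)) := by
  induction T using TensorProduct.induction_on with
  | zero => simp
  | add a b ha hb => simp only [map_add, LinearMap.add_apply]; rw [ha, hb]
  | tmul q' h' =>
    rw [sandwich_tmul, crossedMul_tmul, straighten_mul]
    generalize straighten hS g l r = U
    induction U using TensorProduct.induction_on with
    | zero => simp
    | add a b ha hb => simp only [map_add]; rw [ha, hb]
    | tmul r' l' =>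
      rw [crossedMul_tmul, crossedMul_tmul]
      generalize straighten hS g h' r' = V
      induction V using TensorProduct.induction_on with
      | zero => simp
      | add a b ha hb => simp only [map_add]; rw [ha, hb]
      | tmul a b => simp only [sandwich_tmul, counit_dualMul, dualMul_assoc]

theorem crossedMul_sandwich_right (p q : Dual k H) (h m : H) (U : Dual k H ⊗[k] H) :
    crossedMul hS g (p ⊗ₜ[k] h) (sandwich q m U) =
      sandwich p m (crossedMul hS g (straighten hS g h q) U) := by
  induction U using TensorProduct.induction_on with
  | zero => simp
  | add a b ha hb => simp only [map_add]; rw [ha, hb]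
  | tmul r' l' =>
    rw [sandwich_tmul, crossedMul_tmul, straighten_dualMul]
    generalize straighten hS g h q = T
    induction T using TensorProduct.induction_on with
    | zero => simp
    | add a b ha hb => simp only [map_add, LinearMap.add_apply]; rw [ha, hb]
    | tmul q' h' =>
      rw [crossedMul_tmul, crossedMul_tmul]
      generalize straighten hS g h' r' = V
      induction V using TensorProduct.induction_on with
      | zero => simp
      | add a b ha hb => simp only [map_add]; rw [ha, hb]
      | tmul a b => simp only [sandwich_tmul, mul_one, mul_assoc]

theorem crossedMul_assoc (x y z : Dual k H ⊗[k] H) :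
    crossedMul hS g (crossedMul hS g x y) z = crossedMul hS g x (crossedMul hS g y z) := by
  induction x using TensorProduct.induction_on with
  | zero => simp
  | add a b ha hb => simp only [map_add, LinearMap.add_apply]; rw [ha, hb]
  | tmul p h =>
    induction y using TensorProduct.induction_on with
    | zero => simp
    | add a b ha hb => simp only [map_add, LinearMap.add_apply]; rw [ha, hb]
    | tmul q l =>
      induction z using TensorProduct.induction_on with
      | zero => simp
      | add a b ha hb => simp only [map_add]; rw [ha, hb]
      | tmul r m =>
        rw [crossedMul_tmul, crossedMul_sandwich_left, crossedMul_tmul,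
          crossedMul_sandwich_right]

theorem one_crossedMul (x : Dual k H ⊗[k] H) :
    crossedMul hS g ((counit : H →ₗ[k] k) ⊗ₜ[k] 1) x = x := by
  induction x using TensorProduct.induction_on with
  | zero => simp
  | add a b ha hb => simp only [map_add]; rw [ha, hb]
  | tmul q l =>
    rw [crossedMul_tmul, straighten_one, sandwich_tmul, counit_dualMul, one_mul]

theorem crossedMul_one (x : Dual k H ⊗[k] H) :
    crossedMul hS g x ((counit : H →ₗ[k] k) ⊗ₜ[k] 1) = x := by
  induction x using TensorProduct.induction_on with
  | zero => simp
  | add a b ha hb => simp only [map_add, LinearMap.add_apply]; rw [ha, hb]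
  | tmul p h =>
    rw [crossedMul_tmul, straighten_counit, sandwich_tmul, dualMul_counit, mul_one]

/-- The diagonal crossed product algebra `H^* ⋈ H(α, β)`, `g = (α, β)`: the vector space
`H^* ⊗ H` with the product `crossedMul` and unit `ε ⋈ 1`. -/
def Crossed (_hS : Function.Bijective (HopfAlgebra.antipode k (A := H)))
    (_g : AutPair k H) : Type _ :=
  Dual k H ⊗[k] H

namespace Crossed

instance : AddCommGroup (Crossed hS g) := inferInstanceAs (AddCommGroup (Dual k H ⊗[k] H))

instance : Module k (Crossed hS g) := inferInstanceAs (Module k (Dual k H ⊗[k] H))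

/-- The underlying vector space of `H^* ⋈ H(α, β)`. -/
def equiv : Dual k H ⊗[k] H ≃ₗ[k] Crossed hS g := LinearEquiv.refl k _

instance : Ring (Crossed hS g) where
  __ := (inferInstance : AddCommGroup (Crossed hS g))
  mul x y := equiv hS g (crossedMul hS g ((equiv hS g).symm x) ((equiv hS g).symm y))
  one := equiv hS g ((counit : H →ₗ[k] k) ⊗ₜ[k] 1)
  left_distrib x y z := map_add (crossedMul hS g x) y z
  right_distrib x y z := LinearMap.congr_fun (map_add (crossedMul hS g) x y) z
  zero_mul x := LinearMap.congr_fun (map_zero (crossedMul hS g)) x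
  mul_zero x := map_zero (crossedMul hS g x)
  mul_assoc x y z := crossedMul_assoc hS g x y z
  one_mul x := one_crossedMul hS g x
  mul_one x := crossedMul_one hS g x

instance : Algebra k (Crossed hS g) :=
  Algebra.ofModule
    (fun c x y => LinearMap.congr_fun (map_smul (crossedMul hS g) c x) y)
    (fun c x y => map_smul (crossedMul hS g x) c y)

end Crossed

/-! ## The structure maps of `DT(H)` -/

section FiniteDim

variable [FiniteDimensional k H]

/-- The comultiplication `p ↦ p₁ ⊗ p₂` of `H^*`, determined by `p(h l) = p₁(h) p₂(l)`. -/
def dualComul : Dual k H →ₗ[k] Dual k H ⊗[k] Dual k H :=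
  (TensorProduct.dualDistribEquiv k H H).symm.toLinearMap ∘ₗ
    Dual.transpose (LinearMap.mul' k H)

/-- For `g = (α, β)` and `h = (γ, δ)`:
`Δ_{g,h}(p ⋈ x) = (p₂ ⋈ γ(x₁)) ⊗ (p₁ ⋈ γ⁻¹βγ(x₂))`. -/
def dtComul (g h : AutPair k H) :
    Crossed hS (g * h) →ₗ[k] Crossed hS g ⊗[k] Crossed hS h :=
  TensorProduct.map (Crossed.equiv hS g).toLinearMap (Crossed.equiv hS h).toLinearMap ∘ₗ
    (TensorProduct.tensorTensorTensorComm k (Dual k H) (Dual k H) H H).toLinearMap ∘ₗ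
    TensorProduct.map
      ((TensorProduct.comm k (Dual k H) (Dual k H)).toLinearMap ∘ₗ dualComul)
      (TensorProduct.map (h.fst : H →ₗ[k] H)
        ((h.fst⁻¹ * g.snd * h.fst : H ≃ₐc[k] H) : H →ₗ[k] H) ∘ₗ comul) ∘ₗ
    (Crossed.equiv hS (g * h)).symm.toLinearMap

/-- The counit of the Drinfeld double `D(H) = H^* ⋈ H(id, id)`: `ε(p ⋈ x) = p(1) ε(x)`. -/
def dtCounit : Crossed hS (1 : AutPair k H) →ₗ[k] k :=
  LinearMap.mul' k k ∘ₗ TensorProduct.map (Dual.eval k H 1) counit ∘ₗ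
    (Crossed.equiv hS 1).symm.toLinearMap

/-- For `g = (α, β)` and `h = (γ, δ)`:
`φ_g^h(p ⋈ x) = p ∘ β α⁻¹ ⋈ α γ⁻¹ β⁻¹ γ (x)`. -/
def dtConj (g h : AutPair k H) : Crossed hS h →ₗ[k] Crossed hS (g * h * g⁻¹) :=
  (Crossed.equiv hS (g * h * g⁻¹)).toLinearMap ∘ₗ
    TensorProduct.map
      (Dual.transpose ((g.snd * g.fst⁻¹ : H ≃ₐc[k] H) : H →ₗ[k] H))
      ((g.fst * h.fst⁻¹ * g.snd⁻¹ * h.fst : H ≃ₐc[k] H) : H →ₗ[k] H) ∘ₗ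
    (Crossed.equiv hS h).symm.toLinearMap

/-- For `g = (α, β)`: `S_g(p ⋈ x) = (ε ⋈ αβ(S(x))) · (p ∘ S⁻¹ ⋈ 1)`, the product being that of
`H^* ⋈ H(g⁻¹)`. -/
def dtAntipode (g : AutPair k H) : Crossed hS g →ₗ[k] Crossed hS g⁻¹ :=
  LinearMap.mul' k (Crossed hS g⁻¹) ∘ₗ
    TensorProduct.map
      ((Crossed.equiv hS g⁻¹).toLinearMap ∘ₗ
        TensorProduct.mk k (Dual k H) H (counit : H →ₗ[k] k) ∘ₗ
        ((g.fst * g.snd : H ≃ₐc[k] H) : H →ₗ[k] H) ∘ₗ HopfAlgebra.antipode k)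
      ((Crossed.equiv hS g⁻¹).toLinearMap ∘ₗ
        (TensorProduct.mk k (Dual k H) H).flip 1 ∘ₗ
        Dual.transpose (antipodeInv hS).toLinearMap) ∘ₗ
    (TensorProduct.comm k (Dual k H) H).toLinearMap ∘ₗ
    (Crossed.equiv hS g).symm.toLinearMap

/-- The structure maps of `DT(H)`, the family of the algebras `H^* ⋈ H(α, β)`. -/
def dt : TCoalgebraData k (Crossed hS) where
  comul := dtComul hS
  counit := dtCounit hS
  antipode := dtAntipode hS
  conj := dtConj hS

/-- For `g = (α, β)` and a basis `e_i` of `H` with dual basis `e^i`: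
`R_{g,h} = ∑ i, (ε ⋈ β⁻¹(e_i)) ⊗ (e^i ⋈ 1)`. -/
def dtR {ι : Type*} [Fintype ι] (e : Basis ι k H) (g h : AutPair k H) :
    Crossed hS g ⊗[k] Crossed hS h :=
  ∑ i, Crossed.equiv hS g ((counit : H →ₗ[k] k) ⊗ₜ[k] (g.snd⁻¹) (e i)) ⊗ₜ[k]
    Crossed.equiv hS h (e.coord i ⊗ₜ[k] 1)

end FiniteDim

end Crossed

end

end TurHopf

namespace TurHopf

open WithConv Coalgebra Module

noncomputable section

/-! ### Generators of the diagonal crossed product and its universal property. -/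

section Generators

variable {k H : Type*} [Field k] [Ring H] [HopfAlgebra k H]

/-! The algebra `H^* ⋈ H(α, β)` is generated by the subalgebras `H^*` and `H`, and `p ⋈ h` is the
product of `p ⋈ 1` and `ε ⋈ h`. The rule for moving `h` past `q` involves `S⁻¹`. Since `S⁻¹(h₂) h₁ =
ε(h) = h₂ S⁻¹(h₁)`, that rule is equivalent to an antipode-free relation, `h₁ · (q ↼ β(h₂)) = (α(h₁)
⇀ q) · h₂`, called `CrossRel` here. This gives a universal property (`Crossed.lift`): algebra maps
from `H^*` and from `H` that satisfy the cross relation glue to an algebra map on the crossed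
product. Hence `Δ`, `ε` and `φ` are multiplicative once one relation is checked for each, and
identities between algebra maps need checking only on generators. There they reduce to facts about
`H` and `H^*` and to word identities in `Aut_Hopf(H)`.

The cross relation is an equation in the convolution algebra `Hom(H, B)`, so Sweedler computations
become computations in a ring, with the elements of `B` entering as constants `convConst`. The
decisive one is `crossRel_comul`: the cross relations of the two tensor factors combine to that of
the product index, which is where the twisted group law comes from.

The antipode laws hold because the two inner factors of the product, both in `H^*` or both in `H`,
collapse to a scalar, after which the outer two collapse.

For the `R`-matrix, `f ↦ ∑ f(e_i) ⊗ (e^i ⋈ 1)` is a unital algebra map out of the convolution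
algebra (`canonicalSum_mul`, `canonicalSum_one`). `R` is the image of the algebra map `β⁻¹`,
followed by the inclusion of `H`, so it is invertible. Commuting `R` past the coproduct of `H^*` is
the image of the cross relation of the first factor (`dtR_mul_comulInl`); past that of `H` it
follows from the cross relation of the second factor (`dtR_mul_comulInr`). The two axioms for
coproducts of `R` express that `H` and `H^*` are dual to each other. Throughout, a linear
endomorphism of `H` can be moved from `e_i` to `e^i` as its transpose (`sum_basis_coord_comp`). -/

theorem hitRight_hitRight (x y : H) (p : Dual k H) :
    hitRight x (hitRight y p) = hitRight (y * x) p := by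
  ext l; simp only [hitRight_apply, mul_assoc]

theorem hitLeft_hitRight (x y : H) (p : Dual k H) :
    hitLeft x (hitRight y p) = hitRight y (hitLeft x p) := by
  ext l; simp only [hitRight_apply, hitLeft_apply, mul_assoc]

theorem hitRight_one (p : Dual k H) : hitRight 1 p = p := by
  ext l; simp only [hitRight_apply, one_mul]

variable (hS : Function.Bijective (HopfAlgebra.antipode k (A := H)))

/-- `S⁻¹(h₂) h₁ = ε(h)`. -/
theorem antipodeInv_mul_comul (h : H) :
    LinearMap.mul' k H (((antipodeInv hS).toLinearMap.rTensor H)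
      (TensorProduct.comm k H H (comul (R := k) h))) = algebraMap k H (counit h) := by
  apply hS.injective
  -- `S` reverses products, so it carries `S⁻¹(h₂) h₁` to `S(h₁) h₂`.
  have e : ∀ T : H ⊗[k] H, HopfAlgebra.antipode k (LinearMap.mul' k H
      (((antipodeInv hS).toLinearMap.rTensor H) (TensorProduct.comm k H H T))) =
      LinearMap.mul' k H ((HopfAlgebra.antipode k).rTensor H T) := by
    intro T
    induction T using TensorProduct.induction_on with
    | zero => simp
    | add a b ha hb => simp only [map_add]; rw [ha, hb]
    | tmul a b => simp [HopfAlgebra.antipode_mul_antidistrib, antipode_antipodeInv]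
  rw [e, HopfAlgebra.mul_antipode_rTensor_comul_apply]
  simp [Algebra.algebraMap_eq_smul_one]

/-- `h₂ S⁻¹(h₁) = ε(h)`. -/
theorem mul_antipodeInv_comul (h : H) :
    LinearMap.mul' k H (((antipodeInv hS).toLinearMap.lTensor H)
      (TensorProduct.comm k H H (comul (R := k) h))) = algebraMap k H (counit h) := by
  apply hS.injective
  have e : ∀ T : H ⊗[k] H, HopfAlgebra.antipode k (LinearMap.mul' k H
      (((antipodeInv hS).toLinearMap.lTensor H) (TensorProduct.comm k H H T))) =
      LinearMap.mul' k H ((HopfAlgebra.antipode k).lTensor H T) := by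
    intro T
    induction T using TensorProduct.induction_on with
    | zero => simp
    | add a b ha hb => simp only [map_add]; rw [ha, hb]
    | tmul a b => simp [HopfAlgebra.antipode_mul_antidistrib, antipode_antipodeInv]
  rw [e, HopfAlgebra.mul_antipode_lTensor_comul_apply]
  simp [Algebra.algebraMap_eq_smul_one]

/-- In the convolution algebra `f ∘ S` is a left inverse of `f` because `f` is an algebra map, and
`S ∘ f` is a right inverse because `f` is a coalgebra map. -/
theorem aut_apply_antipode (f : H ≃ₐc[k] H) (x : H) :
    f (HopfAlgebra.antipode k x) = HopfAlgebra.antipode k (f x) := by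
  let F : H →ₗ[k] H := (f : H →ₗ[k] H)
  have h1 : toConv (F ∘ₗ HopfAlgebra.antipode k) * toConv F = 1 := by
    have := LinearMap.algHom_comp_convMul_distrib (f : H →ₐ[k] H)
      (toConv (HopfAlgebra.antipode k)) (toConv (LinearMap.id : H →ₗ[k] H))
    rw [LinearMap.antipode_mul_id] at this
    refine Eq.trans (WithConv.ext this.symm) ?_
    ext h
    simp
  have h2 : toConv F * toConv (HopfAlgebra.antipode k ∘ₗ F) = 1 := by
    have := LinearMap.convMul_comp_coalgHom_distrib (toConv (LinearMap.id : H →ₗ[k] H))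
      (toConv (HopfAlgebra.antipode k)) (f : H →ₗc[k] H)
    rw [LinearMap.id_mul_antipode] at this
    refine Eq.trans (WithConv.ext this.symm) ?_
    ext h
    simp
  exact LinearMap.congr_fun (congrArg WithConv.ofConv (left_inv_eq_right_inv h1 h2)) x

theorem aut_apply_antipodeInv (f : H ≃ₐc[k] H) (x : H) :
    f (antipodeInv hS x) = antipodeInv hS (f x) := by
  apply hS.injective
  rw [← aut_apply_antipode, antipode_antipodeInv, antipode_antipodeInv]

namespace Crossed

variable (g : AutPair k H)

theorem equiv_mul_equiv (x y : Dual k H ⊗[k] H) :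
    equiv hS g x * equiv hS g y = equiv hS g (crossedMul hS g x y) := rfl

theorem one_def : (1 : Crossed hS g) = equiv hS g ((counit : H →ₗ[k] k) ⊗ₜ[k] 1) := rfl

/-- The inclusion `h ↦ ε ⋈ h` of `H`. -/
def inr : H →ₐ[k] Crossed hS g :=
  AlgHom.ofLinearMap ((equiv hS g).toLinearMap ∘ₗ
      TensorProduct.mk k (Dual k H) H (counit : H →ₗ[k] k)) rfl (fun x y => by
    change equiv hS g ((counit : H →ₗ[k] k) ⊗ₜ[k] (x * y)) =
      equiv hS g ((counit : H →ₗ[k] k) ⊗ₜ[k] x) * equiv hS g ((counit : H →ₗ[k] k) ⊗ₜ[k] y)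
    rw [equiv_mul_equiv, crossedMul_tmul, straighten_counit, sandwich_tmul, dualMul_counit])

/-- The inclusion `p ↦ p ⋈ 1` of `H^*`. -/
def inl : WithConv (H →ₗ[k] k) →ₐ[k] Crossed hS g :=
  AlgHom.ofLinearMap ((equiv hS g).toLinearMap ∘ₗ
      (TensorProduct.mk k (Dual k H) H).flip 1 ∘ₗ
      (WithConv.linearEquiv k (H →ₗ[k] k)).toLinearMap) rfl (fun x y => by
    change equiv hS g (dualMul x.ofConv y.ofConv ⊗ₜ[k] 1) =
      equiv hS g (x.ofConv ⊗ₜ[k] 1) * equiv hS g (y.ofConv ⊗ₜ[k] 1)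
    rw [equiv_mul_equiv, crossedMul_tmul, straighten_one, sandwich_tmul, one_mul])

theorem inr_apply (h : H) :
    inr hS g h = equiv hS g ((counit : H →ₗ[k] k) ⊗ₜ[k] h) := rfl

/-- `inl` as a linear map on the dual space. -/
def inlₗ : Dual k H →ₗ[k] Crossed hS g :=
  (inl hS g).toLinearMap ∘ₗ (WithConv.linearEquiv k (H →ₗ[k] k)).symm.toLinearMap

theorem inlₗ_apply (p : Dual k H) : inlₗ hS g p = equiv hS g (p ⊗ₜ[k] 1) := rfl

theorem inlₗ_dualMul (p q : Dual k H) :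
    inlₗ hS g (dualMul p q) = inlₗ hS g p * inlₗ hS g q := map_mul (inl hS g) (toConv p) (toConv q)

theorem inlₗ_counit : inlₗ hS g (counit : H →ₗ[k] k) = 1 := rfl

theorem equiv_tmul (p : Dual k H) (h : H) :
    equiv hS g (p ⊗ₜ[k] h) = inlₗ hS g p * inr hS g h := by
  rw [inlₗ_apply, inr_apply, equiv_mul_equiv, crossedMul_tmul, straighten_one, sandwich_tmul,
    one_mul, dualMul_counit]

theorem induction_on {motive : Crossed hS g → Prop} (x : Crossed hS g)
    (zero : motive 0) (add : ∀ x y, motive x → motive y → motive (x + y))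
    (mul : ∀ p h, motive (inlₗ hS g p * inr hS g h)) : motive x := by
  obtain ⟨x, rfl⟩ := (equiv hS g).surjective x
  induction x using TensorProduct.induction_on with
  | zero => rwa [map_zero]
  | add a b ha hb => rw [map_add]; exact add _ _ ha hb
  | tmul p h => rw [equiv_tmul]; exact mul p h

theorem inr_mul_inlₗ (h : H) (q : Dual k H) :
    inr hS g h * inlₗ hS g q = equiv hS g (straighten hS g h q) := by
  rw [inlₗ_apply, inr_apply, equiv_mul_equiv, crossedMul_tmul]
  congr 1
  generalize straighten hS g h q = T
  induction T using TensorProduct.induction_on with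
  | zero => simp
  | add a b ha hb => rw [map_add, ha, hb]
  | tmul p h => rw [sandwich_tmul, counit_dualMul, mul_one]

theorem algHom_ext {B : Type*} [Semiring B] [Algebra k B] {F F' : Crossed hS g →ₐ[k] B}
    (hl : ∀ p, F (inlₗ hS g p) = F' (inlₗ hS g p))
    (hr : ∀ h, F (inr hS g h) = F' (inr hS g h)) : F = F' := by
  ext x
  induction x using induction_on with
  | zero => simp
  | add a b ha hb => rw [map_add, map_add, ha, hb]
  | mul p h => rw [map_mul, map_mul, hl, hr]

end Crossed

/-- The cross relation `I(h₁) K(q ↼ β(h₂)) = K(α(h₁) ⇀ q) I(h₂)` for `g = (α, β)`. -/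
def CrossRel (g : AutPair k H) {B : Type*} [Ring B] [Algebra k B]
    (K : Dual k H →ₗ[k] B) (I : H →ₗ[k] B) : Prop :=
  ∀ q : Dual k H,
    toConv I * toConv (K ∘ₗ (hitRight (k := k) (H := H)).flip q ∘ₗ (g.snd : H →ₗ[k] H)) =
      toConv (K ∘ₗ (hitLeft (k := k) (H := H)).flip q ∘ₗ (g.fst : H →ₗ[k] H)) * toConv I


/-- The cross relation, applied to the functional `q ↼ S⁻¹(β(h₃))`, turns `K(α(h₁) ⇀ q ↼ S⁻¹(β(h₃)))
I(h₂)` into `I(h₁) K(q ↼ β(S⁻¹(h₃) h₂))`, and `S⁻¹(h₃) h₂` collapses to a counit. `D` below is the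
functional that collapses. -/
theorem CrossRel.lift_straighten {g : AutPair k H} {B : Type*} [Ring B] [Algebra k B]
    {K : Dual k H →ₗ[k] B} {I : H →ₗ[k] B} (hKI : CrossRel g K I) (h : H) (q : Dual k H) :
    LinearMap.mul' k B (TensorProduct.map K I (straighten hS g h q)) = I h * K q := by
  let D : H ⊗[k] H →ₗ[k] Dual k H := (hitRight (k := k)).flip q ∘ₗ (g.snd : H →ₗ[k] H) ∘ₗ
    LinearMap.mul' k H ∘ₗ (antipodeInv hS).toLinearMap.rTensor H ∘ₗ
    (TensorProduct.comm k H H).toLinearMap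
  let Q : H ⊗[k] (H ⊗[k] H) →ₗ[k] B := LinearMap.mul' k B ∘ₗ TensorProduct.map I (K ∘ₗ D)
  let P : H ⊗[k] (H ⊗[k] H) →ₗ[k] B :=
    LinearMap.mul' k B ∘ₗ TensorProduct.map K I ∘ₗ (twist hS g).flip q
  have e1 : ∀ T : H ⊗[k] H, P (TensorProduct.assoc k H H H ((comul (R := k)).rTensor H T)) =
      Q (TensorProduct.assoc k H H H ((comul (R := k)).rTensor H T)) := by
    intro T
    induction T using TensorProduct.induction_on with
    | zero => simp
    | add a b ha hb => simp only [map_add]; rw [ha, hb]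
    | tmul x z =>
      have := LinearMap.congr_fun (congrArg WithConv.ofConv
        (hKI (hitRight (antipodeInv hS (g.snd z)) q))) x
      rw [LinearMap.convMul_apply, LinearMap.convMul_apply] at this
      rw [LinearMap.rTensor_tmul]
      have a1 : ∀ X : H ⊗[k] H, P (TensorProduct.assoc k H H H (X ⊗ₜ[k] z)) =
          LinearMap.mul' k B (TensorProduct.map (K ∘ₗ (hitLeft (k := k) (H := H)).flip
            (hitRight (antipodeInv hS (g.snd z)) q) ∘ₗ (g.fst : H →ₗ[k] H)) I X) := by
        intro X
        induction X using TensorProduct.induction_on with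
        | zero => simp
        | add a b ha hb => simp only [map_add, TensorProduct.add_tmul]; rw [ha, hb]
        | tmul x y => simp [P, twist_tmul, twistAct_apply, hitLeft_hitRight]
      have a2 : ∀ X : H ⊗[k] H, Q (TensorProduct.assoc k H H H (X ⊗ₜ[k] z)) =
          LinearMap.mul' k B (TensorProduct.map I (K ∘ₗ (hitRight (k := k) (H := H)).flip
            (hitRight (antipodeInv hS (g.snd z)) q) ∘ₗ (g.snd : H →ₗ[k] H)) X) := by
        intro X
        induction X using TensorProduct.induction_on with
        | zero => simp
        | add a b ha hb => simp only [map_add, TensorProduct.add_tmul]; rw [ha, hb]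
        | tmul x y => simp [Q, D, hitRight_hitRight, aut_apply_antipodeInv]
      rw [a1, a2]
      exact this.symm
  have e2 : ∀ T : H ⊗[k] H, Q ((comul (R := k)).lTensor H T) =
      LinearMap.mul' k B (TensorProduct.map I (K ∘ₗ LinearMap.toSpanSingleton k _ q)
        ((counit (R := k)).lTensor H T)) := by
    intro T
    induction T using TensorProduct.induction_on with
    | zero => simp
    | add a b ha hb => simp only [map_add]; rw [ha, hb]
    | tmul x z =>
      have : D (comul (R := k) z) = counit (R := k) z • q := by
        simp only [D, LinearMap.comp_apply, LinearEquiv.coe_coe]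
        rw [antipodeInv_mul_comul, Algebra.algebraMap_eq_smul_one]
        simp [hitRight_one]
      simp [Q, this]
  have := e1 (comul h)
  rw [Coalgebra.coassoc_apply, e2] at this
  refine Eq.trans this ?_
  simp

/-- Converse of `CrossRel.lift_straighten`: the product rule gives `(α(h₁) ⇀ q ↼ β(h₄ S⁻¹(h₃))) ⋈
h₂`, and `h₄ S⁻¹(h₃)` collapses. The rebracketing `reb` brings `h₃` and `h₄` together. -/
theorem Crossed.crossRel (g : AutPair k H) :
    CrossRel g (Crossed.inlₗ hS g) (Crossed.inr hS g).toLinearMap := by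
  intro q
  ext h
  rw [LinearMap.convMul_apply, LinearMap.convMul_apply]
  let D : H ⊗[k] H →ₗ[k] Dual k H := (hitRight (k := k)).flip q ∘ₗ (g.snd : H →ₗ[k] H) ∘ₗ
    LinearMap.mul' k H ∘ₗ (antipodeInv hS).toLinearMap.lTensor H ∘ₗ
    (TensorProduct.comm k H H).toLinearMap
  let M : H ⊗[k] (H ⊗[k] (H ⊗[k] H)) →ₗ[k] Crossed hS g := LinearMap.mul' k (Crossed hS g) ∘ₗ
    TensorProduct.map (Crossed.inlₗ hS g ∘ₗ TensorProduct.lift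
      (((hitLeft (k := k) (H := H)) ∘ₗ (g.fst : H →ₗ[k] H)).compl₂ D))
      (Crossed.inr hS g).toLinearMap ∘ₗ
    (TensorProduct.assoc k H (H ⊗[k] H) H).symm.toLinearMap ∘ₗ
    (TensorProduct.comm k H (H ⊗[k] H)).toLinearMap.lTensor H
  have reb : (TensorProduct.assoc k H H H).toLinearMap.lTensor H ∘ₗ
      (TensorProduct.assoc k H (H ⊗[k] H) H).toLinearMap ∘ₗ (comul₃ (k := k)).rTensor H ∘ₗ
      (comul : H →ₗ[k] _) =
      ((comul (R := k)).lTensor H).lTensor H ∘ₗ (comul (R := k)).lTensor H ∘ₗ comul := by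
    simp only [comul₃, coassoc_simps]
  have e1 : ∀ T : H ⊗[k] H, LinearMap.mul' k (Crossed hS g)
      (TensorProduct.map (Crossed.inr hS g).toLinearMap
        (Crossed.inlₗ hS g ∘ₗ (hitRight (k := k) (H := H)).flip q ∘ₗ (g.snd : H →ₗ[k] H)) T) =
      M ((TensorProduct.assoc k H H H).toLinearMap.lTensor H
        (TensorProduct.assoc k H (H ⊗[k] H) H ((comul₃ (k := k)).rTensor H T))) := by
    intro T
    induction T using TensorProduct.induction_on with
    | zero => simp
    | add a b ha hb => simp only [map_add]; rw [ha, hb]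
    | tmul x w =>
      simp only [TensorProduct.map_tmul, LinearMap.mul'_apply, AlgHom.toLinearMap_apply,
        LinearMap.comp_apply, LinearMap.flip_apply, LinearMap.rTensor_tmul]
      rw [Crossed.inr_mul_inlₗ, straighten, LinearMap.comp_apply]
      generalize comul₃ (k := k) x = X
      induction X using TensorProduct.induction_on with
      | zero => simp
      | add a b ha hb =>
        simp only [map_add, LinearMap.add_apply, TensorProduct.add_tmul]; rw [ha, hb]
      | tmul x X =>
        induction X using TensorProduct.induction_on with
        | zero => simp
        | add a b ha hb =>
          simp only [map_add, LinearMap.add_apply, TensorProduct.tmul_add,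
            TensorProduct.add_tmul]
          rw [ha, hb]
        | tmul y z =>
          rw [twist_tmul, Crossed.equiv_tmul, twistAct_apply]
          simp [M, D, hitLeft_hitRight, hitRight_hitRight, aut_apply_antipodeInv]
  have e2 : ∀ T : H ⊗[k] H, M (((comul (R := k)).lTensor H).lTensor H
      ((comul (R := k)).lTensor H T)) = LinearMap.mul' k (Crossed hS g)
      (TensorProduct.map
        (Crossed.inlₗ hS g ∘ₗ (hitLeft (k := k) (H := H)).flip q ∘ₗ (g.fst : H →ₗ[k] H))
        (Crossed.inr hS g).toLinearMap T) := by
    intro T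
    induction T using TensorProduct.induction_on with
    | zero => simp
    | add a b ha hb => simp only [map_add]; rw [ha, hb]
    | tmul x y =>
      have hD : ∀ v : H, D (comul (R := k) v) = counit (R := k) v • q := by
        intro v
        simp only [D, LinearMap.comp_apply, LinearEquiv.coe_coe]
        rw [mul_antipodeInv_comul, Algebra.algebraMap_eq_smul_one]
        simp [hitRight_one]
      have a1 : ∀ Y : H ⊗[k] H, M (x ⊗ₜ[k] ((comul (R := k)).lTensor H Y)) =
          Crossed.inlₗ hS g (hitLeft (g.fst x) q) *
            Crossed.inr hS g (TensorProduct.rid k H ((counit (R := k)).lTensor H Y)) := by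
        intro Y
        induction Y using TensorProduct.induction_on with
        | zero => simp
        | add a b ha hb => simp only [map_add, TensorProduct.tmul_add, mul_add]; rw [ha, hb]
        | tmul y v => simp [M, hD]
      rw [LinearMap.lTensor_tmul, LinearMap.lTensor_tmul, a1]
      simp
  refine (e1 (comul h)).trans ((congrArg M (LinearMap.congr_fun reb h)).trans (e2 (comul h)))

namespace Crossed

variable (g : AutPair k H)

/-- The algebra morphism `p ⋈ h ↦ K(p) I(h)` for morphisms satisfying the cross relation. -/
def lift {B : Type*} [Ring B] [Algebra k B] (K : Dual k H →ₗ[k] B) (I : H →ₐ[k] B)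
    (K_one : K (counit : H →ₗ[k] k) = 1) (K_mul : ∀ p q, K (dualMul p q) = K p * K q)
    (hKI : CrossRel g K I.toLinearMap) : Crossed hS g →ₐ[k] B :=
  AlgHom.ofLinearMap (LinearMap.mul' k B ∘ₗ TensorProduct.map K I.toLinearMap ∘ₗ
      (equiv hS g).symm.toLinearMap)
    (by
      rw [one_def]
      simp [K_one])
    (fun x y => by
      obtain ⟨x, rfl⟩ := (equiv hS g).surjective x
      obtain ⟨y, rfl⟩ := (equiv hS g).surjective y
      rw [equiv_mul_equiv]
      simp only [LinearMap.comp_apply, LinearEquiv.coe_coe, LinearEquiv.symm_apply_apply]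
      induction x using TensorProduct.induction_on with
      | zero => simp
      | add a b ha hb => simp only [map_add, LinearMap.add_apply, add_mul]; rw [ha, hb]
      | tmul p h =>
        induction y using TensorProduct.induction_on with
        | zero => simp
        | add a b ha hb => simp only [map_add, mul_add]; rw [ha, hb]
        | tmul q l =>
          -- Multiplicativity of `K` and `I` strips off the outer factors `p` and `l`; what remains
          -- is `h` moved past `q`, which is `CrossRel.lift_straighten`.
          have e : ∀ T : Dual k H ⊗[k] H, LinearMap.mul' k B (TensorProduct.map K I.toLinearMap
              (sandwich p l T)) =
              K p * LinearMap.mul' k B (TensorProduct.map K I.toLinearMap T) * I l := by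
            intro T
            induction T using TensorProduct.induction_on with
            | zero => simp
            | add a b ha hb => simp only [map_add, mul_add, add_mul]; rw [ha, hb]
            | tmul q h => simp [sandwich_tmul, K_mul, mul_assoc]
          rw [crossedMul_tmul, e, hKI.lift_straighten hS]
          simp [mul_assoc])

theorem lift_equiv {B : Type*} [Ring B] [Algebra k B] (K : Dual k H →ₗ[k] B) (I : H →ₐ[k] B)
    (K_one : K (counit : H →ₗ[k] k) = 1) (K_mul : ∀ p q, K (dualMul p q) = K p * K q)
    (hKI : CrossRel g K I.toLinearMap) (p : Dual k H) (h : H) :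
    lift hS g K I K_one K_mul hKI (equiv hS g (p ⊗ₜ[k] h)) = K p * I h := rfl

theorem lift_inlₗ {B : Type*} [Ring B] [Algebra k B] (K : Dual k H →ₗ[k] B) (I : H →ₐ[k] B)
    (K_one : K (counit : H →ₗ[k] k) = 1) (K_mul : ∀ p q, K (dualMul p q) = K p * K q)
    (hKI : CrossRel g K I.toLinearMap) (p : Dual k H) :
    lift hS g K I K_one K_mul hKI (inlₗ hS g p) = K p := by
  rw [inlₗ_apply, lift_equiv, map_one, mul_one]

theorem lift_inr {B : Type*} [Ring B] [Algebra k B] (K : Dual k H →ₗ[k] B) (I : H →ₐ[k] B)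
    (K_one : K (counit : H →ₗ[k] k) = 1) (K_mul : ∀ p q, K (dualMul p q) = K p * K q)
    (hKI : CrossRel g K I.toLinearMap) (h : H) :
    lift hS g K I K_one K_mul hKI (inr hS g h) = I h := by
  rw [inr_apply, lift_equiv, K_one, one_mul]

/-- Renaming the index fixes the generators, so on them every cast in the axioms disappears. -/
theorem cast_inlₗ {g g' : AutPair k H} (h : g = g') (p : Dual k H) :
    AlgEquiv.cast (R := k) (A := Crossed hS) h (inlₗ hS g p) = inlₗ hS g' p := by
  subst h; rfl

theorem cast_inr {g g' : AutPair k H} (h : g = g') (x : H) :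
    AlgEquiv.cast (R := k) (A := Crossed hS) h (inr hS g x) = inr hS g' x := by
  subst h; rfl

end Crossed

end Generators

/-! ### The bialgebra structure of `H^*` in terms of dual bases. -/

section Dualizing

variable {k H : Type*} [Field k] [Ring H] [HopfAlgebra k H]

/-- Both sides expand to the double sum with the matrix coefficients of `f`. This is the invariance
of the canonical element `∑ e_i ⊗ e^i`, in a form ready for any bilinear map. -/
theorem sum_basis_coord_comp {ι : Type*} [Fintype ι] (e : Basis ι k H) {M : Type*}
    [AddCommMonoid M] [Module k M] (F : H →ₗ[k] Dual k H →ₗ[k] M) (f : H →ₗ[k] H) :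
    ∑ i, F (f (e i)) (e.coord i) = ∑ i, F (e i) (e.coord i ∘ₗ f) := by
  have h1 : ∀ i, F (f (e i)) (e.coord i) =
      ∑ j, e.coord j (f (e i)) • F (e j) (e.coord i) := by
    intro i
    conv_lhs => rw [← e.sum_repr (f (e i))]
    simp [-Basis.sum_repr]
  have h2 : ∀ j, F (e j) (e.coord j ∘ₗ f) = ∑ i, e.coord j (f (e i)) • F (e j) (e.coord i) := by
    intro j
    conv_lhs => rw [← e.sum_dual_apply_smul_coord (e.coord j ∘ₗ f)]
    simp
  simp only [h1, h2]
  exact Finset.sum_comm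

variable [FiniteDimensional k H]

theorem dualDistrib_injective : Function.Injective (TensorProduct.dualDistrib k H H) := by
  exact (TensorProduct.dualDistribEquiv k H H).injective

theorem dualDistrib_dualComul (p : Dual k H) :
    TensorProduct.dualDistrib k H H (dualComul p) = p ∘ₗ LinearMap.mul' k H := by
  exact (TensorProduct.dualDistribEquiv k H H).apply_symm_apply _

/-- Pairing with `x ⊗ y` and expanding `x` in the basis gives `p(xy)` on both sides. The companion
`dualComul_eq_sum'` expands `y` instead. -/
theorem dualComul_eq_sum {ι : Type*} [Fintype ι] (e : Basis ι k H) (p : Dual k H) :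
    dualComul p = ∑ i, e.coord i ⊗ₜ[k] hitRight (e i) p := by
  apply dualDistrib_injective
  rw [dualDistrib_dualComul]
  ext x y
  conv_lhs => rw [← e.sum_repr x]
  simp [hitRight_apply, -Basis.sum_repr]

theorem dualComul_eq_sum' {ι : Type*} [Fintype ι] (e : Basis ι k H) (p : Dual k H) :
    dualComul p = ∑ i, hitLeft (e i) p ⊗ₜ[k] e.coord i := by
  apply dualDistrib_injective
  rw [dualDistrib_dualComul]
  ext x y
  conv_lhs => rw [← e.sum_repr y]
  simp [hitLeft_apply, mul_comm, -Basis.sum_repr]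

theorem dualComul_hitLeft (x : H) (p : Dual k H) :
    dualComul (hitLeft x p) = (hitLeft x).lTensor (Dual k H) (dualComul p) := by
  let e := finBasis k H
  simp [dualComul_eq_sum e, hitLeft_hitRight]

theorem dualComul_hitRight (x : H) (p : Dual k H) :
    dualComul (hitRight x p) = (hitRight x).rTensor (Dual k H) (dualComul p) := by
  let e := finBasis k H
  simp [dualComul_eq_sum' e, hitLeft_hitRight]

/-- Both sides represent `h ⊗ l ↦ p(h x l)`. This lets an element of `H` pass from one tensor factor
to the other in `crossRel_comul`. -/
theorem dualComul_balanced (x : H) (p : Dual k H) :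
    (hitLeft x).rTensor (Dual k H) (dualComul p) =
      (hitRight x).lTensor (Dual k H) (dualComul p) := by
  rw [dualComul_eq_sum (finBasis k H)]
  simp only [map_sum, LinearMap.rTensor_tmul, LinearMap.lTensor_tmul, hitRight_hitRight]
  exact (sum_basis_coord_comp (finBasis k H)
    ((TensorProduct.mk k (Dual k H) (Dual k H)).flip ∘ₗ (hitRight (k := k)).flip p)
    (LinearMap.mulRight k x)).symm

theorem dualComul_coassoc (p : Dual k H) :
    TensorProduct.assoc k _ _ _ ((dualComul (k := k)).rTensor (Dual k H) (dualComul p)) =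
      (dualComul (k := k)).lTensor (Dual k H) (dualComul p) := by
  let e := finBasis k H
  rw [dualComul_eq_sum e]
  simp only [map_sum, LinearMap.rTensor_tmul, LinearMap.lTensor_tmul]
  -- The two different expansions are chosen so that both sides have the middle factor `e^j`; then
  -- only right multiplication by `e_j` has to be transposed.
  simp only [dualComul_eq_sum' e (e.coord _), dualComul_eq_sum e (hitRight _ _), hitRight_hitRight,
    TensorProduct.sum_tmul, TensorProduct.tmul_sum, map_sum, TensorProduct.assoc_tmul]
  rw [Finset.sum_comm]
  conv_rhs => rw [Finset.sum_comm]
  refine Finset.sum_congr rfl fun j _ => ?_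
  exact (sum_basis_coord_comp e
    ((TensorProduct.mk k (Dual k H) (Dual k H ⊗[k] Dual k H)).flip ∘ₗ
      TensorProduct.mk k (Dual k H) (Dual k H) (e.coord j) ∘ₗ (hitRight (k := k)).flip p)
    (LinearMap.mulRight k (e j))).symm

theorem dualComul_counit : dualComul (counit : H →ₗ[k] k) =
    (counit : H →ₗ[k] k) ⊗ₜ[k] (counit : H →ₗ[k] k) := by
  apply dualDistrib_injective
  rw [dualDistrib_dualComul]
  ext x y
  simp

theorem dualComul_dualMul (p q : Dual k H) :
    dualComul (dualMul p q) = TensorProduct.map₂ dualMul dualMul (dualComul p) (dualComul q) := by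
  apply dualDistrib_injective
  rw [dualDistrib_dualComul]
  ext x y
  -- The pairing turns the product of `H^* ⊗ H^*` into the coproduct of `H ⊗ H`, so the claim
  -- becomes multiplicativity of `Δ` on `H`.
  have e : ∀ P Q : Dual k H ⊗[k] Dual k H,
      TensorProduct.dualDistrib k H H (TensorProduct.map₂ dualMul dualMul P Q) (x ⊗ₜ[k] y) =
      LinearMap.mul' k k (TensorProduct.map (TensorProduct.dualDistrib k H H P)
        (TensorProduct.dualDistrib k H H Q)
        (TensorProduct.tensorTensorTensorComm k H H H H (comul x ⊗ₜ[k] comul y))) := by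
    intro P Q
    induction P using TensorProduct.induction_on with
    | zero => simp
    | add a b ha hb =>
      simp only [map_add, LinearMap.add_apply, TensorProduct.map_add_left]; rw [ha, hb]
    | tmul p p' =>
      induction Q using TensorProduct.induction_on with
      | zero => simp
      | add a b ha hb =>
        simp only [map_add, LinearMap.add_apply, TensorProduct.map_add_right]; rw [ha, hb]
      | tmul q q' =>
        rw [TensorProduct.map₂_apply_tmul, TensorProduct.map_tmul,
          TensorProduct.dualDistrib_apply, dualMul_apply, dualMul_apply]
        generalize comul (R := k) x = X
        generalize comul (R := k) y = Y
        induction X using TensorProduct.induction_on with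
        | zero => simp
        | add a b ha hb => simp only [map_add, TensorProduct.add_tmul, add_mul]; rw [ha, hb]
        | tmul x x' =>
          induction Y using TensorProduct.induction_on with
          | zero => simp
          | add a b ha hb => simp only [map_add, TensorProduct.tmul_add, mul_add]; rw [ha, hb]
          | tmul y y' =>
            simp
            ring
  simp only [TensorProduct.AlgebraTensorModule.curry_apply, TensorProduct.curry_apply,
    LinearMap.restrictScalars_self]
  rw [e, dualDistrib_dualComul, dualDistrib_dualComul, LinearMap.comp_apply, LinearMap.mul'_apply,
    dualMul_apply, Bialgebra.comul_mul]
  generalize comul (R := k) x = X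
  generalize comul (R := k) y = Y
  induction X using TensorProduct.induction_on with
  | zero => simp
  | add a b ha hb => simp only [map_add, TensorProduct.add_tmul, add_mul]; rw [ha, hb]
  | tmul x x' =>
    induction Y using TensorProduct.induction_on with
    | zero => simp
    | add a b ha hb => simp only [map_add, TensorProduct.tmul_add, mul_add]; rw [ha, hb]
    | tmul y y' => simp

end Dualizing

/-! ### Constants and change of maps in the convolution algebra. -/

section Constants

variable {k H : Type*} [Field k] [Ring H] [HopfAlgebra k H]
variable {B : Type*} [Ring B] [Algebra k B]

/-- The constant `h ↦ ε(h) c` of the convolution algebra. -/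
def convConst (c : B) : WithConv (H →ₗ[k] B) :=
  toConv (LinearMap.toSpanSingleton k B c ∘ₗ counit)

/-- By the counit law, convolving with a constant is multiplying values by it. Sums over a dual
basis thereby become sums of convolution products with constant coefficients. -/
theorem convConst_mul (c : B) (f : WithConv (H →ₗ[k] B)) :
    convConst c * f = toConv (LinearMap.mulLeft k c ∘ₗ f.ofConv) := by
  ext h
  rw [LinearMap.convMul_apply]
  have : ∀ T : H ⊗[k] H, LinearMap.mul' k B (TensorProduct.map (convConst c).ofConv f.ofConv T) =
      c * f.ofConv (TensorProduct.lid k H ((counit (R := k)).rTensor H T)) := by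
    intro T
    induction T using TensorProduct.induction_on with
    | zero => simp
    | add a b ha hb => simp only [map_add, mul_add]; rw [ha, hb]
    | tmul a b => simp [convConst]
  rw [this]
  simp

theorem mul_convConst (c : B) (f : WithConv (H →ₗ[k] B)) :
    f * convConst c = toConv (LinearMap.mulRight k c ∘ₗ f.ofConv) := by
  ext h
  rw [LinearMap.convMul_apply]
  have : ∀ T : H ⊗[k] H, LinearMap.mul' k B (TensorProduct.map f.ofConv (convConst c).ofConv T) =
      f.ofConv (TensorProduct.rid k H ((counit (R := k)).lTensor H T)) * c := by
    intro T
    induction T using TensorProduct.induction_on with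
    | zero => simp
    | add a b ha hb => simp only [map_add, add_mul]; rw [ha, hb]
    | tmul a b => simp [convConst]
  rw [this]
  simp

/-- Composition with an algebra map after, or a coalgebra map before, preserves convolution
products, hence the relation. -/
theorem CrossRel.comp {g : AutPair k H} {B' : Type*} [Ring B'] [Algebra k B']
    {K : Dual k H →ₗ[k] B} {I : H →ₗ[k] B} (hKI : CrossRel g K I) (φ : B →ₐ[k] B')
    (f : H ≃ₐc[k] H) (q : Dual k H) :
    toConv (φ.toLinearMap ∘ₗ I ∘ₗ (f : H →ₗ[k] H)) *
      toConv (φ.toLinearMap ∘ₗ K ∘ₗ (hitRight (k := k) (H := H)).flip q ∘ₗ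
        ((g.snd * f : H ≃ₐc[k] H) : H →ₗ[k] H)) =
      toConv (φ.toLinearMap ∘ₗ K ∘ₗ (hitLeft (k := k) (H := H)).flip q ∘ₗ
        ((g.fst * f : H ≃ₐc[k] H) : H →ₗ[k] H)) *
      toConv (φ.toLinearMap ∘ₗ I ∘ₗ (f : H →ₗ[k] H)) := by
  have h1 := congrArg (fun u : WithConv (H →ₗ[k] B) =>
    φ.toLinearMap ∘ₗ u.ofConv ∘ₗ (f : H →ₗc[k] H).toLinearMap) (hKI q)
  simp only [LinearMap.convMul_comp_coalgHom_distrib] at h1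
  have h2 := fun u v : WithConv (H →ₗ[k] B) => LinearMap.algHom_comp_convMul_distrib φ u v
  apply WithConv.ofConv_injective
  refine Eq.trans (h2 _ _).symm (Eq.trans h1 (h2 _ _))

end Constants

/-! ### Counit, conjugation and comultiplication: verification of the cross relations. -/

section Morphisms

variable {k H : Type*} [Field k] [Ring H] [HopfAlgebra k H]
variable (hS : Function.Bijective (HopfAlgebra.antipode k (A := H)))

/-- The counit of `D(H)` as an algebra morphism. -/
def counitHom : Crossed hS (1 : AutPair k H) →ₐ[k] k :=
  Crossed.lift hS 1 (Dual.eval k H 1) (Bialgebra.counitAlgHom k H)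
    (by simp [Dual.eval_apply])
    (fun p q => by
      rw [Dual.eval_apply, dualMul_apply, Bialgebra.comul_one, Algebra.TensorProduct.one_def]
      simp [Dual.eval_apply])
    (fun q => by
      ext h
      -- At the unit index both automorphisms are the identity, and both sides of the cross relation
      -- evaluate to `q(h)`.
      have e1 : ∀ T : H ⊗[k] H, LinearMap.mul' k k (TensorProduct.map (counit (R := k))
          (Dual.eval k H 1 ∘ₗ (hitRight (k := k) (H := H)).flip q) T) =
          q (TensorProduct.lid k H ((counit (R := k)).rTensor H T)) := by
        intro T
        induction T using TensorProduct.induction_on with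
        | zero => simp
        | add a b ha hb => simp only [map_add]; rw [ha, hb]
        | tmul a b => simp [Dual.eval_apply, hitRight_apply]
      have e2 : ∀ T : H ⊗[k] H, LinearMap.mul' k k (TensorProduct.map
          (Dual.eval k H 1 ∘ₗ (hitLeft (k := k) (H := H)).flip q) (counit (R := k)) T) =
          q (TensorProduct.rid k H ((counit (R := k)).lTensor H T)) := by
        intro T
        induction T using TensorProduct.induction_on with
        | zero => simp
        | add a b ha hb => simp only [map_add]; rw [ha, hb]
        | tmul a b => simp [Dual.eval_apply, hitLeft_apply, mul_comm]
      rw [LinearMap.convMul_apply, LinearMap.convMul_apply]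
      refine (e1 (comul h)).trans (Eq.trans ?_ (e2 (comul h)).symm)
      simp)

theorem transpose_dualMul (f : H ≃ₐc[k] H) (p q : Dual k H) :
    Dual.transpose (f : H →ₗ[k] H) (dualMul p q) =
      dualMul (Dual.transpose (f : H →ₗ[k] H) p) (Dual.transpose (f : H →ₗ[k] H) q) := by
  ext x
  have hx : comul (R := k) (f x) =
      TensorProduct.map (f : H →ₗ[k] H) (f : H →ₗ[k] H) (comul x) :=
    (CoalgHomClass.map_comp_comul_apply f x).symm
  change dualMul p q (f x) = _
  rw [dualMul_apply, dualMul_apply, hx, ← LinearMap.comp_apply (TensorProduct.map p q),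
    ← TensorProduct.map_comp]
  rfl

theorem transpose_hitRight (f : H ≃ₐc[k] H) (x : H) (p : Dual k H) :
    Dual.transpose (f : H →ₗ[k] H) (hitRight (f x) p) =
      hitRight x (Dual.transpose (f : H →ₗ[k] H) p) := by
  ext l
  exact congrArg p (map_mul f x l).symm

theorem transpose_hitLeft (f : H ≃ₐc[k] H) (x : H) (p : Dual k H) :
    Dual.transpose (f : H →ₗ[k] H) (hitLeft (f x) p) =
      hitLeft x (Dual.transpose (f : H →ₗ[k] H) p) := by
  ext l
  exact congrArg p (map_mul f l x).symm

/-- The transpose of `τ` carries `q ↼ τ(x)` to the transpose of `q` acted on by `x`, likewise for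
`⇀`; so a factor `τ` on the left of `α` and `β` is absorbed by `K`, and a factor `f` on the right by
`I`. -/
theorem CrossRel.comp_transpose {g g' : AutPair k H} {B : Type*} [Ring B] [Algebra k B]
    {K : Dual k H →ₗ[k] B} {I : H →ₗ[k] B} (hKI : CrossRel g K I) {τ f : H ≃ₐc[k] H}
    (h1 : g'.fst = τ * (g.fst * f)) (h2 : g'.snd = τ * (g.snd * f)) :
    CrossRel g' (K ∘ₗ Dual.transpose (τ : H →ₗ[k] H)) (I ∘ₗ (f : H →ₗ[k] H)) := by
  intro q
  have e1 : (K ∘ₗ Dual.transpose (τ : H →ₗ[k] H)) ∘ₗ (hitRight (k := k) (H := H)).flip q ∘ₗ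
      (g'.snd : H →ₗ[k] H) = K ∘ₗ (hitRight (k := k) (H := H)).flip
        (Dual.transpose (τ : H →ₗ[k] H) q) ∘ₗ ((g.snd * f : H ≃ₐc[k] H) : H →ₗ[k] H) := by
    rw [h2]
    ext x
    exact congrArg K (transpose_hitRight τ ((g.snd * f) x) q)
  have e2 : (K ∘ₗ Dual.transpose (τ : H →ₗ[k] H)) ∘ₗ (hitLeft (k := k) (H := H)).flip q ∘ₗ
      (g'.fst : H →ₗ[k] H) = K ∘ₗ (hitLeft (k := k) (H := H)).flip
        (Dual.transpose (τ : H →ₗ[k] H) q) ∘ₗ ((g.fst * f : H ≃ₐc[k] H) : H →ₗ[k] H) := by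
    rw [h1]
    ext x
    exact congrArg K (transpose_hitLeft τ ((g.fst * f) x) q)
  rw [e1, e2]
  exact hKI.comp (AlgHom.id k B) f (Dual.transpose (τ : H →ₗ[k] H) q)

/-- The conjugation of `DT(H)` as an algebra morphism. -/
def conjHom (g h : AutPair k H) : Crossed hS h →ₐ[k] Crossed hS (g * h * g⁻¹) :=
  Crossed.lift hS h
    (Crossed.inlₗ hS (g * h * g⁻¹) ∘ₗ
      Dual.transpose ((g.snd * g.fst⁻¹ : H ≃ₐc[k] H) : H →ₗ[k] H))
    ((Crossed.inr hS (g * h * g⁻¹)).comp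
      ((g.fst * h.fst⁻¹ * g.snd⁻¹ * h.fst : H ≃ₐc[k] H) : H →ₐ[k] H))
    (by
      have : Dual.transpose ((g.snd * g.fst⁻¹ : H ≃ₐc[k] H) : H →ₗ[k] H) (counit : H →ₗ[k] k) =
          (counit : H →ₗ[k] k) := by
        ext x
        exact CoalgHomClass.counit_comp_apply (g.snd * g.fst⁻¹ : H ≃ₐc[k] H) x
      rw [LinearMap.comp_apply, this, Crossed.inlₗ_counit])
    (fun p q => by
      rw [LinearMap.comp_apply, transpose_dualMul, Crossed.inlₗ_dualMul]; rfl)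
    (fun q => by
      -- The pair `τ = βα⁻¹`, `f = αγ⁻¹β⁻¹γ` carries the two automorphisms of the conjugated index
      -- back to `γ` and `δ`.
      have e1 : h.snd = (g.snd * g.fst⁻¹) *
          ((g * h * g⁻¹).snd * (g.fst * h.fst⁻¹ * g.snd⁻¹ * h.fst)) := by
        change h.snd = (g.snd * g.fst⁻¹) * ((g.fst * g.snd⁻¹ * g.fst⁻¹) * (g.fst⁻¹)⁻¹ *
          (h.snd * h.fst⁻¹ * g.snd * h.fst) * g.fst⁻¹ * (g.fst * h.fst⁻¹ * g.snd⁻¹ * h.fst))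
        group
      have e2 : h.fst = (g.snd * g.fst⁻¹) *
          ((g * h * g⁻¹).fst * (g.fst * h.fst⁻¹ * g.snd⁻¹ * h.fst)) := by
        change h.fst = (g.snd * g.fst⁻¹) * ((g.fst * h.fst * g.fst⁻¹) *
          (g.fst * h.fst⁻¹ * g.snd⁻¹ * h.fst))
        group
      exact (Crossed.crossRel hS (g * h * g⁻¹)).comp_transpose e2 e1 q)

theorem conjHom_inlₗ (g h : AutPair k H) (p : Dual k H) : conjHom hS g h (Crossed.inlₗ hS h p) =
    Crossed.inlₗ hS _ (Dual.transpose ((g.snd * g.fst⁻¹ : H ≃ₐc[k] H) : H →ₗ[k] H) p) :=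
  Crossed.lift_inlₗ ..

theorem conjHom_inr (g h : AutPair k H) (x : H) : conjHom hS g h (Crossed.inr hS h x) =
    Crossed.inr hS _ ((g.fst * h.fst⁻¹ * g.snd⁻¹ * h.fst) x) :=
  Crossed.lift_inr ..

theorem conjHom_toLinearMap (g h : AutPair k H) : (conjHom hS g h).toLinearMap = dtConj hS g h := by
  ext x
  obtain ⟨x, rfl⟩ := (Crossed.equiv hS h).surjective x
  induction x using TensorProduct.induction_on with
  | zero => simp
  | add a b ha hb => simp only [map_add]; rw [ha, hb]
  | tmul p x =>
    exact (Crossed.equiv_tmul ..).symm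

/-- `x ↦ (ε ⋈ γ(x₁)) ⊗ (ε ⋈ γ⁻¹βγ(x₂))` for `g = (α, β)` and `h = (γ, δ)`. -/
def comulInr (g h : AutPair k H) : H →ₐ[k] Crossed hS g ⊗[k] Crossed hS h :=
  (Algebra.TensorProduct.map ((Crossed.inr hS g).comp (h.fst : H →ₐ[k] H))
    ((Crossed.inr hS h).comp ((h.fst⁻¹ * g.snd * h.fst : H ≃ₐc[k] H) : H →ₐ[k] H))).comp
      (Bialgebra.comulAlgHom k H)

/-- Splits the coproduct on `H` into a convolution product of one map into each tensor factor, so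
that the cross relations of the factors can be applied separately. -/
theorem comulInr_eq_mul (g h : AutPair k H) :
    toConv (comulInr hS g h).toLinearMap =
      toConv ((Algebra.TensorProduct.includeLeft :
          Crossed hS g →ₐ[k] _ ⊗[k] Crossed hS h).toLinearMap ∘ₗ
        (Crossed.inr hS g).toLinearMap ∘ₗ (h.fst : H →ₗ[k] H)) *
      toConv ((Algebra.TensorProduct.includeRight :
          Crossed hS h →ₐ[k] Crossed hS g ⊗[k] _).toLinearMap ∘ₗ
        (Crossed.inr hS h).toLinearMap ∘ₗ
          ((h.fst⁻¹ * g.snd * h.fst : H ≃ₐc[k] H) : H →ₗ[k] H)) := by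
  ext x
  rw [LinearMap.convMul_apply]
  change Algebra.TensorProduct.map _ _ (comul (R := k) x) = _
  generalize comul (R := k) x = X
  induction X using TensorProduct.induction_on with
  | zero => simp
  | add a b ha hb => simp only [map_add]; rw [ha, hb]
  | tmul a b => simp

variable [FiniteDimensional k H]

/-- `p ↦ (p₂ ⋈ 1) ⊗ (p₁ ⋈ 1)`. -/
def comulInl (g h : AutPair k H) : Dual k H →ₗ[k] Crossed hS g ⊗[k] Crossed hS h :=
  TensorProduct.map (Crossed.inlₗ hS g) (Crossed.inlₗ hS h) ∘ₗ
    (TensorProduct.comm k (Dual k H) (Dual k H)).toLinearMap ∘ₗ dualComul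

theorem comulInl_dualMul (g h : AutPair k H) (p q : Dual k H) :
    comulInl hS g h (dualMul p q) = comulInl hS g h p * comulInl hS g h q := by
  simp only [comulInl, LinearMap.comp_apply, LinearEquiv.coe_coe]
  rw [dualComul_dualMul]
  generalize dualComul p = P
  generalize dualComul q = Q
  induction P using TensorProduct.induction_on with
  | zero => simp
  | add a b ha hb =>
    simp only [map_add, LinearMap.add_apply, add_mul]; rw [ha, hb]
  | tmul p p' =>
    induction Q using TensorProduct.induction_on with
    | zero => simp
    | add a b ha hb => simp only [map_add, mul_add]; rw [ha, hb]
    | tmul q q' =>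
      rw [TensorProduct.map₂_apply_tmul, TensorProduct.map_tmul]
      simp [Crossed.inlₗ_dualMul]

theorem comulInl_counit (g h : AutPair k H) :
    comulInl hS g h (counit : H →ₗ[k] k) = 1 := by
  simp only [comulInl, LinearMap.comp_apply, LinearEquiv.coe_coe]
  rw [dualComul_counit]
  simp [Crossed.inlₗ_counit, Algebra.TensorProduct.one_def]

/-- Write the coproduct on `H` as `U * V`, with values in the first and second factor, and put `θ =
γ⁻¹βγ`. The cross relation of the second factor moves `V` past the functionals, changing `δθ` on the
right to `γθ` on the left. As `γθ = βγ`, `dualComul_balanced` passes this element to the first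
factor, whose cross relation moves `U` and changes `βγ` to `αγ`. The resulting pair `(αγ, δθ)` is
the product in the group. -/
theorem crossRel_comul (g h : AutPair k H) :
    CrossRel (g * h) (comulInl hS g h) (comulInr hS g h).toLinearMap := by
  intro q
  rw [comulInr_eq_mul]
  let e := finBasis k H
  let iL : Crossed hS g →ₐ[k] Crossed hS g ⊗[k] Crossed hS h := Algebra.TensorProduct.includeLeft
  let iR : Crossed hS h →ₐ[k] Crossed hS g ⊗[k] Crossed hS h := Algebra.TensorProduct.includeRight
  let θ : H ≃ₐc[k] H := h.fst⁻¹ * g.snd * h.fst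
  set U := toConv (iL.toLinearMap ∘ₗ (Crossed.inr hS g).toLinearMap ∘ₗ (h.fst : H →ₗ[k] H))
  set V := toConv (iR.toLinearMap ∘ₗ (Crossed.inr hS h).toLinearMap ∘ₗ (θ : H →ₗ[k] H))
  let c := fun i => iL (Crossed.inlₗ hS g (hitRight (e i) q))
  let d := fun i => iR (Crossed.inlₗ hS h (e.coord i))
  let W := fun i => toConv (iR.toLinearMap ∘ₗ Crossed.inlₗ hS h ∘ₗ
    (hitRight (k := k) (H := H)).flip (e.coord i) ∘ₗ ((h.snd * θ : H ≃ₐc[k] H) : H →ₗ[k] H))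
  let W' := fun i => toConv (iR.toLinearMap ∘ₗ Crossed.inlₗ hS h ∘ₗ
    (hitLeft (k := k) (H := H)).flip (e.coord i) ∘ₗ ((h.fst * θ : H ≃ₐc[k] H) : H →ₗ[k] H))
  let X := fun i => toConv (iL.toLinearMap ∘ₗ Crossed.inlₗ hS g ∘ₗ
    (hitRight (k := k) (H := H)).flip (hitRight (e i) q) ∘ₗ
      ((g.snd * h.fst : H ≃ₐc[k] H) : H →ₗ[k] H))
  let Y := fun i => toConv (iL.toLinearMap ∘ₗ Crossed.inlₗ hS g ∘ₗ
    (hitLeft (k := k) (H := H)).flip (hitRight (e i) q) ∘ₗ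
      ((g.fst * h.fst : H ≃ₐc[k] H) : H →ₗ[k] H))
  have hVW : ∀ i, V * W i = W' i * V := fun i => (Crossed.crossRel hS h).comp iR θ (e.coord i)
  have hUX : ∀ i, U * X i = Y i * U := fun i =>
    (Crossed.crossRel hS g).comp iL h.fst (hitRight (e i) q)
  -- A map into one tensor factor commutes with constants from the other.
  have hVc : ∀ i, V * convConst (c i) = convConst (c i) * V := by
    intro i
    rw [mul_convConst, convConst_mul]
    ext x
    simp [V, c, iL, iR]
  have hUd : ∀ i, U * convConst (d i) = convConst (d i) * U := by
    intro i
    rw [mul_convConst, convConst_mul]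
    ext x
    simp [U, d, iL, iR]
  have hK : ∀ P : Dual k H ⊗[k] Dual k H, TensorProduct.map (Crossed.inlₗ hS g)
      (Crossed.inlₗ hS h) (TensorProduct.comm k _ _ P) = LinearMap.mul' k _
        (TensorProduct.map (iR.toLinearMap ∘ₗ Crossed.inlₗ hS h)
          (iL.toLinearMap ∘ₗ Crossed.inlₗ hS g) P) := by
    intro P
    induction P using TensorProduct.induction_on with
    | zero => simp
    | add a b ha hb => simp only [map_add]; rw [ha, hb]
    | tmul p q => simp [iL, iR]
  have hiLR : ∀ x y, iR y * iL x = iL x * iR y := by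
    intro x y
    simp [iL, iR]
  have h1 : toConv (comulInl hS g h ∘ₗ (hitRight (k := k) (H := H)).flip q ∘ₗ
      ((g * h).snd : H →ₗ[k] H)) = ∑ i, convConst (c i) * W i := by
    have hs : (g * h).snd = h.snd * θ := by
      change h.snd * h.fst⁻¹ * g.snd * h.fst = h.snd * (h.fst⁻¹ * g.snd * h.fst)
      group
    rw [hs]
    simp only [convConst_mul]
    ext x
    simp only [comulInl, LinearMap.comp_apply, LinearMap.flip_apply, LinearEquiv.coe_coe]
    rw [dualComul_hitRight, hK, dualComul_eq_sum e]
    simp [W, c, hiLR]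
  -- The passage between the factors; it needs `βγ = γθ`, which dictates the automorphism `γ⁻¹βγ` in
  -- the coproduct.
  have h3 : ∑ i, convConst (c i) * W' i = ∑ i, convConst (d i) * X i := by
    have hs : g.snd * h.fst = h.fst * θ := by
      change g.snd * h.fst = h.fst * (h.fst⁻¹ * g.snd * h.fst)
      group
    simp only [X, hs, convConst_mul]
    ext x
    have := congrArg (fun P => LinearMap.mul' k _
        (TensorProduct.map (iR.toLinearMap ∘ₗ Crossed.inlₗ hS h)
          (iL.toLinearMap ∘ₗ Crossed.inlₗ hS g) P)) (dualComul_balanced ((h.fst * θ) x) q)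
    simp only [dualComul_eq_sum e] at this
    simpa [W', c, d, hiLR] using this
  have h5 : toConv (comulInl hS g h ∘ₗ (hitLeft (k := k) (H := H)).flip q ∘ₗ
      ((g * h).fst : H →ₗ[k] H)) = ∑ i, convConst (d i) * Y i := by
    simp only [convConst_mul]
    ext x
    simp only [comulInl, LinearMap.comp_apply, LinearMap.flip_apply, LinearEquiv.coe_coe]
    rw [dualComul_hitLeft, hK, dualComul_eq_sum e]
    simp only [map_sum]
    simp [Y, d]
    rfl
  calc U * V * _ = ∑ i, U * (V * convConst (c i)) * W i := by
        rw [h1, Finset.mul_sum]; simp only [mul_assoc]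
    _ = ∑ i, U * convConst (c i) * (V * W i) := by simp only [hVc, mul_assoc]
    _ = U * (∑ i, convConst (c i) * W' i) * V := by
        simp only [hVW, Finset.mul_sum, Finset.sum_mul, mul_assoc]
    _ = ∑ i, (U * convConst (d i)) * X i * V := by
        rw [h3]; simp only [Finset.mul_sum, Finset.sum_mul, mul_assoc]
    _ = ∑ i, convConst (d i) * (U * X i) * V := by simp only [hUd, mul_assoc]
    _ = _ := by
        rw [h5]; simp only [hUX, Finset.sum_mul, mul_assoc]

end Morphisms

/-! ### The comultiplication as an algebra map, and preparations for coassociativity. -/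

section Axioms

variable {k H : Type*} [Field k] [Ring H] [HopfAlgebra k H]

namespace AutPair

theorem mul_fst (g h : AutPair k H) : (g * h).fst = g.fst * h.fst := rfl

theorem mul_snd (g h : AutPair k H) : (g * h).snd = h.snd * h.fst⁻¹ * g.snd * h.fst := rfl

theorem inv_fst (g : AutPair k H) : (g⁻¹).fst = g.fst⁻¹ := rfl

theorem inv_snd (g : AutPair k H) : (g⁻¹).snd = g.fst * g.snd⁻¹ * g.fst⁻¹ := rfl

theorem one_fst : (1 : AutPair k H).fst = 1 := rfl

theorem one_snd : (1 : AutPair k H).snd = 1 := rfl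

end AutPair

theorem comul_aut_apply (f : H ≃ₐc[k] H) (x : H) : comul (R := k) (f x) =
    TensorProduct.map (f : H →ₗ[k] H) (f : H →ₗ[k] H) (comul x) :=
  (CoalgHomClass.map_comp_comul_apply f x).symm

theorem counit_aut_apply (f : H ≃ₐc[k] H) (x : H) : counit (R := k) (f x) = counit (R := k) x :=
  CoalgHomClass.counit_comp_apply f x

variable (hS : Function.Bijective (HopfAlgebra.antipode k (A := H)))

theorem comulInr_apply (g h : AutPair k H) (x : H) : comulInr hS g h x =
    TensorProduct.map ((Crossed.inr hS g).toLinearMap ∘ₗ (h.fst : H →ₗ[k] H))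
      ((Crossed.inr hS h).toLinearMap ∘ₗ
        ((h.fst⁻¹ * g.snd * h.fst : H ≃ₐc[k] H) : H →ₗ[k] H)) (comul x) := rfl

theorem comul_map_coassoc {A B C : Type*} [AddCommGroup A] [Module k A] [AddCommGroup B]
    [Module k B] [AddCommGroup C] [Module k C] (f₁ : H →ₗ[k] A) (f₂ : H →ₗ[k] B)
    (f₃ : H →ₗ[k] C) (x : H) :
    TensorProduct.assoc k A B C (TensorProduct.map
      (TensorProduct.map f₁ f₂ ∘ₗ comul) f₃ (comul (R := k) x)) =
      TensorProduct.map f₁ (TensorProduct.map f₂ f₃ ∘ₗ comul) (comul (R := k) x) := by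
  have e1 : ∀ T : H ⊗[k] H, TensorProduct.assoc k A B C (TensorProduct.map
      (TensorProduct.map f₁ f₂ ∘ₗ comul) f₃ T) =
      TensorProduct.map f₁ (TensorProduct.map f₂ f₃)
        (TensorProduct.assoc k H H H ((comul (R := k)).rTensor H T)) := by
    intro T
    rw [TensorProduct.map_map_assoc, LinearMap.map_rTensor]
  rw [e1, Coalgebra.coassoc_apply, LinearMap.map_lTensor]

/-- Since `f` preserves `Δ`, it is absorbed into both factors; comparing coproducts then reduces to
comparing words in automorphisms. -/
theorem comulInr_comp_aut (g h : AutPair k H) (f : H ≃ₐc[k] H) :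
    (comulInr hS g h).toLinearMap ∘ₗ (f : H →ₗ[k] H) =
      TensorProduct.map ((Crossed.inr hS g).toLinearMap ∘ₗ ((h.fst * f : H ≃ₐc[k] H) : H →ₗ[k] H))
        ((Crossed.inr hS h).toLinearMap ∘ₗ
          ((h.fst⁻¹ * g.snd * h.fst * f : H ≃ₐc[k] H) : H →ₗ[k] H)) ∘ₗ comul := by
  ext x
  rw [LinearMap.comp_apply, AlgHom.toLinearMap_apply]
  refine (comulInr_apply hS g h (f x)).trans ?_
  rw [comul_aut_apply, TensorProduct.map_map]
  rfl

theorem algTensorMap_id_right {A B C : Type*} [Ring A] [Algebra k A] [Ring B] [Algebra k B]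
    [Ring C] [Algebra k C] (f : A →ₐ[k] B) (z : A ⊗[k] C) :
    Algebra.TensorProduct.map f (AlgHom.id k C) z = f.toLinearMap.rTensor C z := rfl

theorem algTensorMap_id_left {A B C : Type*} [Ring A] [Algebra k A] [Ring B] [Algebra k B]
    [Ring C] [Algebra k C] (f : A →ₐ[k] B) (z : C ⊗[k] A) :
    Algebra.TensorProduct.map (AlgHom.id k C) f z = f.toLinearMap.lTensor C z := rfl

variable [FiniteDimensional k H]

theorem comulInl_apply (g h : AutPair k H) (p : Dual k H) : comulInl hS g h p =
    TensorProduct.map (Crossed.inlₗ hS g) (Crossed.inlₗ hS h)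
      (TensorProduct.comm k _ _ (dualComul p)) := rfl

theorem dualComul_transpose (f : H ≃ₐc[k] H) (p : Dual k H) :
    dualComul (Dual.transpose (f : H →ₗ[k] H) p) =
      TensorProduct.map (Dual.transpose (f : H →ₗ[k] H)) (Dual.transpose (f : H →ₗ[k] H))
        (dualComul p) := by
  apply dualDistrib_injective
  have e : ∀ P : Dual k H ⊗[k] Dual k H, TensorProduct.dualDistrib k H H
      (TensorProduct.map (Dual.transpose (f : H →ₗ[k] H)) (Dual.transpose (f : H →ₗ[k] H)) P) =
      TensorProduct.dualDistrib k H H P ∘ₗ TensorProduct.map (f : H →ₗ[k] H) (f : H →ₗ[k] H) := by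
    intro P
    induction P using TensorProduct.induction_on with
    | zero => simp
    | add a b ha hb => simp only [map_add, LinearMap.add_comp]; rw [ha, hb]
    | tmul p q =>
      ext x y
      rfl
  rw [e, dualDistrib_dualComul, dualDistrib_dualComul]
  ext x y
  exact congrArg p (map_mul f x y)

/-- The comultiplication of `DT(H)` as an algebra morphism. -/
def comulHom (g h : AutPair k H) : Crossed hS (g * h) →ₐ[k] Crossed hS g ⊗[k] Crossed hS h :=
  Crossed.lift hS (g * h) (comulInl hS g h) (comulInr hS g h) (comulInl_counit hS g h)
    (comulInl_dualMul hS g h) (crossRel_comul hS g h)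

theorem comulHom_inlₗ (g h : AutPair k H) (p : Dual k H) :
    comulHom hS g h (Crossed.inlₗ hS (g * h) p) = comulInl hS g h p :=
  Crossed.lift_inlₗ ..

theorem comulHom_inr (g h : AutPair k H) (x : H) :
    comulHom hS g h (Crossed.inr hS (g * h) x) = comulInr hS g h x :=
  Crossed.lift_inr ..

/-- Transfers multiplicativity to the prescribed map `dtComul`. -/
theorem comulHom_toLinearMap (g h : AutPair k H) :
    (comulHom hS g h).toLinearMap = dtComul hS g h := by
  ext x
  obtain ⟨x, rfl⟩ := (Crossed.equiv hS (g * h)).surjective x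
  induction x using TensorProduct.induction_on with
  | zero => simp
  | add a b ha hb => simp only [map_add]; rw [ha, hb]
  | tmul p x =>
    change comulInl hS g h p * comulInr hS g h x = _
    rw [comulInl_apply, comulInr_apply]
    simp only [dtComul, LinearMap.comp_apply, LinearEquiv.coe_coe, LinearEquiv.symm_apply_apply,
      TensorProduct.map_tmul]
    generalize dualComul p = P
    generalize comul (R := k) x = X
    induction P using TensorProduct.induction_on with
    | zero => simp
    | add a b ha hb => simp only [map_add, add_mul, TensorProduct.add_tmul]; rw [ha, hb]
    | tmul p q =>
      induction X using TensorProduct.induction_on with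
      | zero => simp
      | add a b ha hb => simp only [map_add, mul_add, TensorProduct.tmul_add]; rw [ha, hb]
      | tmul x y => simp [Crossed.equiv_tmul]

theorem dualComul_map_coassoc {A B C : Type*} [AddCommGroup A] [Module k A] [AddCommGroup B]
    [Module k B] [AddCommGroup C] [Module k C] (f₁ : Dual k H →ₗ[k] A) (f₂ : Dual k H →ₗ[k] B)
    (f₃ : Dual k H →ₗ[k] C) (p : Dual k H) :
    TensorProduct.assoc k A B C (TensorProduct.map
      (TensorProduct.map f₁ f₂ ∘ₗ (TensorProduct.comm k _ _).toLinearMap ∘ₗ dualComul) f₃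
        (TensorProduct.comm k _ _ (dualComul p))) =
      TensorProduct.map f₁
        (TensorProduct.map f₂ f₃ ∘ₗ (TensorProduct.comm k _ _).toLinearMap ∘ₗ dualComul)
          (TensorProduct.comm k _ _ (dualComul p)) := by
  let Z : Dual k H ⊗[k] (Dual k H ⊗[k] Dual k H) →ₗ[k] A ⊗[k] (B ⊗[k] C) :=
    TensorProduct.map f₁ (TensorProduct.map f₂ f₃) ∘ₗ
    (TensorProduct.assoc k _ _ _).toLinearMap ∘ₗ
    (TensorProduct.comm k (Dual k H) (Dual k H)).toLinearMap.rTensor _ ∘ₗ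
    (TensorProduct.comm k _ _).toLinearMap
  -- `Z` reverses the order of three tensor factors: the coproduct used is opposite to that of
  -- `H^*`, so its coassociativity is that of `H^*` read backwards.
  trans Z ((dualComul (k := k)).lTensor (Dual k H) (dualComul p))
  · generalize dualComul p = P
    induction P using TensorProduct.induction_on with
    | zero => simp
    | add a b ha hb => simp only [map_add]; rw [ha, hb]
    | tmul p q =>
      simp only [TensorProduct.comm_tmul, TensorProduct.map_tmul,
        LinearMap.lTensor_tmul, LinearMap.comp_apply, LinearEquiv.coe_coe]
      generalize dualComul q = Q
      induction Q using TensorProduct.induction_on with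
      | zero => simp
      | add a b ha hb =>
        simp only [map_add, TensorProduct.add_tmul, TensorProduct.tmul_add]; rw [ha, hb]
      | tmul q q' => simp [Z]
  · rw [← dualComul_coassoc]
    generalize dualComul p = P
    induction P using TensorProduct.induction_on with
    | zero => simp
    | add a b ha hb => simp only [map_add]; rw [ha, hb]
    | tmul p q =>
      simp only [TensorProduct.comm_tmul, TensorProduct.map_tmul, LinearMap.rTensor_tmul,
        LinearMap.comp_apply, LinearEquiv.coe_coe]
      generalize dualComul p = Q
      induction Q using TensorProduct.induction_on with
      | zero => simp
      | add a b ha hb =>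
        simp only [map_add, TensorProduct.add_tmul, TensorProduct.tmul_add]; rw [ha, hb]
      | tmul q q' => simp [Z]

theorem comulHom_comp_inlₗ (g h : AutPair k H) :
    (comulHom hS g h).toLinearMap ∘ₗ Crossed.inlₗ hS (g * h) = comulInl hS g h :=
  LinearMap.ext (comulHom_inlₗ hS g h)

theorem comulHom_comp_inr (g h : AutPair k H) :
    (comulHom hS g h).toLinearMap ∘ₗ (Crossed.inr hS (g * h)).toLinearMap =
      (comulInr hS g h).toLinearMap :=
  LinearMap.ext (comulHom_inr hS g h)

end Axioms

/-! ### Coassociativity. -/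

section CoalgebraAxioms

variable {k H : Type*} [Field k] [Ring H] [HopfAlgebra k H] [FiniteDimensional k H]
variable (hS : Function.Bijective (HopfAlgebra.antipode k (A := H)))

theorem dtComul_coassoc (a b c : AutPair k H) (x : Crossed hS (a * b * c)) :
    TensorProduct.assoc k (Crossed hS a) (Crossed hS b) (Crossed hS c)
        ((dtComul hS a b).rTensor (Crossed hS c) (dtComul hS (a * b) c x)) =
      (dtComul hS b c).lTensor (Crossed hS a)
        (dtComul hS a (b * c) (AlgEquiv.cast (R := k) (A := Crossed hS) (mul_assoc a b c) x)) := by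
  simp only [← comulHom_toLinearMap]
  let C : Crossed hS (a * b * c) ≃ₐ[k] Crossed hS (a * (b * c)) :=
    AlgEquiv.cast (R := k) (A := Crossed hS) (mul_assoc a b c)
  -- Both sides are algebra maps, so they are compared on `H^*` and on `H`.
  suffices h : (Algebra.TensorProduct.assoc k k k (Crossed hS a) (Crossed hS b)
      (Crossed hS c)).toAlgHom.comp ((Algebra.TensorProduct.map (comulHom hS a b)
        (AlgHom.id k (Crossed hS c))).comp (comulHom hS (a * b) c)) =
      (Algebra.TensorProduct.map (AlgHom.id k (Crossed hS a)) (comulHom hS b c)).comp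
        ((comulHom hS a (b * c)).comp C.toAlgHom) by
    have := AlgHom.congr_fun h x
    simp only [AlgHom.comp_apply, algTensorMap_id_left, algTensorMap_id_right] at this
    exact this
  refine Crossed.algHom_ext hS _ (fun p => ?_) (fun x => ?_)
  · simp only [AlgHom.comp_apply, algTensorMap_id_left, algTensorMap_id_right]
    have h1 : C.toAlgHom (Crossed.inlₗ hS (a * b * c) p) = Crossed.inlₗ hS (a * (b * c)) p :=
      Crossed.cast_inlₗ hS (mul_assoc a b c) p
    rw [h1, comulHom_inlₗ, comulHom_inlₗ, comulInl_apply, comulInl_apply, LinearMap.rTensor_map,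
      LinearMap.lTensor_map, comulHom_comp_inlₗ, comulHom_comp_inlₗ]
    exact dualComul_map_coassoc _ _ _ p
  · simp only [AlgHom.comp_apply, algTensorMap_id_left, algTensorMap_id_right]
    have h1 : C.toAlgHom (Crossed.inr hS (a * b * c) x) = Crossed.inr hS (a * (b * c)) x :=
      Crossed.cast_inr hS (mul_assoc a b c) x
    -- On `H` the automorphisms in the second and third tensor factors must agree on both sides;
    -- those in the first agree by definition.
    have e1 : b.fst⁻¹ * a.snd * b.fst * c.fst =
        c.fst * ((b * c).fst⁻¹ * a.snd * (b * c).fst) := by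
      simp only [AutPair.mul_fst]; group
    have e2 : c.fst⁻¹ * (a * b).snd * c.fst =
        c.fst⁻¹ * b.snd * c.fst * ((b * c).fst⁻¹ * a.snd * (b * c).fst) := by
      simp only [AutPair.mul_fst, AutPair.mul_snd]; group
    rw [h1, comulHom_inr, comulHom_inr, comulInr_apply, comulInr_apply, LinearMap.rTensor_map,
      LinearMap.lTensor_map, ← LinearMap.comp_assoc, ← LinearMap.comp_assoc, comulHom_comp_inr,
      comulHom_comp_inr, comulInr_comp_aut, comulInr_comp_aut, e1, e2]
    exact comul_map_coassoc _ _ _ x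

end CoalgebraAxioms

/-! ### Counit laws. -/

section CounitAxioms

variable {k H : Type*} [Field k] [Ring H] [HopfAlgebra k H] [FiniteDimensional k H]
variable (hS : Function.Bijective (HopfAlgebra.antipode k (A := H)))

theorem dtCounit_dtComul (a : AutPair k H) (x : Crossed hS a) :
    TensorProduct.lid k (Crossed hS a) ((dtCounit hS).rTensor (Crossed hS a)
      (dtComul hS 1 a (AlgEquiv.cast (R := k) (A := Crossed hS) (one_mul a).symm x))) = x := by
  rw [← comulHom_toLinearMap]
  suffices h : (Algebra.TensorProduct.lid k (Crossed hS a)).toAlgHom.comp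
      ((Algebra.TensorProduct.map (counitHom hS) (AlgHom.id k (Crossed hS a))).comp
        ((comulHom hS 1 a).comp
          (AlgEquiv.cast (R := k) (A := Crossed hS) (one_mul a).symm).toAlgHom)) =
      AlgHom.id k _ from AlgHom.congr_fun h x
  refine Crossed.algHom_ext hS _ (fun p => ?_) (fun x => ?_)
  · change TensorProduct.lid k _ ((dtCounit hS).rTensor _ (comulHom hS 1 a
      (AlgEquiv.cast (R := k) (A := Crossed hS) (one_mul a).symm (Crossed.inlₗ hS _ p)))) =
        Crossed.inlₗ hS _ p
    -- After the flip the counit meets `p ↼ e_i` and returns `p(e_i)`, so the sum is the dual-basis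
    -- expansion of `p`.
    rw [Crossed.cast_inlₗ, comulHom_inlₗ, comulInl_apply, dualComul_eq_sum (finBasis k H)]
    have e : ∀ q, dtCounit hS (Crossed.inlₗ hS 1 q) = q 1 := fun q => by
      simp [dtCounit, Crossed.inlₗ_apply, Dual.eval_apply]
    conv_rhs => rw [← (finBasis k H).sum_dual_apply_smul_coord p]
    simp only [map_sum, map_smul, TensorProduct.comm_tmul, TensorProduct.map_tmul,
      LinearMap.rTensor_tmul, e, TensorProduct.lid_tmul, hitRight_apply, mul_one]
  · change TensorProduct.lid k _ ((dtCounit hS).rTensor _ (comulHom hS 1 a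
      (AlgEquiv.cast (R := k) (A := Crossed hS) (one_mul a).symm (Crossed.inr hS _ x)))) =
        Crossed.inr hS _ x
    rw [Crossed.cast_inr, comulHom_inr, comulInr_apply]
    have e1 : a.fst⁻¹ * (1 : AutPair k H).snd * a.fst = 1 := by
      simp only [AutPair.one_snd]; group
    have e : ∀ y, dtCounit hS (Crossed.inr hS 1 y) = counit (R := k) y := fun q => by
      simp [dtCounit, Crossed.inr_apply, Dual.eval_apply]
    have e2 : ∀ T : H ⊗[k] H, TensorProduct.lid k _ ((dtCounit hS).rTensor _
        (TensorProduct.map ((Crossed.inr hS 1).toLinearMap ∘ₗ (a.fst : H →ₗ[k] H))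
      ((Crossed.inr hS a).toLinearMap ∘ₗ ((1 : H ≃ₐc[k] H) : H →ₗ[k] H)) T)) =
      Crossed.inr hS a (TensorProduct.lid k H ((counit (R := k)).rTensor H T)) := by
      intro T
      induction T using TensorProduct.induction_on with
      | zero => simp
      | add a b ha hb => simp only [map_add]; rw [ha, hb]
      | tmul x y =>
        simp only [TensorProduct.map_tmul, LinearMap.rTensor_tmul,
          AlgHom.toLinearMap_apply, LinearMap.comp_apply, TensorProduct.lid_tmul, e, map_smul]
        change counit (R := k) (a.fst x) • _ = _
        rw [counit_aut_apply]
        rfl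
    rw [e1, e2]
    simp

theorem dtComul_dtCounit (a : AutPair k H) (x : Crossed hS a) :
    TensorProduct.rid k (Crossed hS a) ((dtCounit hS).lTensor (Crossed hS a)
      (dtComul hS a 1 (AlgEquiv.cast (R := k) (A := Crossed hS) (mul_one a).symm x))) = x := by
  rw [← comulHom_toLinearMap]
  suffices h : (Algebra.TensorProduct.rid k k (Crossed hS a)).toAlgHom.comp
      ((Algebra.TensorProduct.map (AlgHom.id k (Crossed hS a)) (counitHom hS)).comp
        ((comulHom hS a 1).comp
          (AlgEquiv.cast (R := k) (A := Crossed hS) (mul_one a).symm).toAlgHom)) =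
      AlgHom.id k _ from AlgHom.congr_fun h x
  refine Crossed.algHom_ext hS _ (fun p => ?_) (fun x => ?_)
  · change TensorProduct.rid k _ ((dtCounit hS).lTensor _ (comulHom hS a 1
      (AlgEquiv.cast (R := k) (A := Crossed hS) (mul_one a).symm (Crossed.inlₗ hS _ p)))) =
        Crossed.inlₗ hS _ p
    -- Here the counit meets the other factor, so the expansion with `e_i ⇀ p` is the suitable one.
    rw [Crossed.cast_inlₗ, comulHom_inlₗ, comulInl_apply, dualComul_eq_sum' (finBasis k H)]
    have e : ∀ q, dtCounit hS (Crossed.inlₗ hS 1 q) = q 1 := fun q => by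
      simp [dtCounit, Crossed.inlₗ_apply, Dual.eval_apply]
    conv_rhs => rw [← (finBasis k H).sum_dual_apply_smul_coord p]
    simp only [map_sum, map_smul, TensorProduct.comm_tmul, TensorProduct.map_tmul,
      LinearMap.lTensor_tmul, e, TensorProduct.rid_tmul, hitLeft_apply, one_mul]
  · change TensorProduct.rid k _ ((dtCounit hS).lTensor _ (comulHom hS a 1
      (AlgEquiv.cast (R := k) (A := Crossed hS) (mul_one a).symm (Crossed.inr hS _ x)))) =
        Crossed.inr hS _ x
    rw [Crossed.cast_inr, comulHom_inr, comulInr_apply]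
    have e : ∀ y, dtCounit hS (Crossed.inr hS 1 y) = counit (R := k) y := fun q => by
      simp [dtCounit, Crossed.inr_apply, Dual.eval_apply]
    have e2 : ∀ (f : H ≃ₐc[k] H) (T : H ⊗[k] H), TensorProduct.rid k _ ((dtCounit hS).lTensor _
        (TensorProduct.map ((Crossed.inr hS a).toLinearMap ∘ₗ ((1 : H ≃ₐc[k] H) : H →ₗ[k] H))
      ((Crossed.inr hS 1).toLinearMap ∘ₗ (f : H →ₗ[k] H)) T)) =
      Crossed.inr hS a (TensorProduct.rid k H ((counit (R := k)).lTensor H T)) := by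
      intro f T
      induction T using TensorProduct.induction_on with
      | zero => simp
      | add a b ha hb => simp only [map_add]; rw [ha, hb]
      | tmul x y =>
        simp only [TensorProduct.map_tmul, LinearMap.lTensor_tmul,
          AlgHom.toLinearMap_apply, LinearMap.comp_apply, TensorProduct.rid_tmul, e, map_smul]
        change counit (R := k) (f y) • _ = _
        rw [counit_aut_apply]
        rfl
    rw [AutPair.one_fst, e2]
    simp

end CounitAxioms

/-! ### Laws of the conjugation. -/

section ConjAxioms

variable {k H : Type*} [Field k] [Ring H] [HopfAlgebra k H]
variable (hS : Function.Bijective (HopfAlgebra.antipode k (A := H)))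

theorem dtConj_inlₗ (g h : AutPair k H) (p : Dual k H) : dtConj hS g h (Crossed.inlₗ hS h p) =
    Crossed.inlₗ hS _ (Dual.transpose ((g.snd * g.fst⁻¹ : H ≃ₐc[k] H) : H →ₗ[k] H) p) := by
  rw [← conjHom_toLinearMap]
  exact conjHom_inlₗ hS g h p

theorem dtConj_inr (g h : AutPair k H) (x : H) : dtConj hS g h (Crossed.inr hS h x) =
    Crossed.inr hS _ ((g.fst * h.fst⁻¹ * g.snd⁻¹ * h.fst) x) := by
  rw [← conjHom_toLinearMap]
  exact conjHom_inr hS g h x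

theorem dtConj_comp_inr (g h : AutPair k H) (f : H ≃ₐc[k] H) :
    dtConj hS g h ∘ₗ (Crossed.inr hS h).toLinearMap ∘ₗ (f : H →ₗ[k] H) =
      (Crossed.inr hS (g * h * g⁻¹)).toLinearMap ∘ₗ
        ((g.fst * h.fst⁻¹ * g.snd⁻¹ * h.fst * f : H ≃ₐc[k] H) : H →ₗ[k] H) :=
  LinearMap.ext fun x => dtConj_inr hS g h (f x)

theorem dtConj_mul (g h : AutPair k H) (x y : Crossed hS h) :
    dtConj hS g h (x * y) = dtConj hS g h x * dtConj hS g h y := by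
  rw [← conjHom_toLinearMap]
  exact map_mul (conjHom hS g h) x y

theorem dtConj_one (g h : AutPair k H) : dtConj hS g h 1 = 1 := by
  rw [← conjHom_toLinearMap]
  exact map_one (conjHom hS g h)

theorem aut_bijective (f : H ≃ₐc[k] H) : Function.Bijective (f : H →ₗ[k] H) :=
  ⟨fun _ _ h => f.injective h, fun y => f.surjective y⟩

theorem dtConj_bijective (g h : AutPair k H) : Function.Bijective (dtConj hS g h) := by
  let E₁ := (LinearEquiv.ofBijective _ (aut_bijective (g.snd * g.fst⁻¹))).dualMap
  let E₂ := LinearEquiv.ofBijective _ (aut_bijective (g.fst * h.fst⁻¹ * g.snd⁻¹ * h.fst))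
  have e : dtConj hS g h = ((Crossed.equiv hS h).symm ≪≫ₗ TensorProduct.congr E₁ E₂ ≪≫ₗ
      Crossed.equiv hS (g * h * g⁻¹)).toLinearMap := rfl
  rw [e]
  exact LinearEquiv.bijective _

theorem transpose_transpose (f f' : H ≃ₐc[k] H) (p : Dual k H) :
    Dual.transpose (f : H →ₗ[k] H) (Dual.transpose (f' : H →ₗ[k] H) p) =
      Dual.transpose ((f' * f : H ≃ₐc[k] H) : H →ₗ[k] H) p := rfl

theorem aut_aut_apply (f f' : H ≃ₐc[k] H) (x : H) : f (f' x) = (f * f') x := rfl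

theorem dtConj_dtConj (c d a : AutPair k H) (e : c * (d * a * d⁻¹) * c⁻¹ = c * d * a * (c * d)⁻¹)
    (x : Crossed hS a) : dtConj hS (c * d) a x =
      AlgEquiv.cast (R := k) (A := Crossed hS) e
        (dtConj hS c (d * a * d⁻¹) (dtConj hS d a x)) := by
  induction x using Crossed.induction_on with
  | zero => simp only [map_zero]
  | add x y hx hy => simp only [map_add]; rw [hx, hy]
  | mul p x =>
    simp only [dtConj_mul, map_mul, dtConj_inlₗ, dtConj_inr, Crossed.cast_inlₗ, Crossed.cast_inr,
      transpose_transpose, aut_aut_apply]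
    -- `(α, β) ↦ βα⁻¹` reverses products, and so does transposition; together they preserve the
    -- order.
    have e1 : (c * d).snd * (c * d).fst⁻¹ = d.snd * d.fst⁻¹ * (c.snd * c.fst⁻¹) := by
      simp only [AutPair.mul_fst, AutPair.mul_snd]; group
    have e2 : (c * d).fst * a.fst⁻¹ * (c * d).snd⁻¹ * a.fst =
        c.fst * (d * a * d⁻¹).fst⁻¹ * c.snd⁻¹ * (d * a * d⁻¹).fst *
          (d.fst * a.fst⁻¹ * d.snd⁻¹ * a.fst) := by
      simp only [AutPair.mul_fst, AutPair.mul_snd, AutPair.inv_fst]; group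
    rw [e1, e2]

theorem dtCounit_inlₗ (p : Dual k H) : dtCounit hS (Crossed.inlₗ hS 1 p) = p 1 := by
  simp [dtCounit, Crossed.inlₗ_apply, Dual.eval_apply]

theorem dtCounit_inr (x : H) : dtCounit hS (Crossed.inr hS 1 x) = counit (R := k) x := by
  simp [dtCounit, Crossed.inr_apply, Dual.eval_apply]

theorem dtCounit_mul (x y : Crossed hS (1 : AutPair k H)) :
    dtCounit hS (x * y) = dtCounit hS x * dtCounit hS y :=
  map_mul (counitHom hS) x y

theorem dtCounit_one : dtCounit hS (1 : Crossed hS (1 : AutPair k H)) = 1 :=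
  map_one (counitHom hS)

theorem dtCounit_dtConj (c : AutPair k H) (e : c * 1 * c⁻¹ = 1) (x : Crossed hS (1 : AutPair k H)) :
    dtCounit hS (AlgEquiv.cast (R := k) (A := Crossed hS) e (dtConj hS c 1 x)) =
      dtCounit hS x := by
  induction x using Crossed.induction_on with
  | zero => simp only [map_zero]
  | add x y hx hy => simp only [map_add]; rw [hx, hy]
  | mul p x =>
    simp only [dtConj_mul, map_mul, dtConj_inlₗ, dtConj_inr, Crossed.cast_inlₗ, Crossed.cast_inr,
      dtCounit_mul, dtCounit_inlₗ, dtCounit_inr, counit_aut_apply]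
    congr 1
    exact congrArg p (map_one (c.snd * c.fst⁻¹))

theorem map_dtConj_mul (c a b : AutPair k H) (x y : Crossed hS a ⊗[k] Crossed hS b) :
    TensorProduct.map (dtConj hS c a) (dtConj hS c b) (x * y) =
      TensorProduct.map (dtConj hS c a) (dtConj hS c b) x *
        TensorProduct.map (dtConj hS c a) (dtConj hS c b) y := by
  rw [← conjHom_toLinearMap, ← conjHom_toLinearMap]
  exact map_mul (Algebra.TensorProduct.map (conjHom hS c a) (conjHom hS c b)) x y

theorem Crossed.cast_mul {g g' : AutPair k H} (h : g = g') (x y : Crossed hS g) :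
    AlgEquiv.cast (R := k) (A := Crossed hS) h (x * y) =
      AlgEquiv.cast (R := k) (A := Crossed hS) h x *
        AlgEquiv.cast (R := k) (A := Crossed hS) h y := by
  subst h; rfl

variable [FiniteDimensional k H]

theorem dtComul_inlₗ (g h : AutPair k H) (p : Dual k H) :
    dtComul hS g h (Crossed.inlₗ hS (g * h) p) = comulInl hS g h p := by
  rw [← comulHom_toLinearMap]
  exact comulHom_inlₗ hS g h p

theorem dtComul_inr (g h : AutPair k H) (x : H) :
    dtComul hS g h (Crossed.inr hS (g * h) x) = comulInr hS g h x := by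
  rw [← comulHom_toLinearMap]
  exact comulHom_inr hS g h x

theorem dtComul_mul (g h : AutPair k H) (x y : Crossed hS (g * h)) :
    dtComul hS g h (x * y) = dtComul hS g h x * dtComul hS g h y := by
  rw [← comulHom_toLinearMap]
  exact map_mul (comulHom hS g h) x y

theorem dtComul_one (g h : AutPair k H) : dtComul hS g h 1 = 1 := by
  rw [← comulHom_toLinearMap]
  exact map_one (comulHom hS g h)

theorem map_dtConj_dtComul (c a b : AutPair k H)
    (e : c * (a * b) * c⁻¹ = c * a * c⁻¹ * (c * b * c⁻¹)) (x : Crossed hS (a * b)) :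
    TensorProduct.map (dtConj hS c a) (dtConj hS c b) (dtComul hS a b x) =
      dtComul hS (c * a * c⁻¹) (c * b * c⁻¹)
        (AlgEquiv.cast (R := k) (A := Crossed hS) e (dtConj hS c (a * b) x)) := by
  induction x using Crossed.induction_on with
  | zero => simp only [map_zero]
  | add x y hx hy => simp only [map_add]; rw [hx, hy]
  | mul p x =>
    rw [dtConj_mul, Crossed.cast_mul, dtConj_inlₗ, dtConj_inr, Crossed.cast_inlₗ, Crossed.cast_inr,
      dtComul_mul, dtComul_mul, map_dtConj_mul]
    simp only [dtComul_inlₗ, dtComul_inr]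
    congr 1
    · rw [comulInl_apply, comulInl_apply, dualComul_transpose, ← TensorProduct.map_comm
        (Dual.transpose ((c.snd * c.fst⁻¹ : H ≃ₐc[k] H) : H →ₗ[k] H))]
      rw [TensorProduct.map_map, TensorProduct.map_map]
      congr 2
      · ext p; exact dtConj_inlₗ hS c a p
      · ext p; exact dtConj_inlₗ hS c b p
    · have e1 : c.fst * a.fst⁻¹ * c.snd⁻¹ * a.fst * b.fst = (c * b * c⁻¹).fst *
            (c.fst * (a * b).fst⁻¹ * c.snd⁻¹ * (a * b).fst) := by
        simp only [AutPair.mul_fst, AutPair.inv_fst]; group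
      have e2 : c.fst * b.fst⁻¹ * c.snd⁻¹ * b.fst * (b.fst⁻¹ * a.snd * b.fst) =
            ((c * b * c⁻¹).fst⁻¹ * (c * a * c⁻¹).snd * (c * b * c⁻¹).fst) *
            (c.fst * (a * b).fst⁻¹ * c.snd⁻¹ * (a * b).fst) := by
        simp only [AutPair.mul_fst, AutPair.mul_snd, AutPair.inv_fst, AutPair.inv_snd]; group
      have e3 := LinearMap.congr_fun (comulInr_comp_aut hS (c * a * c⁻¹) (c * b * c⁻¹)
        (c.fst * (a * b).fst⁻¹ * c.snd⁻¹ * (a * b).fst)) x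
      rw [← e1, ← e2] at e3
      refine Eq.trans ?_ e3.symm
      rw [comulInr_apply, TensorProduct.map_map, dtConj_comp_inr, dtConj_comp_inr]
      rfl

end ConjAxioms

/-! ### The antipode on the `H^*` part. -/

section AntipodeAxioms

variable {k H : Type*} [Field k] [Ring H] [HopfAlgebra k H]
variable (hS : Function.Bijective (HopfAlgebra.antipode k (A := H)))

theorem dtAntipode_mul (g : AutPair k H) (p : Dual k H) (x : H) :
    dtAntipode hS g (Crossed.inlₗ hS g p * Crossed.inr hS g x) =
      Crossed.inr hS g⁻¹ ((g.fst * g.snd) (HopfAlgebra.antipode k x)) *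
        Crossed.inlₗ hS g⁻¹ (Dual.transpose (antipodeInv hS).toLinearMap p) := by
  rw [← Crossed.equiv_tmul]
  rfl

variable [FiniteDimensional k H]

/-- At `x` the left side is `p₂(S⁻¹(x₁)) p₁(x₂) = p(x₂ S⁻¹(x₁))`. It is `S⁻¹` and not `S` that
works, because the coproduct of `H^*` is flipped. -/
theorem dualMul_antipodeInv_left (p : Dual k H) :
    LinearMap.mul' k (WithConv (H →ₗ[k] k)) (TensorProduct.map
      ((WithConv.linearEquiv k (H →ₗ[k] k)).symm.toLinearMap ∘ₗ
        Dual.transpose (antipodeInv hS).toLinearMap)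
      (WithConv.linearEquiv k (H →ₗ[k] k)).symm.toLinearMap
      (TensorProduct.comm k _ _ (dualComul p))) = p 1 • 1 := by
  ext x
  have e : ∀ P : Dual k H ⊗[k] Dual k H, (LinearMap.mul' k (WithConv (H →ₗ[k] k))
      (TensorProduct.map ((WithConv.linearEquiv k (H →ₗ[k] k)).symm.toLinearMap ∘ₗ
        Dual.transpose (antipodeInv hS).toLinearMap)
      (WithConv.linearEquiv k (H →ₗ[k] k)).symm.toLinearMap
      (TensorProduct.comm k _ _ P))).ofConv x = TensorProduct.dualDistrib k H H P
        ((antipodeInv hS).toLinearMap.lTensor H (TensorProduct.comm k H H (comul x))) := by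
    intro P
    induction P using TensorProduct.induction_on with
    | zero => simp
    | add a b ha hb => simp only [map_add, WithConv.ofConv_add, LinearMap.add_apply]; rw [ha, hb]
    | tmul p q =>
      simp only [TensorProduct.comm_tmul, TensorProduct.map_tmul, LinearMap.mul'_apply]
      refine (dualMul_apply _ _ x).trans ?_
      generalize comul (R := k) x = X
      induction X using TensorProduct.induction_on with
      | zero => simp
      | add a b ha hb => simp only [map_add]; rw [ha, hb]
      | tmul a b =>
        simp [Dual.transpose_apply, mul_comm]
  refine (e _).trans ?_
  rw [dualDistrib_dualComul, LinearMap.comp_apply, mul_antipodeInv_comul]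
  simp [Algebra.algebraMap_eq_smul_one, mul_comm]

/-- Here the value at `x` is `p(S⁻¹(x₂) x₁)`. -/
theorem dualMul_antipodeInv_right (p : Dual k H) :
    LinearMap.mul' k (WithConv (H →ₗ[k] k)) (TensorProduct.map
      (WithConv.linearEquiv k (H →ₗ[k] k)).symm.toLinearMap
      ((WithConv.linearEquiv k (H →ₗ[k] k)).symm.toLinearMap ∘ₗ
        Dual.transpose (antipodeInv hS).toLinearMap)
      (TensorProduct.comm k _ _ (dualComul p))) = p 1 • 1 := by
  ext x
  have e : ∀ P : Dual k H ⊗[k] Dual k H, (LinearMap.mul' k (WithConv (H →ₗ[k] k))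
      (TensorProduct.map (WithConv.linearEquiv k (H →ₗ[k] k)).symm.toLinearMap
        ((WithConv.linearEquiv k (H →ₗ[k] k)).symm.toLinearMap ∘ₗ
        Dual.transpose (antipodeInv hS).toLinearMap)
      (TensorProduct.comm k _ _ P))).ofConv x = TensorProduct.dualDistrib k H H P
        ((antipodeInv hS).toLinearMap.rTensor H (TensorProduct.comm k H H (comul x))) := by
    intro P
    induction P using TensorProduct.induction_on with
    | zero => simp
    | add a b ha hb => simp only [map_add, WithConv.ofConv_add, LinearMap.add_apply]; rw [ha, hb]
    | tmul p q =>
      simp only [TensorProduct.comm_tmul, TensorProduct.map_tmul, LinearMap.mul'_apply]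
      refine (dualMul_apply _ _ x).trans ?_
      generalize comul (R := k) x = X
      induction X using TensorProduct.induction_on with
      | zero => simp
      | add a b ha hb => simp only [map_add]; rw [ha, hb]
      | tmul a b =>
        simp [Dual.transpose_apply, mul_comm]
  refine (e _).trans ?_
  rw [dualDistrib_dualComul, LinearMap.comp_apply, antipodeInv_mul_comul]
  simp [Algebra.algebraMap_eq_smul_one, mul_comm]

end AntipodeAxioms

/-! ### The antipode laws. -/

section AntipodeLaws

variable {k H : Type*} [Field k] [Ring H] [HopfAlgebra k H]
variable (hS : Function.Bijective (HopfAlgebra.antipode k (A := H)))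

/-- Automorphisms commute with `S`, so the condition `e` allows `f₂` to be pulled out of `S(x₁) x₂`.
-/
theorem inr_antipode_mul (g : AutPair k H) (f f₁ f₂ : H ≃ₐc[k] H) (e : f * f₁ = f₂) (x : H) :
    LinearMap.mul' k _ (TensorProduct.map
      ((Crossed.inr hS g).toLinearMap ∘ₗ (f : H →ₗ[k] H) ∘ₗ HopfAlgebra.antipode k ∘ₗ
        (f₁ : H →ₗ[k] H)) ((Crossed.inr hS g).toLinearMap ∘ₗ (f₂ : H →ₗ[k] H)) (comul x)) =
      counit (R := k) x • (1 : Crossed hS g) := by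
  have h : ∀ T : H ⊗[k] H, LinearMap.mul' k _ (TensorProduct.map
      ((Crossed.inr hS g).toLinearMap ∘ₗ (f : H →ₗ[k] H) ∘ₗ HopfAlgebra.antipode k ∘ₗ
        (f₁ : H →ₗ[k] H)) ((Crossed.inr hS g).toLinearMap ∘ₗ (f₂ : H →ₗ[k] H)) T) =
      Crossed.inr hS g (f₂ (LinearMap.mul' k H ((HopfAlgebra.antipode k).rTensor H T))) := by
    intro T
    induction T using TensorProduct.induction_on with
    | zero => simp
    | add a b ha hb => simp only [map_add]; rw [ha, hb]
    | tmul a b =>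
      have : f (HopfAlgebra.antipode k (f₁ a)) = f₂ (HopfAlgebra.antipode k a) := by
        rw [aut_apply_antipode, aut_apply_antipode, aut_aut_apply, e]
      simp only [TensorProduct.map_tmul, LinearMap.rTensor_tmul, LinearMap.mul'_apply, map_mul,
        ← this]
      rfl
  rw [h, HopfAlgebra.mul_antipode_rTensor_comul_apply, Algebra.algebraMap_eq_smul_one]
  simp

theorem inr_mul_antipode (g : AutPair k H) (f f₁ f₂ : H ≃ₐc[k] H) (e : f * f₂ = f₁) (x : H) :
    LinearMap.mul' k _ (TensorProduct.map
      ((Crossed.inr hS g).toLinearMap ∘ₗ (f₁ : H →ₗ[k] H))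
      ((Crossed.inr hS g).toLinearMap ∘ₗ (f : H →ₗ[k] H) ∘ₗ HopfAlgebra.antipode k ∘ₗ
        (f₂ : H →ₗ[k] H)) (comul x)) =
      counit (R := k) x • (1 : Crossed hS g) := by
  have h : ∀ T : H ⊗[k] H, LinearMap.mul' k _ (TensorProduct.map
      ((Crossed.inr hS g).toLinearMap ∘ₗ (f₁ : H →ₗ[k] H))
      ((Crossed.inr hS g).toLinearMap ∘ₗ (f : H →ₗ[k] H) ∘ₗ HopfAlgebra.antipode k ∘ₗ
        (f₂ : H →ₗ[k] H)) T) =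
      Crossed.inr hS g (f₁ (LinearMap.mul' k H ((HopfAlgebra.antipode k).lTensor H T))) := by
    intro T
    induction T using TensorProduct.induction_on with
    | zero => simp
    | add a b ha hb => simp only [map_add]; rw [ha, hb]
    | tmul a b =>
      have : f (HopfAlgebra.antipode k (f₂ b)) = f₁ (HopfAlgebra.antipode k b) := by
        rw [aut_apply_antipode, aut_apply_antipode, aut_aut_apply, e]
      simp only [TensorProduct.map_tmul, LinearMap.lTensor_tmul, LinearMap.mul'_apply, map_mul,
        ← this]
      rfl
  rw [h, HopfAlgebra.mul_antipode_lTensor_comul_apply, Algebra.algebraMap_eq_smul_one]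
  simp

/-- With `a` a free index the cast is removed by substitution; for `b = a⁻¹` inside the axiom that
would be impossible. -/
theorem cast_dtAntipode_mul {a b : AutPair k H} (e : b⁻¹ = a) (p : Dual k H) (x : H) :
    ((AlgEquiv.cast (R := k) (A := Crossed hS) e).toLinearMap ∘ₗ dtAntipode hS b)
      (Crossed.inlₗ hS b p * Crossed.inr hS b x) =
      Crossed.inr hS a ((b.fst * b.snd) (HopfAlgebra.antipode k x)) *
        Crossed.inlₗ hS a (Dual.transpose (antipodeInv hS).toLinearMap p) := by
  subst e
  exact dtAntipode_mul hS b p x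

variable [FiniteDimensional k H]

theorem inlₗ_antipodeInv_mul (g : AutPair k H) (p : Dual k H) :
    LinearMap.mul' k (Crossed hS g) (TensorProduct.map
      (Crossed.inlₗ hS g ∘ₗ Dual.transpose (antipodeInv hS).toLinearMap)
      (Crossed.inlₗ hS g) (TensorProduct.comm k _ _ (dualComul p))) = p 1 • 1 := by
  have h := congrArg (Crossed.inl hS g) (dualMul_antipodeInv_left hS p)
  rw [map_smul, map_one (Crossed.inl hS g)] at h
  refine Eq.trans ?_ h
  have e : ∀ P : Dual k H ⊗[k] Dual k H, LinearMap.mul' k (Crossed hS g) (TensorProduct.map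
      (Crossed.inlₗ hS g ∘ₗ Dual.transpose (antipodeInv hS).toLinearMap) (Crossed.inlₗ hS g) P) =
      Crossed.inl hS g (LinearMap.mul' k (WithConv (H →ₗ[k] k)) (TensorProduct.map
        ((WithConv.linearEquiv k (H →ₗ[k] k)).symm.toLinearMap ∘ₗ
          Dual.transpose (antipodeInv hS).toLinearMap)
        ((WithConv.linearEquiv k (H →ₗ[k] k)).symm.toLinearMap) P)) := by
    intro P
    induction P using TensorProduct.induction_on with
    | zero => simp
    | add a b ha hb => simp only [map_add]; rw [ha, hb]
    | tmul p q => exact (map_mul (Crossed.inl hS g) _ _).symm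
  exact e _

theorem inlₗ_mul_antipodeInv (g : AutPair k H) (p : Dual k H) :
    LinearMap.mul' k (Crossed hS g) (TensorProduct.map (Crossed.inlₗ hS g)
      (Crossed.inlₗ hS g ∘ₗ Dual.transpose (antipodeInv hS).toLinearMap)
      (TensorProduct.comm k _ _ (dualComul p))) = p 1 • 1 := by
  have h := congrArg (Crossed.inl hS g) (dualMul_antipodeInv_right hS p)
  rw [map_smul, map_one (Crossed.inl hS g)] at h
  refine Eq.trans ?_ h
  have e : ∀ P : Dual k H ⊗[k] Dual k H, LinearMap.mul' k (Crossed hS g) (TensorProduct.map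
      (Crossed.inlₗ hS g) (Crossed.inlₗ hS g ∘ₗ Dual.transpose (antipodeInv hS).toLinearMap) P) =
      Crossed.inl hS g (LinearMap.mul' k (WithConv (H →ₗ[k] k)) (TensorProduct.map
        ((WithConv.linearEquiv k (H →ₗ[k] k)).symm.toLinearMap)
        ((WithConv.linearEquiv k (H →ₗ[k] k)).symm.toLinearMap ∘ₗ
          Dual.transpose (antipodeInv hS).toLinearMap) P)) := by
    intro P
    induction P using TensorProduct.induction_on with
    | zero => simp
    | add a b ha hb => simp only [map_add]; rw [ha, hb]
    | tmul p q => exact (map_mul (Crossed.inl hS g) _ _).symm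
  exact e _

/-- The antipode puts its `H` factor on the left, so the two `H^*` factors become adjacent. They
collapse to `p(1)`, and then the two `H` factors collapse to `ε(x)`. -/
theorem mul_dtAntipode_rTensor (a b : AutPair k H) (e : b⁻¹ = a) (e' : 1 = b * a)
    (x : Crossed hS (1 : AutPair k H)) :
    LinearMap.mul' k (Crossed hS a)
        (((AlgEquiv.cast (R := k) (A := Crossed hS) e).toLinearMap ∘ₗ
          dtAntipode hS b).rTensor (Crossed hS a)
          (dtComul hS b a (AlgEquiv.cast (R := k) (A := Crossed hS) e' x))) =
      dtCounit hS x • (1 : Crossed hS a) := by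
  induction x using Crossed.induction_on with
  | zero => simp only [map_zero, zero_smul]
  | add x y hx hy => simp only [map_add, add_smul]; rw [hx, hy]
  | mul p x =>
    rw [Crossed.cast_mul, Crossed.cast_inlₗ, Crossed.cast_inr, dtComul_mul, dtComul_inlₗ,
      dtComul_inr, dtCounit_mul, dtCounit_inlₗ, dtCounit_inr, comulInl_apply, comulInr_apply]
    -- The automorphism `αβ` in the antipode makes the two `H` factors match.
    have hθ : (b.fst * b.snd) * a.fst = a.fst⁻¹ * b.snd * a.fst := by
      subst e; simp only [AutPair.inv_fst]; group
    generalize a.fst⁻¹ * b.snd * a.fst = θ at *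
    generalize hs : (AlgEquiv.cast (R := k) (A := Crossed hS) e).toLinearMap ∘ₗ
      dtAntipode hS b = σ
    have hσ : ∀ p x, σ (Crossed.inlₗ hS b p * Crossed.inr hS b x) =
      Crossed.inr hS a ((b.fst * b.snd) (HopfAlgebra.antipode k x)) *
        Crossed.inlₗ hS a (Dual.transpose (antipodeInv hS).toLinearMap p) := by
      rw [← hs]; exact cast_dtAntipode_mul hS e
    have key : ∀ (P : Dual k H ⊗[k] Dual k H) (X : H ⊗[k] H), LinearMap.mul' k (Crossed hS a)
        (σ.rTensor (Crossed hS a) (TensorProduct.map (Crossed.inlₗ hS b) (Crossed.inlₗ hS a) P *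
          TensorProduct.map ((Crossed.inr hS b).toLinearMap ∘ₗ (a.fst : H →ₗ[k] H))
            ((Crossed.inr hS a).toLinearMap ∘ₗ (θ : H →ₗ[k] H)) X)) =
        LinearMap.mul' k (Crossed hS a) (TensorProduct.map (LinearMap.mulRight k
          (LinearMap.mul' k (Crossed hS a) (TensorProduct.map
            (Crossed.inlₗ hS a ∘ₗ Dual.transpose (antipodeInv hS).toLinearMap)
            (Crossed.inlₗ hS a) P))) LinearMap.id (TensorProduct.map
          ((Crossed.inr hS a).toLinearMap ∘ₗ ((b.fst * b.snd : H ≃ₐc[k] H) : H →ₗ[k] H) ∘ₗ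
            HopfAlgebra.antipode k ∘ₗ (a.fst : H →ₗ[k] H))
          ((Crossed.inr hS a).toLinearMap ∘ₗ (θ : H →ₗ[k] H)) X)) := by
      intro P X
      induction X using TensorProduct.induction_on with
      | zero => simp
      | add a b ha hb => simp only [map_add, mul_add]; rw [ha, hb]
      | tmul x y =>
        induction P using TensorProduct.induction_on with
        | zero => simp
        | add a b ha hb =>
          simp only [map_add, add_mul]; rw [ha, hb]
          simp [mul_add, add_mul]
        | tmul p q =>
          simp only [TensorProduct.map_tmul, Algebra.TensorProduct.tmul_mul_tmul,
            LinearMap.rTensor_tmul, LinearMap.mul'_apply, LinearMap.comp_apply,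
            AlgHom.toLinearMap_apply, hσ, LinearMap.mulRight_apply, LinearMap.id_apply, mul_assoc]
          rfl
    rw [key, inlₗ_antipodeInv_mul, show LinearMap.mulRight k (p 1 • (1 : Crossed hS a)) =
      p 1 • LinearMap.id by ext; simp, TensorProduct.map_smul_left, TensorProduct.map_id,
      LinearMap.smul_apply, map_smul, LinearMap.id_apply, inr_antipode_mul hS a _ _ _ hθ,
      smul_smul]

/-- Now the two `H` factors are adjacent and collapse before those of `H^*`. -/
theorem mul_dtAntipode_lTensor (a b : AutPair k H) (e : b⁻¹ = a) (e' : 1 = a * b)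
    (x : Crossed hS (1 : AutPair k H)) :
    LinearMap.mul' k (Crossed hS a)
        (((AlgEquiv.cast (R := k) (A := Crossed hS) e).toLinearMap ∘ₗ
          dtAntipode hS b).lTensor (Crossed hS a)
          (dtComul hS a b (AlgEquiv.cast (R := k) (A := Crossed hS) e' x))) =
      dtCounit hS x • (1 : Crossed hS a) := by
  induction x using Crossed.induction_on with
  | zero => simp only [map_zero, zero_smul]
  | add x y hx hy => simp only [map_add, add_smul]; rw [hx, hy]
  | mul p x =>
    rw [Crossed.cast_mul, Crossed.cast_inlₗ, Crossed.cast_inr, dtComul_mul, dtComul_inlₗ,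
      dtComul_inr, dtCounit_mul, dtCounit_inlₗ, dtCounit_inr, comulInl_apply, comulInr_apply]
    have hθ : (b.fst * b.snd) * (b.fst⁻¹ * a.snd * b.fst) = b.fst := by
      subst e; simp only [AutPair.inv_snd]; group
    generalize b.fst⁻¹ * a.snd * b.fst = θ at *
    generalize hs : (AlgEquiv.cast (R := k) (A := Crossed hS) e).toLinearMap ∘ₗ
      dtAntipode hS b = σ
    have hσ : ∀ p x, σ (Crossed.inlₗ hS b p * Crossed.inr hS b x) =
      Crossed.inr hS a ((b.fst * b.snd) (HopfAlgebra.antipode k x)) *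
        Crossed.inlₗ hS a (Dual.transpose (antipodeInv hS).toLinearMap p) := by
      rw [← hs]; exact cast_dtAntipode_mul hS e
    have key : ∀ (P : Dual k H ⊗[k] Dual k H) (X : H ⊗[k] H), LinearMap.mul' k (Crossed hS a)
        (σ.lTensor (Crossed hS a) (TensorProduct.map (Crossed.inlₗ hS a) (Crossed.inlₗ hS b) P *
          TensorProduct.map ((Crossed.inr hS a).toLinearMap ∘ₗ (b.fst : H →ₗ[k] H))
            ((Crossed.inr hS b).toLinearMap ∘ₗ (θ : H →ₗ[k] H)) X)) =
        LinearMap.mul' k (Crossed hS a) (TensorProduct.map (LinearMap.mulRight k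
          (LinearMap.mul' k (Crossed hS a) (TensorProduct.map
          ((Crossed.inr hS a).toLinearMap ∘ₗ (b.fst : H →ₗ[k] H))
          ((Crossed.inr hS a).toLinearMap ∘ₗ ((b.fst * b.snd : H ≃ₐc[k] H) : H →ₗ[k] H) ∘ₗ
            HopfAlgebra.antipode k ∘ₗ (θ : H →ₗ[k] H)) X))) LinearMap.id (TensorProduct.map
            (Crossed.inlₗ hS a) (Crossed.inlₗ hS a ∘ₗ
              Dual.transpose (antipodeInv hS).toLinearMap) P)) := by
      intro P X
      induction P using TensorProduct.induction_on with
      | zero => simp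
      | add a b ha hb => simp only [map_add, add_mul]; rw [ha, hb]
      | tmul p q =>
        induction X using TensorProduct.induction_on with
        | zero => simp
        | add a b ha hb =>
          simp only [map_add, mul_add]; rw [ha, hb]
          simp [mul_add, add_mul]
        | tmul x y =>
          simp only [TensorProduct.map_tmul, Algebra.TensorProduct.tmul_mul_tmul,
            LinearMap.lTensor_tmul, LinearMap.mul'_apply, LinearMap.comp_apply,
            AlgHom.toLinearMap_apply, hσ, LinearMap.mulRight_apply, LinearMap.id_apply, mul_assoc]
          rfl
    rw [key, inr_mul_antipode hS a _ _ _ hθ,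
      show LinearMap.mulRight k (counit (R := k) x • (1 : Crossed hS a)) =
      counit (R := k) x • LinearMap.id by ext; simp, TensorProduct.map_smul_left,
      TensorProduct.map_id, LinearMap.smul_apply, map_smul, LinearMap.id_apply,
      inlₗ_mul_antipodeInv, smul_smul, mul_comm]

end AntipodeLaws

/-! ### Assembly of the T-coalgebra. -/

section TCoalgebra

variable {k H : Type*} [Field k] [Ring H] [HopfAlgebra k H] [FiniteDimensional k H]
variable (hS : Function.Bijective (HopfAlgebra.antipode k (A := H)))

theorem dt_isTCoalgebra : (dt hS).IsTCoalgebra := by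
  constructor
  · exact dtComul_one hS
  · exact dtComul_mul hS
  · exact dtComul_coassoc hS
  · exact dtCounit_one hS
  · exact dtCounit_mul hS
  · exact dtCounit_dtComul hS
  · exact dtComul_dtCounit hS
  · intro a x
    have := mul_dtAntipode_rTensor hS a a⁻¹ (inv_inv a) (inv_mul_cancel a).symm x
    exact this
  · intro a x
    have := mul_dtAntipode_lTensor hS a a⁻¹ (inv_inv a) (mul_inv_cancel a).symm x
    exact this
  · exact dtConj_one hS
  · exact dtConj_mul hS
  · exact dtConj_bijective hS
  · exact fun c d a x => dtConj_dtConj hS c d a _ x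
  · exact fun c a b x => map_dtConj_dtComul hS c a b _ x
  · exact fun c x => dtCounit_dtConj hS c _ x

end TCoalgebra

/-! ### The `R`-matrix: invertibility, coproducts and conjugation. -/

section RMatrix

variable {k H : Type*} [Field k] [Ring H] [HopfAlgebra k H]
variable {ι : Type*} [Fintype ι] (e : Basis ι k H)

/-- The coefficient of `e_i ⊗ e_j` in `Δ(e_l)` is the value of `e^i e^j` at `e_l`: the product of
`H^*` is dual to `Δ`. -/
theorem sum_comul_tmul_coord : ∑ i, comul (R := k) (e i) ⊗ₜ[k] e.coord i =
    ∑ i, ∑ j, (e i ⊗ₜ[k] e j) ⊗ₜ[k] dualMul (e.coord i) (e.coord j) := by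
  have h1 : ∀ T : H ⊗[k] H, T = ∑ i, ∑ j,
      LinearMap.mul' k k (TensorProduct.map (e.coord i) (e.coord j) T) • (e i ⊗ₜ[k] e j) := by
    intro T
    induction T using TensorProduct.induction_on with
    | zero => simp
    | add a b ha hb =>
      simp only [map_add, add_smul, Finset.sum_add_distrib]; rw [← ha, ← hb]
    | tmul x y =>
      conv_lhs => rw [← e.sum_repr x, ← e.sum_repr y]
      simp only [TensorProduct.sum_tmul, TensorProduct.tmul_sum, TensorProduct.smul_tmul_smul]
      simpa using Finset.sum_comm
  have h2 : ∀ q : Dual k H, q = ∑ l, q (e l) • e.coord l := fun q =>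
    (e.sum_dual_apply_smul_coord q).symm
  have h3 : ∀ i j, dualMul (e.coord i) (e.coord j) = ∑ l, LinearMap.mul' k k
      (TensorProduct.map (e.coord i) (e.coord j) (comul (R := k) (e l))) • e.coord l :=
    fun i j => h2 _
  simp only [h3, TensorProduct.tmul_sum]
  conv_lhs => enter [2, l]; rw [h1 (comul (R := k) (e l))]
  simp only [TensorProduct.sum_tmul]
  rw [Finset.sum_comm]
  refine Finset.sum_congr rfl fun i _ => ?_
  rw [Finset.sum_comm]
  refine Finset.sum_congr rfl fun j _ => Finset.sum_congr rfl fun l _ => ?_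
  rw [TensorProduct.smul_tmul]

variable (hS : Function.Bijective (HopfAlgebra.antipode k (A := H)))

/-- `∑ i, f(e_i) ⊗ (e^i ⋈ 1)`. -/
def canonicalSum (h : AutPair k H) {A : Type*} [Ring A] [Algebra k A] (f : H →ₗ[k] A) :
    A ⊗[k] Crossed hS h :=
  ∑ i, f (e i) ⊗ₜ[k] Crossed.inlₗ hS h (e.coord i)

/-- Turns convolution identities into identities in `A ⊗ A_h`; this is the previous duality,
followed by `f`, `f'` and the multiplicative inclusion of `H^*`. -/
theorem canonicalSum_mul (h : AutPair k H) {A : Type*} [Ring A] [Algebra k A]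
    (f f' : WithConv (H →ₗ[k] A)) : canonicalSum e hS h (f * f').ofConv =
      canonicalSum e hS h f.ofConv * canonicalSum e hS h f'.ofConv := by
  have := congrArg (TensorProduct.map (LinearMap.mul' k A ∘ₗ TensorProduct.map f.ofConv f'.ofConv)
    (Crossed.inlₗ hS h)) (sum_comul_tmul_coord e)
  simp only [map_sum, TensorProduct.map_tmul, LinearMap.comp_apply, LinearMap.mul'_apply,
    Crossed.inlₗ_dualMul] at this
  simp only [canonicalSum, Finset.sum_mul_sum, Algebra.TensorProduct.tmul_mul_tmul]
  exact this

theorem canonicalSum_one (h : AutPair k H) {A : Type*} [Ring A] [Algebra k A] :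
    canonicalSum e hS h (1 : WithConv (H →ₗ[k] A)).ofConv = 1 := by
  have h1 := (e.sum_dual_apply_smul_coord (counit : H →ₗ[k] k))
  rw [Algebra.TensorProduct.one_def, ← Crossed.inlₗ_counit hS h, ← h1]
  simp only [canonicalSum, map_sum, map_smul, TensorProduct.tmul_sum]
  refine Finset.sum_congr rfl fun i _ => ?_
  rw [← TensorProduct.smul_tmul]
  congr 1
  exact Algebra.algebraMap_eq_smul_one _

theorem canonicalSum_comp (h : AutPair k H) {A : Type*} [Ring A] [Algebra k A] (f : H →ₗ[k] A)
    (u : H →ₗ[k] H) : canonicalSum e hS h (f ∘ₗ u) =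
      ∑ i, f (e i) ⊗ₜ[k] Crossed.inlₗ hS h (Dual.transpose u (e.coord i)) :=
  sum_basis_coord_comp e
    ((TensorProduct.mk k A (Crossed hS h)).compl₂ (Crossed.inlₗ hS h) ∘ₗ f) u

theorem dtR_eq (g h : AutPair k H) : dtR hS e g h = canonicalSum e hS h
    ((Crossed.inr hS g).toLinearMap ∘ₗ ((g.snd⁻¹ : H ≃ₐc[k] H) : H →ₗ[k] H)) := rfl

/-- `R` is the canonical sum of an algebra map `F` on `H`, whose convolution inverse is `F ∘ S`. -/
theorem isUnit_dtR (g h : AutPair k H) : IsUnit (dtR hS e g h) := by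
  let F : H →ₐ[k] Crossed hS g :=
    (Crossed.inr hS g).comp ((g.snd⁻¹ : H ≃ₐc[k] H) : H →ₐ[k] H)
  have h1 : toConv F.toLinearMap * toConv (F.toLinearMap ∘ₗ HopfAlgebra.antipode k) = 1 := by
    have := LinearMap.algHom_comp_convMul_distrib F
      (toConv (LinearMap.id : H →ₗ[k] H)) (toConv (HopfAlgebra.antipode k))
    rw [LinearMap.id_mul_antipode] at this
    refine Eq.trans (WithConv.ext this.symm) ?_
    ext x
    simp
  have h2 : toConv (F.toLinearMap ∘ₗ HopfAlgebra.antipode k) * toConv F.toLinearMap = 1 := by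
    have := LinearMap.algHom_comp_convMul_distrib F
      (toConv (HopfAlgebra.antipode k)) (toConv (LinearMap.id : H →ₗ[k] H))
    rw [LinearMap.antipode_mul_id] at this
    refine Eq.trans (WithConv.ext this.symm) ?_
    ext x
    simp
  have h3 := canonicalSum_mul e hS h (toConv F.toLinearMap)
    (toConv (F.toLinearMap ∘ₗ HopfAlgebra.antipode k))
  have h4 := canonicalSum_mul e hS h
    (toConv (F.toLinearMap ∘ₗ HopfAlgebra.antipode k)) (toConv F.toLinearMap)
  rw [h1, canonicalSum_one] at h3
  rw [h2, canonicalSum_one] at h4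
  exact ⟨⟨_, _, h3.symm, h4.symm⟩, rfl⟩

/-- A conjugation followed by an identification of the index of its target. -/
theorem cast_dtConj_inlₗ {g h h' : AutPair k H} (e : g * h * g⁻¹ = h') (p : Dual k H) :
    ((AlgEquiv.cast (R := k) (A := Crossed hS) e).toLinearMap ∘ₗ dtConj hS g h)
      (Crossed.inlₗ hS h p) =
    Crossed.inlₗ hS h' (Dual.transpose ((g.snd * g.fst⁻¹ : H ≃ₐc[k] H) : H →ₗ[k] H) p) := by
  subst e
  exact dtConj_inlₗ hS g h p

theorem cast_dtConj_inr {g h h' : AutPair k H} (e : g * h * g⁻¹ = h') (x : H) :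
    ((AlgEquiv.cast (R := k) (A := Crossed hS) e).toLinearMap ∘ₗ dtConj hS g h)
      (Crossed.inr hS h x) =
    Crossed.inr hS h' ((g.fst * h.fst⁻¹ * g.snd⁻¹ * h.fst) x) := by
  subst e
  exact dtConj_inr hS g h x

/-- Conjugation transposes an automorphism on `e^i`; moving it to `e_i` yields the inverse second
component of the conjugated index. -/
theorem map_dtConj_dtR (c a b : AutPair k H) :
    TensorProduct.map (dtConj hS c a) (dtConj hS c b) (dtR hS e a b) =
      dtR hS e (c * a * c⁻¹) (c * b * c⁻¹) := by
  have e1 : (c * a * c⁻¹).snd⁻¹ =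
      c.fst * a.fst⁻¹ * c.snd⁻¹ * a.fst * a.snd⁻¹ * (c.snd * c.fst⁻¹) := by
    simp only [AutPair.mul_snd, AutPair.inv_fst, AutPair.inv_snd]; group
  rw [dtR_eq, dtR_eq, e1]
  refine Eq.trans ?_ (canonicalSum_comp e hS (c * b * c⁻¹) ((Crossed.inr hS _).toLinearMap ∘ₗ
    ((c.fst * a.fst⁻¹ * c.snd⁻¹ * a.fst * a.snd⁻¹ : H ≃ₐc[k] H) : H →ₗ[k] H))
    ((c.snd * c.fst⁻¹ : H ≃ₐc[k] H) : H →ₗ[k] H)).symm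
  simp only [canonicalSum, map_sum, TensorProduct.map_tmul, dtConj_inlₗ]
  rw [← dtConj_comp_inr]
  rfl

variable [FiniteDimensional k H]

theorem dtComul_lTensor_dtR (a b c : AutPair k H) :
    (dtComul hS b c).lTensor (Crossed hS a) (dtR hS e a (b * c)) =
      (Algebra.TensorProduct.includeRight :
        Crossed hS c →ₐ[k] Crossed hS b ⊗[k] Crossed hS c).toLinearMap.lTensor (Crossed hS a)
          (dtR hS e a c) *
        (Algebra.TensorProduct.includeLeft :
          Crossed hS b →ₐ[k] Crossed hS b ⊗[k] Crossed hS c).toLinearMap.lTensor (Crossed hS a)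
          (dtR hS e a b) := by
  simp only [dtR_eq, canonicalSum, map_sum, LinearMap.lTensor_tmul, dtComul_inlₗ, comulInl_apply,
    dualComul_eq_sum e, TensorProduct.comm_tmul, TensorProduct.map_tmul, TensorProduct.tmul_sum,
    Finset.sum_mul_sum]
  rw [Finset.sum_comm]
  refine Finset.sum_congr rfl fun i _ => ?_
  -- Since `e^j ↼ e_i` is `e^j` composed with left multiplication by `e_i`, the sum becomes one over
  -- `e_i e_j ⊗ e^j ⊗ e^i`.
  have := sum_basis_coord_comp e ((TensorProduct.mk k (Crossed hS a)
    (Crossed hS b ⊗[k] Crossed hS c)).compl₂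
      ((TensorProduct.mk k (Crossed hS b) (Crossed hS c)).flip (Crossed.inlₗ hS c (e.coord i)) ∘ₗ
        Crossed.inlₗ hS b) ∘ₗ (Crossed.inr hS a).toLinearMap ∘ₗ
        ((a.snd⁻¹ : H ≃ₐc[k] H) : H →ₗ[k] H)) (LinearMap.mulLeft k (e i))
  refine this.symm.trans (Finset.sum_congr rfl fun j _ => ?_)
  rw [Algebra.TensorProduct.tmul_mul_tmul]
  simp only [LinearMap.comp_apply, LinearMap.compl₂_apply, TensorProduct.mk_apply,
    LinearMap.flip_apply, LinearMap.mulLeft_apply, AlgHom.toLinearMap_apply,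
    Algebra.TensorProduct.includeLeft_apply, Algebra.TensorProduct.includeRight_apply,
    Algebra.TensorProduct.tmul_mul_tmul, one_mul, mul_one]
  congr 1
  exact (congrArg (Crossed.inr hS a) (map_mul (a.snd⁻¹ : H ≃ₐc[k] H) (e i) (e j))).trans
    (map_mul _ _ _)

theorem dtComul_rTensor_dtR (a b c : AutPair k H) (h : b⁻¹ * (b * c * b⁻¹) * b⁻¹⁻¹ = c) :
    TensorProduct.assoc k (Crossed hS a) (Crossed hS b) (Crossed hS c)
        ((dtComul hS a b).rTensor (Crossed hS c) (dtR hS e (a * b) c)) =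
      (Algebra.TensorProduct.includeRight :
        Crossed hS c →ₐ[k] Crossed hS b ⊗[k] Crossed hS c).toLinearMap.lTensor (Crossed hS a)
          (((AlgEquiv.cast (R := k) (A := Crossed hS) h).toLinearMap ∘ₗ
              dtConj hS b⁻¹ (b * c * b⁻¹)).lTensor (Crossed hS a)
                (dtR hS e a (b * c * b⁻¹))) *
        ((1 : Crossed hS a) ⊗ₜ[k] dtR hS e b c) := by
  -- The extra factor beside `a.snd⁻¹` is the one that conjugation by `b⁻¹` transposes onto `H^*`;
  -- it accounts for the `φ` in this axiom. In the second tensor factor, `e2` leaves exactly the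
  -- automorphism of `R_{b,c}`.
  have e1 : b.fst * (a * b).snd⁻¹ = a.snd⁻¹ * (b⁻¹.snd * b⁻¹.fst⁻¹) := by
    simp only [AutPair.mul_snd, AutPair.inv_fst, AutPair.inv_snd]; group
  have e2 : b.fst⁻¹ * a.snd * b.fst * (a * b).snd⁻¹ = b.snd⁻¹ := by
    simp only [AutPair.mul_snd]; group
  have h1 : ((AlgEquiv.cast (R := k) (A := Crossed hS) h).toLinearMap ∘ₗ
      dtConj hS b⁻¹ (b * c * b⁻¹)).lTensor (Crossed hS a) (dtR hS e a (b * c * b⁻¹)) =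
      canonicalSum e hS c ((Crossed.inr hS a).toLinearMap ∘ₗ
        ((a.snd⁻¹ * (b⁻¹.snd * b⁻¹.fst⁻¹) : H ≃ₐc[k] H) : H →ₗ[k] H)) := by
    refine Eq.trans ?_ (canonicalSum_comp e hS c ((Crossed.inr hS a).toLinearMap ∘ₗ
      ((a.snd⁻¹ : H ≃ₐc[k] H) : H →ₗ[k] H))
      ((b⁻¹.snd * b⁻¹.fst⁻¹ : H ≃ₐc[k] H) : H →ₗ[k] H)).symm
    simp only [dtR_eq, canonicalSum, map_sum, LinearMap.lTensor_tmul, cast_dtConj_inlₗ]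
  have h2 := comulInr_comp_aut hS a b (a * b).snd⁻¹
  rw [e1, e2] at h2
  rw [h1]
  have h3 := congrArg (TensorProduct.assoc k _ _ _ ∘ TensorProduct.map (TensorProduct.map
    ((Crossed.inr hS a).toLinearMap ∘ₗ
      ((a.snd⁻¹ * (b⁻¹.snd * b⁻¹.fst⁻¹) : H ≃ₐc[k] H) : H →ₗ[k] H))
    ((Crossed.inr hS b).toLinearMap ∘ₗ ((b.snd⁻¹ : H ≃ₐc[k] H) : H →ₗ[k] H)))
    (Crossed.inlₗ hS c)) (sum_comul_tmul_coord e)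
  have h4 : ∀ i, dtComul hS a b (Crossed.inr hS (a * b) ((a * b).snd⁻¹ (e i))) = _ := fun i =>
    (dtComul_inr hS a b _).trans (LinearMap.congr_fun h2 (e i))
  simp only [Function.comp_apply, map_sum, TensorProduct.map_tmul, Crossed.inlₗ_dualMul,
    TensorProduct.assoc_tmul] at h3
  refine Eq.trans ?_ (h3.trans ?_)
  · simp only [dtR_eq, canonicalSum, map_sum, LinearMap.rTensor_tmul]
    exact Finset.sum_congr rfl fun i _ => congrArg
      (fun z => TensorProduct.assoc k _ _ _ (z ⊗ₜ[k] Crossed.inlₗ hS c (e.coord i))) (h4 i)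
  · simp only [dtR_eq, canonicalSum, map_sum, LinearMap.lTensor_tmul, TensorProduct.tmul_sum,
      Finset.sum_mul_sum, Algebra.TensorProduct.tmul_mul_tmul, mul_one, one_mul,
      AlgHom.toLinearMap_apply, Algebra.TensorProduct.includeRight_apply]

end RMatrix

/-! ### Intertwining of the two coproducts by `R`. -/

section Quasitriangular

variable {k H : Type*} [Field k] [Ring H] [HopfAlgebra k H]
variable {ι : Type*} [Fintype ι] (e : Basis ι k H)
variable (hS : Function.Bijective (HopfAlgebra.antipode k (A := H)))

/-- With `R` as a constant this is `R * (U * V) = (V * U') * R`. Transposing a multiplication on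
`e_i` to an action on `e^i` (`h1`, `h2`) writes `U' * R` and `R * U` as sums of constants times `W
i` and `W' i`, and `V` is moved between these by the cross relation of the second factor. -/
theorem dtR_mul_comulInr (a b : AutPair k H) (x : H) :
    dtR hS e a b * comulInr hS a b x =
      TensorProduct.comm k (Crossed hS b) (Crossed hS a) (TensorProduct.map
        ((Crossed.inr hS b).toLinearMap ∘ₗ
          ((b.fst⁻¹ * a.snd * b.fst : H ≃ₐc[k] H) : H →ₗ[k] H))
        ((Crossed.inr hS a).toLinearMap ∘ₗ
          ((a.snd⁻¹ * (b.snd * (b.fst⁻¹ * a.snd * b.fst)) : H ≃ₐc[k] H) : H →ₗ[k] H))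
          (comul x)) * dtR hS e a b := by
  let iL : Crossed hS a →ₐ[k] Crossed hS a ⊗[k] Crossed hS b := Algebra.TensorProduct.includeLeft
  let iR : Crossed hS b →ₐ[k] Crossed hS a ⊗[k] Crossed hS b := Algebra.TensorProduct.includeRight
  have hiL : ∀ y, iL y = y ⊗ₜ[k] 1 := fun _ => rfl
  have hiR : ∀ y, iR y = 1 ⊗ₜ[k] y := fun _ => rfl
  generalize hθ : b.fst⁻¹ * a.snd * b.fst = θ
  -- Writes `γ` as `β⁻¹` of something, so that it merges with `β⁻¹(e_i)`.
  have hγ : b.fst = a.snd⁻¹ * (b.fst * θ) := by rw [← hθ]; group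
  have hI := comulInr_eq_mul hS a b
  rw [hθ] at hI
  set U := toConv (iL.toLinearMap ∘ₗ (Crossed.inr hS a).toLinearMap ∘ₗ (b.fst : H →ₗ[k] H))
  set V := toConv (iR.toLinearMap ∘ₗ (Crossed.inr hS b).toLinearMap ∘ₗ (θ : H →ₗ[k] H))
  set U' := toConv (iL.toLinearMap ∘ₗ (Crossed.inr hS a).toLinearMap ∘ₗ
    ((a.snd⁻¹ * (b.snd * θ) : H ≃ₐc[k] H) : H →ₗ[k] H))
  let r := fun i => iL (Crossed.inr hS a (a.snd⁻¹ (e i)))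
  let W := fun i => toConv (iR.toLinearMap ∘ₗ Crossed.inlₗ hS b ∘ₗ
    (hitRight (k := k) (H := H)).flip (e.coord i) ∘ₗ ((b.snd * θ : H ≃ₐc[k] H) : H →ₗ[k] H))
  let W' := fun i => toConv (iR.toLinearMap ∘ₗ Crossed.inlₗ hS b ∘ₗ
    (hitLeft (k := k) (H := H)).flip (e.coord i) ∘ₗ ((b.fst * θ : H ≃ₐc[k] H) : H →ₗ[k] H))
  have hVW : ∀ i, V * W i = W' i * V := fun i => (Crossed.crossRel hS b).comp iR θ (e.coord i)
  have hVr : ∀ i, V * convConst (r i) = convConst (r i) * V := by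
    intro i
    rw [mul_convConst, convConst_mul]
    ext x
    simp [V, r, iL, iR]
  have hR : dtR hS e a b = ∑ i, Crossed.inr hS a (a.snd⁻¹ (e i)) ⊗ₜ[k]
    Crossed.inlₗ hS b (e.coord i) := rfl
  have h1 : U' * convConst (dtR hS e a b) = ∑ i, convConst (r i) * W i := by
    simp only [mul_convConst, convConst_mul]
    ext x
    have := sum_basis_coord_comp e ((TensorProduct.mk k (Crossed hS a) (Crossed hS b)).compl₂
      (Crossed.inlₗ hS b) ∘ₗ (Crossed.inr hS a).toLinearMap ∘ₗ
        ((a.snd⁻¹ : H ≃ₐc[k] H) : H →ₗ[k] H)) (LinearMap.mulLeft k ((b.snd * θ) x))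
    have h1 : ∀ i, Crossed.inr hS a ((a.snd⁻¹ * (b.snd * θ)) x) *
        Crossed.inr hS a (a.snd⁻¹ (e i)) =
        Crossed.inr hS a (a.snd⁻¹ ((b.snd * θ) x * e i)) := fun i =>
      (map_mul (Crossed.inr hS a) _ _).symm.trans
        (congrArg (Crossed.inr hS a) (map_mul a.snd⁻¹ ((b.snd * θ) x) (e i)).symm)
    refine Eq.trans ?_ (this.trans ?_)
    · refine Eq.trans (congrArg (iL (Crossed.inr hS a ((a.snd⁻¹ * (b.snd * θ)) x)) * ·) hR) ?_
      simp only [Finset.mul_sum, hiL, Algebra.TensorProduct.tmul_mul_tmul, one_mul, h1]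
      rfl
    · rw [WithConv.ofConv_sum, LinearMap.sum_apply]
      refine Finset.sum_congr rfl fun i _ => ?_
      refine Eq.trans ?_ (?_ : r i * iR (Crossed.inlₗ hS b
        (hitRight ((b.snd * θ) x) (e.coord i))) = _)
      · simp only [r, hiL, hiR, Algebra.TensorProduct.tmul_mul_tmul, one_mul, mul_one]
        rfl
      · rfl
  have h2 : ∑ i, convConst (r i) * W' i = convConst (dtR hS e a b) * U := by
    simp only [convConst_mul]
    ext x
    have := sum_basis_coord_comp e ((TensorProduct.mk k (Crossed hS a) (Crossed hS b)).compl₂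
      (Crossed.inlₗ hS b) ∘ₗ (Crossed.inr hS a).toLinearMap ∘ₗ
        ((a.snd⁻¹ : H ≃ₐc[k] H) : H →ₗ[k] H)) (LinearMap.mulRight k ((b.fst * θ) x))
    have h1 : ∀ i, Crossed.inr hS a (a.snd⁻¹ (e i)) *
        Crossed.inr hS a ((a.snd⁻¹ * (b.fst * θ)) x) =
        Crossed.inr hS a (a.snd⁻¹ (e i * (b.fst * θ) x)) := fun i =>
      (map_mul (Crossed.inr hS a) _ _).symm.trans
        (congrArg (Crossed.inr hS a) (map_mul a.snd⁻¹ (e i) ((b.fst * θ) x)).symm)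
    refine Eq.trans ?_ (this.symm.trans ?_)
    · rw [WithConv.ofConv_sum, LinearMap.sum_apply]
      refine Finset.sum_congr rfl fun i _ => ?_
      refine Eq.trans (?_ : _ = r i * iR (Crossed.inlₗ hS b
        (hitLeft ((b.fst * θ) x) (e.coord i)))) ?_
      · rfl
      · simp only [r, hiL, hiR, Algebra.TensorProduct.tmul_mul_tmul, one_mul, mul_one]
        rfl
    · refine Eq.trans ?_ (congrArg (· * iL (Crossed.inr hS a (b.fst x))) hR).symm
      rw [show b.fst x = (a.snd⁻¹ * (b.fst * θ)) x from DFunLike.congr_fun hγ x]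
      simp only [Finset.sum_mul, hiL, Algebra.TensorProduct.tmul_mul_tmul, mul_one, h1]
      rfl
  have key : convConst (dtR hS e a b) * (U * V) = V * U' * convConst (dtR hS e a b) := by
    rw [mul_assoc V, h1, ← mul_assoc, ← h2, Finset.mul_sum, Finset.sum_mul]
    refine Finset.sum_congr rfl fun i _ => ?_
    rw [← mul_assoc, hVr, mul_assoc, mul_assoc, hVW]
  rw [← hI, convConst_mul, mul_convConst] at key
  have hVU : (V * U').ofConv x = TensorProduct.comm k (Crossed hS b) (Crossed hS a)
      (TensorProduct.map ((Crossed.inr hS b).toLinearMap ∘ₗ (θ : H →ₗ[k] H))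
        ((Crossed.inr hS a).toLinearMap ∘ₗ
          ((a.snd⁻¹ * (b.snd * θ) : H ≃ₐc[k] H) : H →ₗ[k] H)) (comul x)) := by
    rw [LinearMap.convMul_apply]
    generalize comul (R := k) x = X
    induction X using TensorProduct.induction_on with
    | zero => simp
    | add a b ha hb => simp only [map_add]; rw [ha, hb]
    | tmul y z => simp [V, U', hiL, hiR]
  have := LinearMap.congr_fun (congrArg ofConv key) x
  rw [← hVU]
  exact this

variable [FiniteDimensional k H]

/-- All factors are canonical sums, so this is the cross relation of the first factor, precomposed
with `β⁻¹`, under the algebra map `canonicalSum`. -/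
theorem dtR_mul_comulInl (a b : AutPair k H) (p : Dual k H) :
    dtR hS e a b * comulInl hS a b p =
      TensorProduct.map (Crossed.inlₗ hS a) (Crossed.inlₗ hS b ∘ₗ
        Dual.transpose ((a.fst * a.snd⁻¹ : H ≃ₐc[k] H) : H →ₗ[k] H)) (dualComul p) *
          dtR hS e a b := by
  have h1 : comulInl hS a b p = canonicalSum e hS b
      (Crossed.inlₗ hS a ∘ₗ (hitRight (k := k) (H := H)).flip p) := by
    rw [comulInl_apply, dualComul_eq_sum e]
    simp only [canonicalSum, map_sum, TensorProduct.comm_tmul, TensorProduct.map_tmul,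
      LinearMap.comp_apply, LinearMap.flip_apply]
  have h2 : TensorProduct.map (Crossed.inlₗ hS a) (Crossed.inlₗ hS b ∘ₗ
        Dual.transpose ((a.fst * a.snd⁻¹ : H ≃ₐc[k] H) : H →ₗ[k] H)) (dualComul p) =
      canonicalSum e hS b ((Crossed.inlₗ hS a ∘ₗ (hitLeft (k := k) (H := H)).flip p) ∘ₗ
        ((a.fst * a.snd⁻¹ : H ≃ₐc[k] H) : H →ₗ[k] H)) := by
    rw [canonicalSum_comp, dualComul_eq_sum' e]
    simp only [map_sum, TensorProduct.map_tmul, LinearMap.comp_apply, LinearMap.flip_apply]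
  have h3 := (Crossed.crossRel hS a).comp (AlgHom.id k _) a.snd⁻¹ p
  rw [mul_inv_cancel] at h3
  have h4 := congrArg (fun u => canonicalSum e hS b (ofConv u)) h3
  simp only [canonicalSum_mul] at h4
  rw [h1, h2, dtR_eq]
  exact h4

theorem dtR_mul_dtComul (a b : AutPair k H) (h : a⁻¹ * (a * b * a⁻¹) * a⁻¹⁻¹ = b)
    (h' : a * b = a * b * a⁻¹ * a) (x : Crossed hS (a * b)) :
    dtR hS e a b * dtComul hS a b x =
      TensorProduct.comm k (Crossed hS b) (Crossed hS a)
        (((AlgEquiv.cast (R := k) (A := Crossed hS) h).toLinearMap ∘ₗ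
              dtConj hS a⁻¹ (a * b * a⁻¹)).rTensor (Crossed hS a)
          (dtComul hS (a * b * a⁻¹) a
            (AlgEquiv.cast (R := k) (A := Crossed hS) h' x))) * dtR hS e a b := by
  generalize hσ : (AlgEquiv.cast (R := k) (A := Crossed hS) h).toLinearMap ∘ₗ
    dtConj hS a⁻¹ (a * b * a⁻¹) = σ
  have hσl : ∀ p, σ (Crossed.inlₗ hS _ p) = Crossed.inlₗ hS b (Dual.transpose
      ((a⁻¹.snd * a⁻¹.fst⁻¹ : H ≃ₐc[k] H) : H →ₗ[k] H) p) := by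
    rw [← hσ]; exact cast_dtConj_inlₗ hS h
  have hσr : ∀ y, σ (Crossed.inr hS _ y) = Crossed.inr hS b
      ((a⁻¹.fst * (a * b * a⁻¹).fst⁻¹ * a⁻¹.snd⁻¹ * (a * b * a⁻¹).fst) y) := by
    rw [← hσ]; exact cast_dtConj_inr hS h
  -- The opposite coproduct is multiplicative too, so the identity for `H^*` and that for `H` may be
  -- applied one after the other.
  have hσm : ∀ u v, TensorProduct.comm k (Crossed hS b) (Crossed hS a)
      (σ.rTensor (Crossed hS a) (u * v)) = TensorProduct.comm k (Crossed hS b) (Crossed hS a)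
      (σ.rTensor (Crossed hS a) u) * TensorProduct.comm k (Crossed hS b) (Crossed hS a)
      (σ.rTensor (Crossed hS a) v) := by
    let F : Crossed hS (a * b * a⁻¹) →ₐ[k] Crossed hS b :=
      (AlgEquiv.cast (R := k) (A := Crossed hS) h).toAlgHom.comp (conjHom hS a⁻¹ (a * b * a⁻¹))
    have hF : F.toLinearMap = σ := by
      rw [← hσ, ← conjHom_toLinearMap]; rfl
    rw [← hF]
    exact map_mul ((Algebra.TensorProduct.comm k (Crossed hS b) (Crossed hS a)).toAlgHom.comp
      (Algebra.TensorProduct.map F (AlgHom.id k (Crossed hS a))))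
  induction x using Crossed.induction_on with
  | zero => simp only [map_zero, mul_zero, zero_mul]
  | add x y hx hy => simp only [map_add, mul_add, add_mul]; rw [hx, hy]
  | mul p x =>
    rw [Crossed.cast_mul, Crossed.cast_inlₗ, Crossed.cast_inr, dtComul_mul, dtComul_mul,
      dtComul_inlₗ, dtComul_inr, dtComul_inlₗ, dtComul_inr, hσm, ← mul_assoc, dtR_mul_comulInl,
      mul_assoc, dtR_mul_comulInr, ← mul_assoc]
    congr 2
    · have e1 : a⁻¹.snd * a⁻¹.fst⁻¹ = a.fst * a.snd⁻¹ := by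
        simp only [AutPair.inv_fst, AutPair.inv_snd]; group
      have e2 : σ ∘ₗ Crossed.inlₗ hS (a * b * a⁻¹) = Crossed.inlₗ hS b ∘ₗ
          Dual.transpose ((a.fst * a.snd⁻¹ : H ≃ₐc[k] H) : H →ₗ[k] H) := by
        rw [← e1]; exact LinearMap.ext hσl
      rw [comulInl_apply, LinearMap.rTensor_map, e2, ← TensorProduct.map_comm,
        TensorProduct.comm_comm]
    · have e1 : a⁻¹.fst * (a * b * a⁻¹).fst⁻¹ * a⁻¹.snd⁻¹ * (a * b * a⁻¹).fst * a.fst =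
          b.fst⁻¹ * a.snd * b.fst := by
        simp only [AutPair.mul_fst, AutPair.inv_fst, AutPair.inv_snd]; group
      have e2 : a.fst⁻¹ * (a * b * a⁻¹).snd * a.fst =
          a.snd⁻¹ * (b.snd * (b.fst⁻¹ * a.snd * b.fst)) := by
        simp only [AutPair.mul_snd, AutPair.inv_fst, AutPair.inv_snd]; group
      have e3 : σ ∘ₗ (Crossed.inr hS (a * b * a⁻¹)).toLinearMap ∘ₗ (a.fst : H →ₗ[k] H) =
          (Crossed.inr hS b).toLinearMap ∘ₗ
            ((b.fst⁻¹ * a.snd * b.fst : H ≃ₐc[k] H) : H →ₗ[k] H) := by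
        refine LinearMap.ext fun y => ?_
        have := hσr (a.fst y)
        rw [aut_aut_apply, e1] at this
        exact this
      rw [comulInr_apply, LinearMap.rTensor_map, e2, e3]

theorem dt_isQuasitriangular : (dt hS).IsQuasitriangular (dtR hS e) := by
  refine ⟨dt_isTCoalgebra hS, ?_, ?_, ?_, ?_, ?_⟩
  · exact isUnit_dtR e hS
  · intro a b x
    have := dtR_mul_dtComul e hS a b (by group) (by group) x
    exact this
  · exact dtComul_lTensor_dtR e hS
  · intro a b c
    have := dtComul_rTensor_dtR e hS a b c (by group)
    exact this
  · exact map_dtConj_dtR e hS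

end Quasitriangular

end

end TurHopf

theorem mainTheorem3 {k H : Type*} [Field k] [Ring H] [HopfAlgebra k H] [FiniteDimensional k H]
    (hS : Function.Bijective (HopfAlgebra.antipode k (A := H)))
    {ι : Type*} [Fintype ι] (e : Module.Basis ι k H) :
    (TurHopf.dt hS).IsQuasitriangular (TurHopf.dtR hS e) :=
  TurHopf.dt_isQuasitriangular e hS
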